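/- **Setting.** Let $\omega:[0,1]\to[0,1]$ satisfy $\omega(0)=0$ and be continuous at $0$, and let $a\in(0,1)$. For each integer $j\ge 0$ let $(\mathcal X_j,d_j)$ be a metric space of diameter at most $1$, equipped with a $\sigma$-algebra (for instance its Borel $\sigma$-algebra), and let $(X_j)_{j\ge 0}$ be a Markov chain, $X_j$ taking values in $\mathcal X_j$. Let $P_j(\cdot\,|\,x)$, $x\in\mathcal X_{j+1}$, be a probability kernel which is the conditional law of $X_j$ given $X_{j+1}=x$. Assume that there is $\delta\in(0,1)$ such that for all $j\ge 0$ and $x,y\in\mathcal X_{j+1}$ $$\|P_j(\cdot\,|\,x)-P_j(\cdot\,|\,y)\|_{TV}\le\delta\,\omega(d_{j+1}(x,y)),\qquad \|P-Q\|_{TV}:=\sup_\Gamma|P(\Gamma)-Q(\Gamma)|.$$ Put $\mathcal X_{j,\infty}=\prod_{k\ge j}\mathcal X_k$ (with the product $\sigma$-algebra), let $\kappa_j$ be the law of $(X_j,X_{j+1},\dots)$ on $\mathcal X_{j,\infty}$, let $\mathcal G_j=\sigma\{X_k:k\ge j\}$, and for $x,y\in\mathcal X_{j,\infty}$ and $g:\mathcal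 X_{j,\infty}\to\mathbb R$ put $$\omega_j(x,y)=\sup_{n\ge0}a^n\omega(d_{j+n}(x_{j+n},y_{j+n})),\qquad \|g\|_{j,\omega}=\|g\|_{L^\infty(\kappa_j)}+\sup_{x\ne y}\frac{|g(x)-g(y)|}{\omega_j(x,y)},$$ with the conventions $0/0=0$ and $c/0=\infty$ for $c>0$. Let $f_j:\mathcal X_{j,\infty}\to\mathbb R$ be measurable functions with $\sup_j\|f_j\|_{j,\omega}<\infty$, and let $S_nf=\sum_{j=0}^{n-1}f_j(X_j,X_{j+1},\dots)$. **Theorem.** The following conditions are equivalent. 1. $\liminf_{n\to\infty}\mathrm{Var}(S_nf)<\infty$. 2. $\sup_n\mathrm{Var}(S_nf)<\infty$. 3. There are measurable functions $u_j,M_j:\mathcal X_{j,\infty}\to\mathbb R$, $j\ge 0$, with $\sup_j\|u_j\|_{j,\omega}<\infty$ and $\sup_j\|M_j\|_{j,\omega}<\infty$, such that $u_j(X_j,X_{j+1},\dots)$ and $M_j(X_j,X_{j+1},\dots)$ have zero mean, $(M_j(X_j,X_{j+1},\dots))_{j\ge0}$ is a reverse martingale difference with respect to $(\mathcal G_j)$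 (it is $\mathcal G_j$-measurable and integrable, with $\mathbb E[M_j(X_j,X_{j+1},\dots)\,|\,\mathcal G_{j+1}]=0$), $\sum_{j\ge0}\mathrm{Var}(M_j(X_j,X_{j+1},\dots))<\infty$, and for every $j\ge0$, almost surely, $$f_j(X_j,\dots)=\mathbb E[f_j(X_j,\dots)]+M_j(X_j,\dots)+u_{j+1}(X_{j+1},\dots)-u_j(X_j,\dots).$$ 4. There are measurable functions $H_j:\mathcal X_{j,\infty}\to\mathbb R$, $j\ge 0$, such that for every $j\ge 0$, $f_j(X_j,X_{j+1},\dots)=H_{j+1}(X_{j+1},X_{j+2},\dots)-H_j(X_j,X_{j+1},\dots)$ almost surely. Moreover, any $(H_j)$ as in (4) satisfies $H_j\in L^s(\kappa_j)$ for all $j$ and all finite $s$. For any $(u_j),(M_j)$ as in (3) and any $j$, the series $\sum_{k\ge j}M_k(X_k,X_{k+1},\dots)$ converges almost surely and in $L^p$ for all finite $p$, and for any $(H_j)$ as in (4), almost surely, $$H_j(X_j,X_{j+1},\dots)=\int H_j\,d\kappa_j+u_j(X_j,X_{j+1},\dots)-\sum_{k\ge j}M_k(X_k,X_{k+1},\dots).$$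 -/

import Mathlib

open MeasureTheory ProbabilityTheory Filter Topology
open scoped ENNReal

/-- The path space `∏_{k ≥ j} 𝒳 k`. -/
abbrev PathFrom (𝒳 : ℕ → Type*) (j : ℕ) : Type _ := (k : Set.Ici j) → 𝒳 k

/-- The random path `(X j, X (j+1), …)`. -/
def tailPath {Ω : Type*} {𝒳 : ℕ → Type*} (X : (k : ℕ) → Ω → 𝒳 k) (j : ℕ) :
    Ω → PathFrom 𝒳 j :=
  fun o k => X k o

/-- The σ-algebra generated by `X k`, `k ≤ n`. -/
abbrev pastSigma {Ω : Type*} {𝒳 : ℕ → Type*} [∀ k, MeasurableSpace (𝒳 k)]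
    (X : (k : ℕ) → Ω → 𝒳 k) (n : ℕ) : MeasurableSpace Ω :=
  ⨆ k : Set.Iic n, MeasurableSpace.comap (X k) inferInstance

/-- The σ-algebra generated by `X k`, `k ≥ j` (the reverse filtration). -/
abbrev futureSigma {Ω : Type*} {𝒳 : ℕ → Type*} [∀ k, MeasurableSpace (𝒳 k)]
    (X : (k : ℕ) → Ω → 𝒳 k) (j : ℕ) : MeasurableSpace Ω :=
  ⨆ k : Set.Ici j, MeasurableSpace.comap (X k) inferInstance

/-- `X` is an (inhomogeneous) Markov chain:
`P(X (n+1) ∈ A | X 0, …, X n) = P(X (n+1) ∈ A | X n)` a.s. -/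
def IsMarkovChain {Ω : Type*} [MeasurableSpace Ω] {𝒳 : ℕ → Type*}
    [∀ k, MeasurableSpace (𝒳 k)] (X : (k : ℕ) → Ω → 𝒳 k) (μ : Measure Ω) : Prop :=
  (∀ k, Measurable (X k)) ∧
  ∀ n, ∀ A : Set (𝒳 (n + 1)), MeasurableSet A →
    μ⟦X (n + 1) ⁻¹' A | pastSigma X n⟧
      =ᵐ[μ] μ⟦X (n + 1) ⁻¹' A | MeasurableSpace.comap (X n) inferInstance⟧

/-- Total variation distance of probability measures, `sup_Γ |P(Γ) - Q(Γ)|` over measurable `Γ`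
(values in `[0, 1]`). -/
noncomputable def tvDistance {S : Type*} [MeasurableSpace S] (P Q : Measure S) : ℝ :=
  ⨆ Γ : {Γ : Set S // MeasurableSet Γ}, |P.real Γ - Q.real Γ|

/-- `ω : [0,1] → [0,1]` with `ω 0 = 0`, continuous at the origin (only the values of `ω` on `[0,1]`
matter). -/
structure IsModulus (ω : ℝ → ℝ) : Prop where
  mapsTo : Set.MapsTo ω (Set.Icc 0 1) (Set.Icc 0 1)
  zero : ω 0 = 0
  continuous_zero : ContinuousWithinAt ω (Set.Icc 0 1) 0

/-- `ω_j(x, y) = sup_{n ≥ 0} a ^ n * ω(d(x_{j+n}, y_{j+n}))`. -/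
noncomputable def pathModulus {𝒳 : ℕ → Type*} [∀ k, MetricSpace (𝒳 k)]
    (a : ℝ) (ω : ℝ → ℝ) (j : ℕ) (x y : PathFrom 𝒳 j) : ℝ :=
  ⨆ n : ℕ, a ^ n * ω (dist (x ⟨j + n, Nat.le_add_right j n⟩) (y ⟨j + n, Nat.le_add_right j n⟩))

/-- `v_{j,ω}(g) = sup { |g x - g y| / ω_j(x, y) : x ≠ y }`, with values in `[0, ∞]`. In `[0, ∞]` one
has `c / 0 = ∞` for `c > 0` and `0 / 0 = 0`, so this is the least `C` such that
`|g x - g y| ≤ C * ω_j(x, y)` for all `x, y`. -/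
noncomputable def variationSeminorm {𝒳 : ℕ → Type*} [∀ k, MetricSpace (𝒳 k)]
    (a : ℝ) (ω : ℝ → ℝ) (j : ℕ) (g : PathFrom 𝒳 j → ℝ) : ℝ≥0∞ :=
  ⨆ (x : PathFrom 𝒳 j) (y : PathFrom 𝒳 j) (_ : x ≠ y),
    ‖g x - g y‖ₑ / ENNReal.ofReal (pathModulus a ω j x y)

/-- `‖g‖_{j,ω} = ‖g‖_{L^∞(κ)} + v_{j,ω}(g)`, with values in `[0, ∞]`. -/
noncomputable def omegaNorm {𝒳 : ℕ → Type*} [∀ k, MetricSpace (𝒳 k)]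
    [∀ k, MeasurableSpace (𝒳 k)] (a : ℝ) (ω : ℝ → ℝ) (j : ℕ) (κ : Measure (PathFrom 𝒳 j))
    (g : PathFrom 𝒳 j → ℝ) : ℝ≥0∞ :=
  eLpNorm g ∞ κ + variationSeminorm a ω j g

/-- Every `g j` is measurable and `sup_j ‖g j‖_{j,ω} < ∞`, where the `L^∞` part is taken with respect
to the law of `(X j, X (j+1), …)`. -/
def IsOmegaRegular {Ω : Type*} [MeasurableSpace Ω] {𝒳 : ℕ → Type*} [∀ k, MetricSpace (𝒳 k)]
    [∀ k, MeasurableSpace (𝒳 k)] (X : (k : ℕ) → Ω → 𝒳 k) (μ : Measure Ω) (a : ℝ) (ω : ℝ → ℝ)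
    (g : (j : ℕ) → PathFrom 𝒳 j → ℝ) : Prop :=
  (∀ j, Measurable (g j)) ∧ ⨆ j, omegaNorm a ω j (μ.map (tailPath X j)) (g j) < ∞

/-- `Y` is a reverse martingale difference for the decreasing sequence of σ-algebras `G`. -/
def IsReverseMartingaleDiff {Ω : Type*} [MeasurableSpace Ω] (μ : Measure Ω)
    (G : ℕ → MeasurableSpace Ω) (Y : ℕ → Ω → ℝ) : Prop :=
  ∀ j, StronglyMeasurable[G j] (Y j) ∧ Integrable (Y j) μ ∧ μ[Y j | G (j + 1)] =ᵐ[μ] 0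

/-- `S_n f = ∑_{j < n} f_j(X j, X (j+1), …)`. -/
def partialSum {Ω : Type*} {𝒳 : ℕ → Type*} (X : (k : ℕ) → Ω → 𝒳 k)
    (f : (j : ℕ) → PathFrom 𝒳 j → ℝ) (n : ℕ) (o : Ω) : ℝ :=
  ∑ j ∈ Finset.range n, f j (tailPath X j o)

/-- `f_j = E f_j + M_j + u_{j+1} - u_j` a.s., where `u` and `M` are centered and `ω`-regular, `M` is a
reverse martingale difference and `∑ Var M_j < ∞`. -/
structure IsMartingaleCoboundaryDecomp {Ω : Type*} [MeasurableSpace Ω] {𝒳 : ℕ → Type*}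
    [∀ k, MetricSpace (𝒳 k)] [∀ k, MeasurableSpace (𝒳 k)]
    (X : (k : ℕ) → Ω → 𝒳 k) (μ : Measure Ω) (a : ℝ) (ω : ℝ → ℝ)
    (f M u : (j : ℕ) → PathFrom 𝒳 j → ℝ) : Prop where
  decomp : ∀ j, ∀ᵐ o ∂μ, f j (tailPath X j o) =
    (∫ o', f j (tailPath X j o') ∂μ) + M j (tailPath X j o)
      + u (j + 1) (tailPath X (j + 1) o) - u j (tailPath X j o)
  regular_u : IsOmegaRegular X μ a ω u
  regular_M : IsOmegaRegular X μ a ω M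
  mean_u : ∀ j, ∫ o, u j (tailPath X j o) ∂μ = 0
  mean_M : ∀ j, ∫ o, M j (tailPath X j o) ∂μ = 0
  martingale : IsReverseMartingaleDiff μ (futureSigma X) fun j o => M j (tailPath X j o)
  summable_var : ∑' j, evariance (fun o => M j (tailPath X j o)) μ < ∞

/-- `f_j(X_j, …) = H_{j+1}(X_{j+1}, …) - H_j(X_j, …)` a.s. with measurable `H_j`. -/
def IsMeasurableCoboundary {Ω : Type*} [MeasurableSpace Ω] {𝒳 : ℕ → Type*}
    [∀ k, MeasurableSpace (𝒳 k)] (X : (k : ℕ) → Ω → 𝒳 k) (μ : Measure Ω)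
    (f H : (j : ℕ) → PathFrom 𝒳 j → ℝ) : Prop :=
  (∀ j, Measurable (H j)) ∧
  ∀ j, ∀ᵐ o ∂μ, f j (tailPath X j o) =
    H (j + 1) (tailPath X (j + 1) o) - H j (tailPath X j o)

/-! Averaging over the first coordinate, `transfer P j`, is conditional expectation given the future
`G_{j+1}`, and it contracts oscillations measured by a weighted form of `pathModulus`. So the
recursion `u_0 = 0`, `u_{j+1} = L_j (f_j - E f_j + u_j)` stays uniformly bounded
(`exists_corrector`), and `M_j = f_j - E f_j + u_j - u_{j+1}` is a bounded reverse martingale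
difference, whatever the variances do (`exists_decomp`). The `M_j` are orthogonal and `S_n f - E S_n
f` differs from `T_n = ∑_{k<n} M_k` by a bounded term, so (1), (2) and summability of `Var M_j` say
the same thing. If the variances are summable, Kolmogorov's inequality gives `R_j = ∑_{k≥j} M_k`,
and `H_j = u_j - R_j + ∑_{k<j} E f_k` solves (4).

The hard direction is (4) ⇒ (3), since `H` is only measurable. It gives `T_n = Z_n - K` with `K =
H_0 - u_0` fixed and `Z_n` measurable for `G_n`, while `T_n` is orthogonal to bounded functions of
`G_n`. For square integrable `K` one would have `E T_n² = -E[T_n K]`, which bounds the variance. For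
general `K` a truncation does the same (`exists_bound_of_sum_eq_sub`), provided `E T_n⁴ ≤ C (1 + E
T_n²)²`.

That moment bound comes from the corrector applied to `M_j²`: it gives `E[∑_{k<n} M_k² | G_n] ≤ E
∑_{k<n} M_k² + const` (`exists_potential_bound`). An induction then controls all moments of the
square function (`integral_mul_icoSq_pow_le`), and a Burkholder type inequality (`integral_pow_le`)
transfers them to the sums. The same moments give `L^p` convergence of the series.

For the formula for `H`, `H_j - u_j + R_j` is the limit of variables depending on ever later
futures, and the contraction makes the tail σ-algebra trivial, so it is constant
(`eq_of_coboundary`). -/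

/-! ### Bounded measurable test functions -/

/-- Bounded real functions measurable with respect to a given σ-algebra. -/
def BddMeas {Ω : Type*} (m : MeasurableSpace Ω) (h : Ω → ℝ) : Prop :=
  Measurable[m] h ∧ ∃ c, ∀ o, |h o| ≤ c

namespace BddMeas

variable {Ω : Type*} {m m' m0 : MeasurableSpace Ω} {g h : Ω → ℝ}

lemma mono (hm : m ≤ m') (hh : BddMeas m h) : BddMeas m' h := ⟨hh.1.mono hm le_rfl, hh.2⟩

lemma const (c : ℝ) : BddMeas m (fun _ => c) := ⟨measurable_const, |c|, fun _ => le_rfl⟩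

lemma add (hg : BddMeas m g) (hh : BddMeas m h) : BddMeas m (fun o => g o + h o) := by
  obtain ⟨c, hc⟩ := hg.2
  obtain ⟨d, hd⟩ := hh.2
  exact ⟨hg.1.add hh.1, c + d, fun o => (abs_add_le _ _).trans (add_le_add (hc o) (hd o))⟩

lemma neg (hg : BddMeas m g) : BddMeas m (fun o => -g o) := by
  obtain ⟨c, hc⟩ := hg.2
  exact ⟨hg.1.neg, c, fun o => by rw [abs_neg]; exact hc o⟩

lemma sub (hg : BddMeas m g) (hh : BddMeas m h) : BddMeas m (fun o => g o - h o) := by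
  simpa only [sub_eq_add_neg] using hg.add hh.neg

lemma mul (hg : BddMeas m g) (hh : BddMeas m h) : BddMeas m (fun o => g o * h o) := by
  obtain ⟨c, hc⟩ := hg.2
  obtain ⟨d, hd⟩ := hh.2
  refine ⟨hg.1.mul hh.1, c * d, fun o => ?_⟩
  rw [abs_mul]
  exact mul_le_mul (hc o) (hd o) (abs_nonneg _) ((abs_nonneg _).trans (hc o))

lemma const_mul (c : ℝ) (hh : BddMeas m h) : BddMeas m (fun o => c * h o) := (const c).mul hh

lemma pow (hg : BddMeas m g) (n : ℕ) : BddMeas m (fun o => g o ^ n) := by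
  obtain ⟨c, hc⟩ := hg.2
  refine ⟨hg.1.pow_const n, c ^ n, fun o => ?_⟩
  rw [abs_pow]
  exact pow_le_pow_left₀ (abs_nonneg _) (hc o) n

lemma sum {ι : Type*} {s : Finset ι} {g : ι → Ω → ℝ} (hg : ∀ i ∈ s, BddMeas m (g i)) :
    BddMeas m (fun o => ∑ i ∈ s, g i o) := by
  classical
  induction s using Finset.induction_on with
  | empty => simpa using const 0
  | insert i s hi ih =>
    simp only [Finset.sum_insert hi]
    exact (hg i (Finset.mem_insert_self _ _)).add
      (ih fun j hj => hg j (Finset.mem_insert_of_mem hj))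

lemma indicator {s : Set Ω} (hs : MeasurableSet[m] s) : BddMeas m (s.indicator fun _ => (1 : ℝ)) := by
  refine ⟨measurable_const.indicator hs, 1, fun o => ?_⟩
  by_cases ho : o ∈ s <;> simp [ho]

lemma integrable {μ : Measure Ω} [IsFiniteMeasure μ] (hg : BddMeas m0 g) : Integrable g μ := by
  obtain ⟨c, hc⟩ := hg.2
  exact Integrable.of_bound hg.1.aestronglyMeasurable c (ae_of_all _ hc)

lemma memLp {μ : Measure Ω} [IsFiniteMeasure μ] (hg : BddMeas m0 g) (p : ℝ≥0∞) : MemLp g p μ := by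
  obtain ⟨c, hc⟩ := hg.2
  exact MemLp.of_bound hg.1.aestronglyMeasurable c (ae_of_all _ hc)

end BddMeas

/-! ### Polynomial inequalities -/

/-- An even power is convex, so it lies above its tangent at `t`. Dividing by `t ^ n` reduces this
to Bernoulli's inequality; where Bernoulli fails, `s / t < -1`, the left side is negative. -/
lemma Even.pow_add_mul_le_pow {n : ℕ} (hn : Even n) (s t : ℝ) :
    t ^ n + n * t ^ (n - 1) * (s - t) ≤ s ^ n := by
  rcases Nat.eq_zero_or_pos n with rfl | hpos
  · simp
  rcases eq_or_ne t 0 with rfl | ht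
  · have : 2 ≤ n := by rcases hn with ⟨k, rfl⟩; omega
    rw [zero_pow hpos.ne', zero_pow (by omega)]
    simpa using hn.pow_nonneg s
  have key : 1 + n * (s / t - 1) ≤ (s / t) ^ n := by
    rcases le_or_gt (-1) (s / t) with h | h
    · exact one_add_mul_sub_le_pow h n
    · have h1 : (1 : ℝ) ≤ n := by exact_mod_cast hpos
      have := hn.pow_nonneg (s / t)
      nlinarith
  have h := mul_le_mul_of_nonneg_left key (hn.pow_nonneg t)
  rw [div_pow, mul_div_cancel₀ _ (pow_ne_zero n ht)] at h
  refine le_trans (le_of_eq ?_) h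
  obtain ⟨k, rfl⟩ : ∃ k, n = k + 1 := ⟨n - 1, by omega⟩
  simp only [Nat.add_sub_cancel]
  field_simp
  ring

/-- Second-order expansion in `y`: convexity at `y + x`, then the mean value bound on `(y + x) ^
(2k+1) - x ^ (2k+1)`. The remainder is expressed through `y + x` rather than `x`: with `y = M i`,
the whole sum starting at `i` is what Jensen's inequality can later compare with longer sums. -/
lemma pow_two_mul_add_two_le (k : ℕ) {x y b : ℝ} (hy : |y| ≤ b) :
    (y + x) ^ (2 * k + 2) ≤ x ^ (2 * k + 2) + (2 * k + 2) * (x ^ (2 * k + 1) * y)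
      + (2 * k + 2) * (2 * k + 1) * 4 ^ k * (y ^ 2 * ((y + x) ^ (2 * k) + b ^ (2 * k))) := by
  set t := y + x with ht
  have h1 := Even.pow_add_mul_le_pow (n := 2 * k + 2) ⟨k + 1, by ring⟩ x t
  have h2 : y * (t ^ (2 * k + 1) - x ^ (2 * k + 1))
      ≤ y ^ 2 * ((2 * k + 1) * (4 ^ k * (t ^ (2 * k) + b ^ (2 * k)))) := by
    have h3 := abs_pow_sub_pow_le t x (2 * k + 1)
    have h4 : max |t| |x| ≤ |t| + b := by
      refine max_le (by linarith [abs_nonneg y]) ?_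
      have : |x| ≤ |t| + |y| := by
        have : x = t - y := by rw [ht]; ring
        rw [this]; exact abs_sub _ _
      linarith
    have h5 : (max |t| |x|) ^ (2 * k) ≤ 4 ^ k * (t ^ (2 * k) + b ^ (2 * k)) := by
      calc (max |t| |x|) ^ (2 * k) ≤ (|t| + b) ^ (2 * k) := pow_le_pow_left₀ (by positivity) h4 _
        _ ≤ 2 ^ (2 * k - 1) * (|t| ^ (2 * k) + b ^ (2 * k)) :=
          add_pow_le (abs_nonneg _) ((abs_nonneg _).trans hy) _
        _ ≤ 2 ^ (2 * k) * (|t| ^ (2 * k) + b ^ (2 * k)) := by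
          have := (even_two_mul k).pow_nonneg b
          gcongr
          · norm_num
          · omega
        _ = _ := by rw [(even_two_mul k).pow_abs, pow_mul]; norm_num
    have h6 : |t - x| = |y| := by rw [ht]; simp
    rw [h6] at h3
    calc y * (t ^ (2 * k + 1) - x ^ (2 * k + 1))
        ≤ |y| * |t ^ (2 * k + 1) - x ^ (2 * k + 1)| := by rw [← abs_mul]; exact le_abs_self _
      _ ≤ |y| * (|y| * ((2 * k + 1 : ℕ) : ℝ) * (max |t| |x|) ^ (2 * k)) := by gcongr; exact h3
      _ ≤ |y| * (|y| * ((2 * k + 1 : ℕ) : ℝ) * (4 ^ k * (t ^ (2 * k) + b ^ (2 * k)))) := by gcongr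
      _ = _ := by rw [← sq_abs y]; push_cast; ring
  have h7 : x - t = -y := by rw [ht]; ring
  rw [h7] at h1
  push_cast at h1
  have h8 := mul_le_mul_of_nonneg_left h2 (show (0 : ℝ) ≤ 2 * k + 2 by positivity)
  nlinarith

/-- Whichever of `c * q` and `t ^ 2` is larger, one of the two terms on the right suffices. A large
`c` lets the `t` term be absorbed. -/
lemma mul_pow_le_young (k : ℕ) {q t c : ℝ} (hq : 0 ≤ q) (hc : 0 < c) :
    q * t ^ (2 * k) ≤ c⁻¹ * t ^ (2 * k + 2) + c ^ k * q ^ (k + 1) := by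
  have h0 := (even_two_mul k).pow_nonneg t
  have h2 : 0 ≤ t ^ (2 * k + 2) := (show Even (2 * k + 2) from ⟨k + 1, by ring⟩).pow_nonneg t
  rcases le_total (c * q) (t ^ 2) with h | h
  · have : q * t ^ (2 * k) ≤ c⁻¹ * t ^ (2 * k + 2) := by
      rw [← div_eq_inv_mul, le_div_iff₀ hc, pow_add]
      nlinarith
    have : 0 ≤ c ^ k * q ^ (k + 1) := by positivity
    linarith
  · have : q * t ^ (2 * k) ≤ c ^ k * q ^ (k + 1) := by
      calc q * t ^ (2 * k) = q * (t ^ 2) ^ k := by rw [pow_mul]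
        _ ≤ q * (c * q) ^ k := by gcongr
        _ = _ := by rw [mul_pow]; ring
    have : 0 ≤ c⁻¹ * t ^ (2 * k + 2) := by positivity
    linarith

/-! ### Moments of reverse martingale sums -/

/-- A uniformly bounded reverse martingale difference sequence. -/
structure IsBddRevMart {Ω : Type*} {m0 : MeasurableSpace Ω} (μ : Measure Ω)
    (G : ℕ → MeasurableSpace Ω) (M : ℕ → Ω → ℝ) (b : ℝ) : Prop where
  anti : Antitone G
  le : ∀ n, G n ≤ m0
  meas : ∀ j, Measurable[G j] (M j)
  bdd : ∀ j o, |M j o| ≤ b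
  -- Testing against bounded functions replaces a vanishing conditional expectation; with bounds
  -- holding everywhere, integrability is automatic.
  orth : ∀ j h, BddMeas (G (j + 1)) h → ∫ o, h o * M j o ∂μ = 0

namespace IsBddRevMart

variable {Ω : Type*} {m0 : MeasurableSpace Ω} {μ : Measure Ω}
  {G : ℕ → MeasurableSpace Ω} {M : ℕ → Ω → ℝ} {b : ℝ}

/-- The partial sum over `Ico j n`. -/
def _root_.icoSum {Ω : Type*} (M : ℕ → Ω → ℝ) (j n : ℕ) (o : Ω) : ℝ := ∑ k ∈ Finset.Ico j n, M k o

/-- The partial square function over `Ico j n`. -/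
def _root_.icoSq {Ω : Type*} (M : ℕ → Ω → ℝ) (j n : ℕ) (o : Ω) : ℝ :=
  ∑ k ∈ Finset.Ico j n, M k o ^ 2

lemma bddMeas (hM : IsBddRevMart μ G M b) (j : ℕ) : BddMeas (G j) (M j) :=
  ⟨hM.meas j, b, hM.bdd j⟩

lemma nonneg [NeZero μ] (hM : IsBddRevMart μ G M b) : 0 ≤ b := by
  obtain ⟨o⟩ := μ.nonempty_of_neZero
  exact (abs_nonneg _).trans (hM.bdd 0 o)

lemma bddMeas_sum (hM : IsBddRevMart μ G M b) (j n : ℕ) : BddMeas (G j) (icoSum M j n) :=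
  BddMeas.sum fun k hk => (hM.bddMeas k).mono (hM.anti (Finset.mem_Ico.1 hk).1)

lemma bddMeas_sq (hM : IsBddRevMart μ G M b) (j n : ℕ) : BddMeas (G j) (icoSq M j n) :=
  BddMeas.sum fun k hk => ((hM.bddMeas k).mono (hM.anti (Finset.mem_Ico.1 hk).1)).pow 2

lemma icoSq_nonneg (j n : ℕ) (o : Ω) : 0 ≤ icoSq M j n o := Finset.sum_nonneg fun _ _ => sq_nonneg _

/-- Discrete form of `d(Q^(k+1)) = (k+1) Q^k dQ`. The weight at `i` is the square function strictly
before `i`, and the jump, at most `b ^ 2`, accounts for the term `b ^ (2 * k)`. -/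
lemma icoSq_pow_le (hM : IsBddRevMart μ G M b) (k j n : ℕ) (hjn : j ≤ n) (o : Ω) :
    icoSq M j n o ^ (k + 1)
      ≤ (k + 1) * 2 ^ k * ∑ i ∈ Finset.Ico j n, M i o ^ 2 * (icoSq M j i o ^ k + b ^ (2 * k)) := by
  induction n, hjn using Nat.le_induction with
  | base => simp [icoSq]
  | succ n hjn ih =>
    have e : icoSq M j (n + 1) o = icoSq M j n o + M n o ^ 2 := Finset.sum_Ico_succ_top hjn _
    rw [Finset.sum_Ico_succ_top hjn, mul_add, e]
    set q := icoSq M j n o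
    set y := M n o ^ 2 with hy
    have hq : 0 ≤ q := icoSq_nonneg j n o
    have hy0 : 0 ≤ y := sq_nonneg _
    have hyb : y ≤ b ^ 2 := by
      rw [hy, ← sq_abs]; exact pow_le_pow_left₀ (abs_nonneg _) (hM.bdd n o) 2
    have h1 : (q + y) ^ (k + 1) - q ^ (k + 1) ≤ y * (k + 1) * (q + y) ^ k := by
      have := abs_pow_sub_pow_le (q + y) q (k + 1)
      rw [abs_of_nonneg (show 0 ≤ q + y by positivity), abs_of_nonneg hq,
        max_eq_left (by linarith), add_sub_cancel_left, abs_of_nonneg hy0] at this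
      push_cast at this
      exact (le_abs_self _).trans this
    have h2 : (q + y) ^ k ≤ 2 ^ k * (q ^ k + b ^ (2 * k)) := by
      calc (q + y) ^ k ≤ (q + b ^ 2) ^ k := by gcongr
        _ ≤ 2 ^ (k - 1) * (q ^ k + (b ^ 2) ^ k) := add_pow_le hq (by positivity) _
        _ ≤ 2 ^ k * (q ^ k + (b ^ 2) ^ k) := by
          gcongr
          · norm_num
          · omega
        _ = _ := by rw [← pow_mul]
    have h3 : y * (k + 1) * (q + y) ^ k ≤ y * (k + 1) * (2 ^ k * (q ^ k + b ^ (2 * k))) := by gcongr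
    linarith

lemma integral_mul_sum [IsFiniteMeasure μ] (hM : IsBddRevMart μ G M b) (j n : ℕ)
    {h : Ω → ℝ} (hh : BddMeas (G n) h) :
    ∫ o, h o * icoSum M j n o ∂μ = 0 := by
  simp only [icoSum, Finset.mul_sum]
  rw [integral_finsetSum]
  · refine Finset.sum_eq_zero fun k hk => hM.orth k h (hh.mono (hM.anti ?_))
    have := (Finset.mem_Ico.1 hk).2
    omega
  · intro k _
    exact ((hh.mono (hM.le n)).mul ((hM.bddMeas k).mono (hM.le k))).integrable

end IsBddRevMart

lemma icoSum_succ_bot {Ω : Type*} {M : ℕ → Ω → ℝ} {j n : ℕ} (h : j < n) (o : Ω) :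
    icoSum M j n o = M j o + icoSum M (j + 1) n o := Finset.sum_eq_sum_Ico_succ_bot h _

lemma icoSum_add {Ω : Type*} {M : ℕ → Ω → ℝ} {i j n : ℕ} (h : i ≤ j) (h' : j ≤ n) (o : Ω) :
    icoSum M i n o = icoSum M i j o + icoSum M j n o := (Finset.sum_Ico_consecutive _ h h').symm

lemma sum_Ico_sub_succ (g : ℕ → ℝ) {j n : ℕ} (h : j ≤ n) :
    ∑ k ∈ Finset.Ico j n, (g k - g (k + 1)) = g j - g n := by
  have := Finset.sum_Ico_sub (fun k => - g k) h
  simpa [sub_eq_add_neg, add_comm] using this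

namespace IsBddRevMart

variable {Ω : Type*} {m0 : MeasurableSpace Ω} {μ : Measure Ω} [IsProbabilityMeasure μ]
  {G : ℕ → MeasurableSpace Ω} {M : ℕ → Ω → ℝ} {b : ℝ}

lemma int_sum (hM : IsBddRevMart μ G M b) (j n k : ℕ) :
    Integrable (fun o => icoSum M j n o ^ k) μ :=
  (((hM.bddMeas_sum j n).mono (hM.le j)).pow k).integrable

lemma integral_sum_sq (hM : IsBddRevMart μ G M b) {j n : ℕ} (hjn : j ≤ n) :
    ∫ o, icoSum M j n o ^ 2 ∂μ = ∑ k ∈ Finset.Ico j n, ∫ o, M k o ^ 2 ∂μ := by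
  have key : ∀ k ∈ Finset.Ico j n, ∫ o, M k o ^ 2 ∂μ
      = ∫ o, icoSum M k n o ^ 2 ∂μ - ∫ o, icoSum M (k + 1) n o ^ 2 ∂μ := by
    intro k hk
    have hk' := (Finset.mem_Ico.1 hk).2
    have h1 : ∀ o, icoSum M k n o ^ 2
        = M k o ^ 2 + (icoSum M (k + 1) n o ^ 2 + 2 * (icoSum M (k + 1) n o * M k o)) := fun o => by
      rw [icoSum_succ_bot hk']; ring
    have hMk := (hM.bddMeas k).mono (hM.le k)
    have hS := (hM.bddMeas_sum (k + 1) n).mono (hM.le _)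
    simp_rw [h1]
    rw [integral_add (hMk.pow 2).integrable ((hS.pow 2).add ((hS.mul hMk).const_mul 2)).integrable,
      integral_add (hS.pow 2).integrable ((hS.mul hMk).const_mul 2).integrable, integral_const_mul,
      hM.orth k _ (hM.bddMeas_sum (k + 1) n)]
    ring
  rw [Finset.sum_congr rfl key, sum_Ico_sub_succ (fun k => ∫ o, icoSum M k n o ^ 2 ∂μ) hjn]
  simp [icoSum]

/-- Conditional Jensen: `icoSum M i n` is `icoSum M j n` plus `icoSum M i j`, which has conditional
mean zero given `G j`, and `M j ^ 2` is `G j`-measurable. The tangent inequality makes this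
explicit, its linear term integrating to zero. -/
lemma integral_sq_mul_pow_le (hM : IsBddRevMart μ G M b) {i j n : ℕ} (hij : i ≤ j) (hjn : j ≤ n)
    (k : ℕ) : ∫ o, M j o ^ 2 * icoSum M j n o ^ (2 * k) ∂μ
      ≤ ∫ o, M j o ^ 2 * icoSum M i n o ^ (2 * k) ∂μ := by
  have hMj := (hM.bddMeas j).mono (hM.le j)
  have hS := (hM.bddMeas_sum j n).mono (hM.le _)
  have hi := (hM.bddMeas_sum i n).mono (hM.le _)
  have hij' := (hM.bddMeas_sum i j).mono (hM.le _)
  have hz := hM.integral_mul_sum i j (((hM.bddMeas j).pow 2).mul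
    (((hM.bddMeas_sum j n).pow (2 * k - 1)).const_mul ((2 * k : ℕ) : ℝ)))
  rw [← add_zero (∫ o, M j o ^ 2 * icoSum M j n o ^ (2 * k) ∂μ), ← hz, ← integral_add
    ((hMj.pow 2).mul (hS.pow _)).integrable
    (((hMj.pow 2).mul ((hS.pow _).const_mul _)).mul hij').integrable]
  refine integral_mono (((hMj.pow 2).mul (hS.pow _)).add
    (((hMj.pow 2).mul ((hS.pow _).const_mul _)).mul hij')).integrable
    ((hMj.pow 2).mul (hi.pow _)).integrable fun o => ?_
  have := Even.pow_add_mul_le_pow (even_two_mul k) (icoSum M i n o) (icoSum M j n o)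
  have e : icoSum M i n o - icoSum M j n o = icoSum M i j o := by
    rw [icoSum_add hij hjn]; ring
  rw [e] at this
  have := mul_le_mul_of_nonneg_left this (sq_nonneg (M j o))
  dsimp only
  linarith

/-- The constant in `integral_pow_le`. -/
noncomputable def _root_.burkholderConst (k : ℕ) : ℝ := (2 * k + 2) * (2 * k + 1) * 4 ^ k

lemma integral_pow_le_aux (hM : IsBddRevMart μ G M b) {j n : ℕ} (hjn : j ≤ n) (k : ℕ) :
    ∫ o, icoSum M j n o ^ (2 * k + 2) ∂μ ≤ burkholderConst k *
      ∫ o, icoSq M j n o * (icoSum M j n o ^ (2 * k) + b ^ (2 * k)) ∂μ := by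
  have hc : 0 ≤ burkholderConst k := by unfold burkholderConst; positivity
  -- Adding `M i` to the sum from `i + 1`: the first-order term vanishes by orthogonality, and
  -- Jensen replaces the sum from `i` by the full sum from `j` in the remainder.
  have key : ∀ i ∈ Finset.Ico j n, ∫ o, icoSum M i n o ^ (2 * k + 2) ∂μ
      - ∫ o, icoSum M (i + 1) n o ^ (2 * k + 2) ∂μ
      ≤ burkholderConst k * ∫ o, M i o ^ 2 * (icoSum M j n o ^ (2 * k) + b ^ (2 * k)) ∂μ := by
    intro i hi
    obtain ⟨hji, hin⟩ := Finset.mem_Ico.1 hi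
    have hMi := (hM.bddMeas i).mono (hM.le i)
    have hS := (hM.bddMeas_sum i n).mono (hM.le _)
    have hSj := (hM.bddMeas_sum j n).mono (hM.le _)
    have hS' := (hM.bddMeas_sum (i + 1) n).mono (hM.le _)
    have h1 : ∫ o, icoSum M i n o ^ (2 * k + 2) ∂μ
        ≤ ∫ o, (icoSum M (i + 1) n o ^ (2 * k + 2)
          + (2 * k + 2) * (icoSum M (i + 1) n o ^ (2 * k + 1) * M i o)
          + burkholderConst k * (M i o ^ 2 * (icoSum M i n o ^ (2 * k) + b ^ (2 * k)))) ∂μ := by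
      refine integral_mono (hS.pow _).integrable (((hS'.pow _).add
        (((hS'.pow _).mul hMi).const_mul _)).add
        (((hMi.pow 2).mul ((hS.pow _).add (BddMeas.const _))).const_mul _)).integrable fun o => ?_
      have := pow_two_mul_add_two_le k (x := icoSum M (i + 1) n o) (hM.bdd i o)
      rw [← icoSum_succ_bot hin] at this
      exact this
    rw [integral_add ((hS'.pow _).add (((hS'.pow _).mul hMi).const_mul _)).integrable
      (((hMi.pow 2).mul ((hS.pow _).add (BddMeas.const _))).const_mul _).integrable,
      integral_add (hS'.pow _).integrable (((hS'.pow _).mul hMi).const_mul _).integrable,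
      integral_const_mul, integral_const_mul,
      hM.orth i _ ((hM.bddMeas_sum (i + 1) n).pow _)] at h1
    have h2 : ∫ o, M i o ^ 2 * (icoSum M i n o ^ (2 * k) + b ^ (2 * k)) ∂μ
        ≤ ∫ o, M i o ^ 2 * (icoSum M j n o ^ (2 * k) + b ^ (2 * k)) ∂μ := by
      simp only [mul_add]
      rw [integral_add ((hMi.pow 2).mul (hS.pow _)).integrable
        ((hMi.pow 2).mul (BddMeas.const _)).integrable,
        integral_add ((hMi.pow 2).mul (hSj.pow _)).integrable
        ((hMi.pow 2).mul (BddMeas.const _)).integrable]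
      exact add_le_add_left (hM.integral_sq_mul_pow_le hji hin.le k) _
    have := mul_le_mul_of_nonneg_left h2 hc
    linarith
  have h := Finset.sum_le_sum key
  rw [sum_Ico_sub_succ (fun i => ∫ o, icoSum M i n o ^ (2 * k + 2) ∂μ) hjn, ← Finset.mul_sum,
    ← integral_finsetSum] at h
  · simp only [icoSum, Finset.Ico_self, Finset.sum_empty, ← Finset.sum_mul] at h ⊢
    simpa [icoSq] using h
  · intro i _
    exact ((((hM.bddMeas i).mono (hM.le i)).pow 2).mul
      ((((hM.bddMeas_sum j n).mono (hM.le _)).pow _).add (BddMeas.const _))).integrable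

/-- The even moments of the sum are controlled by the moments of the square function. -/
lemma integral_pow_le (hM : IsBddRevMart μ G M b) {j n : ℕ} (hjn : j ≤ n) (k : ℕ) :
    ∫ o, icoSum M j n o ^ (2 * k + 2) ∂μ ≤ 2 * burkholderConst k *
      ((2 * burkholderConst k) ^ k * ∫ o, icoSq M j n o ^ (k + 1) ∂μ
        + b ^ (2 * k) * ∫ o, icoSq M j n o ∂μ) := by
  have hc : 0 < burkholderConst k := by unfold burkholderConst; positivity
  have hS := (hM.bddMeas_sum j n).mono (hM.le _)
  have hQ := (hM.bddMeas_sq j n).mono (hM.le _)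
  have h1 := hM.integral_pow_le_aux hjn k
  have h2 : ∫ o, icoSq M j n o * (icoSum M j n o ^ (2 * k) + b ^ (2 * k)) ∂μ
      ≤ ∫ o, ((2 * burkholderConst k)⁻¹ * icoSum M j n o ^ (2 * k + 2)
        + (2 * burkholderConst k) ^ k * icoSq M j n o ^ (k + 1)
        + b ^ (2 * k) * icoSq M j n o) ∂μ := by
    refine integral_mono (hQ.mul ((hS.pow _).add (BddMeas.const _))).integrable
      ((((hS.pow _).const_mul _).add ((hQ.pow _).const_mul _)).add (hQ.const_mul _)).integrable
      fun o => ?_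
    -- The weight is twice `burkholderConst k`, so that exactly half of the left side reappears on
    -- the right and is absorbed.
    have := mul_pow_le_young k (t := icoSum M j n o) (icoSq_nonneg (M := M) j n o)
      (show 0 < 2 * burkholderConst k by positivity)
    dsimp only
    linarith
  rw [integral_add (((hS.pow _).const_mul _).add ((hQ.pow _).const_mul _)).integrable
    (hQ.const_mul _).integrable, integral_add ((hS.pow _).const_mul _).integrable
    ((hQ.pow _).const_mul _).integrable, integral_const_mul, integral_const_mul,
    integral_const_mul] at h2
  have h3 := mul_le_mul_of_nonneg_left h2 hc.le
  have h4 : burkholderConst k * ((2 * burkholderConst k)⁻¹ *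
      ∫ o, icoSum M j n o ^ (2 * k + 2) ∂μ) = 1 / 2 * ∫ o, icoSum M j n o ^ (2 * k + 2) ∂μ := by
    field_simp
  rw [mul_add, mul_add, h4] at h3
  linarith

/-- Bounds for the moments of the square function. -/
noncomputable def _root_.squareMomentBound (b B : ℝ) : ℕ → ℝ
  | 0 => 1
  | k + 1 => (k + 1) * 2 ^ k * (squareMomentBound b B k + b ^ (2 * k)) * B

/-- Energy inequality: a bound `B` on the conditional expectation of the square function given the
future bounds all its conditional moments. In the induction on `k`, `h * M i ^ 2` is itself a
nonnegative `G i`-measurable test function, so the hypothesis at `i` removes the factor `icoSq M j i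
^ k`; the remaining sum of `h * M i ^ 2` is controlled by the potential bound at `n`. -/
lemma integral_mul_icoSq_pow_le (hM : IsBddRevMart μ G M b) {B : ℝ} (hB : 0 ≤ B) {N : ℕ}
    (hpot : ∀ n ≤ N, ∀ h, BddMeas (G n) h → (∀ o, 0 ≤ h o) →
      ∫ o, h o * icoSq M 0 n o ∂μ ≤ B * ∫ o, h o ∂μ) (j k : ℕ) :
    ∀ n, j ≤ n → n ≤ N → ∀ h, BddMeas (G n) h → (∀ o, 0 ≤ h o) →
      ∫ o, h o * icoSq M j n o ^ k ∂μ ≤ squareMomentBound b B k * ∫ o, h o ∂μ := by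
  have hb := hM.nonneg
  have hbd : ∀ k, 0 ≤ squareMomentBound b B k := by
    intro k
    induction k with
    | zero => simp [squareMomentBound]
    | succ k ih => rw [squareMomentBound]; positivity
  induction k with
  | zero => intro n _ _ h _ _; simp [squareMomentBound]
  | succ k ih =>
    intro n hjn hnN h hh h0
    have hh' := hh.mono (hM.le n)
    have hMi : ∀ i, BddMeas m0 (M i) := fun i => (hM.bddMeas i).mono (hM.le i)
    have hQi : ∀ i, BddMeas m0 (icoSq M j i) := fun i => (hM.bddMeas_sq j i).mono (hM.le j)
    have h1 : ∫ o, h o * icoSq M j n o ^ (k + 1) ∂μ ≤ ∫ o, (k + 1) * 2 ^ k *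
        ∑ i ∈ Finset.Ico j n, (h o * M i o ^ 2) * (icoSq M j i o ^ k + b ^ (2 * k)) ∂μ := by
      refine integral_mono (hh'.mul ((hQi n).pow _)).integrable (BddMeas.const_mul _
        (BddMeas.sum fun i _ => (hh'.mul ((hMi i).pow 2)).mul
          (((hQi i).pow k).add (BddMeas.const _)))).integrable fun o => ?_
      refine (mul_le_mul_of_nonneg_left (hM.icoSq_pow_le k j n hjn o) (h0 o)).trans (le_of_eq ?_)
      simp only [Finset.mul_sum]
      exact Finset.sum_congr rfl fun i _ => by ring
    have h2 : ∀ i ∈ Finset.Ico j n,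
        ∫ o, (h o * M i o ^ 2) * (icoSq M j i o ^ k + b ^ (2 * k)) ∂μ
          ≤ (squareMomentBound b B k + b ^ (2 * k)) * ∫ o, h o * M i o ^ 2 ∂μ := by
      intro i hi
      obtain ⟨hji, hin⟩ := Finset.mem_Ico.1 hi
      have h3 := ih i hji (hin.le.trans hnN) (fun o => h o * M i o ^ 2)
        ((hh.mono (hM.anti hin.le)).mul ((hM.bddMeas i).pow 2))
        (fun o => mul_nonneg (h0 o) (sq_nonneg _))
      simp only [mul_add]
      rw [integral_add ((hh'.mul ((hMi i).pow 2)).mul ((hQi i).pow k)).integrable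
        ((hh'.mul ((hMi i).pow 2)).mul (BddMeas.const _)).integrable, integral_mul_const]
      linarith
    rw [integral_const_mul, integral_finsetSum _ fun i _ => ((hh'.mul ((hMi i).pow 2)).mul
          (((hQi i).pow k).add (BddMeas.const _))).integrable] at h1
    have h4 : ∑ i ∈ Finset.Ico j n, ∫ o, h o * M i o ^ 2 ∂μ ≤ B * ∫ o, h o ∂μ := by
      rw [← integral_finsetSum _ fun i _ => (hh'.mul ((hMi i).pow 2)).integrable]
      refine le_trans (integral_mono (BddMeas.sum fun i _ => hh'.mul ((hMi i).pow 2)).integrable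
        (hh'.mul ((hM.bddMeas_sq 0 n).mono (hM.le 0))).integrable fun o => ?_) (hpot n hnN h hh h0)
      dsimp only
      rw [← Finset.mul_sum]
      refine mul_le_mul_of_nonneg_left ?_ (h0 o)
      exact Finset.sum_le_sum_of_subset_of_nonneg (Finset.Ico_subset_Ico_left (Nat.zero_le j))
        fun _ _ _ => sq_nonneg _
    calc _ ≤ _ := h1
      _ ≤ (k + 1) * 2 ^ k * ∑ i ∈ Finset.Ico j n,
          (squareMomentBound b B k + b ^ (2 * k)) * ∫ o, h o * M i o ^ 2 ∂μ := by
        gcongr with i hi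
        exact h2 i hi
      _ ≤ (k + 1) * 2 ^ k * ((squareMomentBound b B k + b ^ (2 * k)) * (B * ∫ o, h o ∂μ)) := by
        rw [← Finset.mul_sum]
        have := hbd k
        gcongr
      _ = _ := by rw [squareMomentBound]; ring

/-- Every even moment of the partial sums is bounded in terms of the potential bound `B`. -/
lemma integral_pow_le_of_potential (hM : IsBddRevMart μ G M b) {B : ℝ} (hB : 0 ≤ B) {n : ℕ}
    (hpot : ∀ i ≤ n, ∀ h, BddMeas (G i) h → (∀ o, 0 ≤ h o) →
      ∫ o, h o * icoSq M 0 i o ∂μ ≤ B * ∫ o, h o ∂μ) {j : ℕ} (hjn : j ≤ n) (k : ℕ) :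
    ∫ o, icoSum M j n o ^ (2 * k + 2) ∂μ ≤ 2 * burkholderConst k *
      ((2 * burkholderConst k) ^ k * squareMomentBound b B (k + 1)
        + b ^ (2 * k) * squareMomentBound b B 1) := by
  have h := hM.integral_pow_le hjn k
  have h1 := hM.integral_mul_icoSq_pow_le hB hpot j (k + 1) n hjn le_rfl (fun _ => 1)
    (BddMeas.const 1) (fun _ => zero_le_one)
  have h2 := hM.integral_mul_icoSq_pow_le hB hpot j 1 n hjn le_rfl (fun _ => 1)
    (BddMeas.const 1) (fun _ => zero_le_one)
  simp only [one_mul, integral_const, probReal_univ, smul_eq_mul, mul_one, pow_one] at h1 h2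
  have hc : 0 ≤ burkholderConst k := by unfold burkholderConst; positivity
  have hb := hM.nonneg
  refine h.trans ?_
  gcongr

end IsBddRevMart

/-! ### Convergence of reverse martingale series -/

lemma setIntegral_eq_integral_indicator_mul {Ω : Type*} {m0 : MeasurableSpace Ω} {μ : Measure Ω}
    {s : Set Ω} (hs : MeasurableSet s) (g : Ω → ℝ) :
    ∫ o in s, g o ∂μ = ∫ o, s.indicator (fun _ => (1 : ℝ)) o * g o ∂μ := by
  rw [← integral_indicator hs]
  refine integral_congr_ae (ae_of_all _ fun o => ?_)
  by_cases ho : o ∈ s <;> simp [ho]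

/-- Weighted AM-GM between the powers `2` and `4m + 2`: a small variance and a bounded higher moment
make the intermediate moment small. -/
lemma pow_le_mul_sq_add (m : ℕ) (t : ℝ) {c : ℝ} (hc : 0 < c) :
    t ^ (2 * m + 2) ≤ c * t ^ 2 + c⁻¹ * t ^ (2 * (2 * m) + 2) := by
  have h1 : 0 ≤ c⁻¹ * (t ^ (2 * m + 1) - c * t) ^ 2 := by positivity
  have h2 : c⁻¹ * (t ^ (2 * m + 1) - c * t) ^ 2
      = c⁻¹ * t ^ (2 * (2 * m) + 2) - 2 * t ^ (2 * m + 2) + c * t ^ 2 := by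
    field_simp
    ring
  have h3 : 0 ≤ t ^ (2 * m + 2) := (show Even (2 * m + 2) from ⟨m + 1, by ring⟩).pow_nonneg t
  linarith

namespace IsBddRevMart

variable {Ω : Type*} {m0 : MeasurableSpace Ω} {μ : Measure Ω} [IsProbabilityMeasure μ]
  {G : ℕ → MeasurableSpace Ω} {M : ℕ → Ω → ℝ} {b : ℝ}

/-- Kolmogorov's maximal inequality for the sums read backwards from `N`. -/
lemma measure_exists_le_abs_le (hM : IsBddRevMart μ G M b) {n N : ℕ} (hnN : n ≤ N) {ε : ℝ}
    (hε : 0 < ε) : μ {o | ∃ k, n ≤ k ∧ k ≤ N ∧ ε ≤ |icoSum M k N o|}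
      ≤ ENNReal.ofReal ((∑ k ∈ Finset.Ico n N, ∫ o, M k o ^ 2 ∂μ) / ε ^ 2) := by
  -- Reversing time, sums ending at `N` and started at `N - i` form a martingale in `i`, and Doob's
  -- inequality applies to their squares. For `i ≥ N` truncated subtraction freezes the process.
  let F : Filtration ℕ m0 := ⟨fun i => G (N - i),
    fun i j hij => hM.anti (by omega), fun i => hM.le _⟩
  have hsub : Submartingale (fun i o => icoSum M (N - i) N o ^ 2) F μ := by
    refine submartingale_of_setIntegral_le_succ
      (fun i => ((hM.bddMeas_sum _ _).1.pow_const 2).stronglyMeasurable)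
      (fun i => hM.int_sum _ _ _) fun i s hs => ?_
    have hs' : MeasurableSet s := hM.le _ s hs
    rcases Nat.lt_or_ge i N with hi | hi
    · obtain ⟨k, hk⟩ : ∃ k, N - i = k + 1 := ⟨N - i - 1, by omega⟩
      have hk' : N - (i + 1) = k := by omega
      simp only [hk', hk]
      have hs1 : BddMeas (G (k + 1)) (s.indicator fun _ => (1 : ℝ)) := by
        rw [← hk]; exact BddMeas.indicator hs
      have hs0 := hs1.mono (hM.le _)
      have h0 := hM.orth k _ (hs1.mul (hM.bddMeas_sum (k + 1) N))
      have hMk := (hM.bddMeas k).mono (hM.le k)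
      have hS := (hM.bddMeas_sum (k + 1) N).mono (hM.le _)
      have hS' := (hM.bddMeas_sum k N).mono (hM.le _)
      rw [setIntegral_eq_integral_indicator_mul hs', setIntegral_eq_integral_indicator_mul hs']
      rw [← add_zero (∫ o, s.indicator (fun _ => (1 : ℝ)) o * icoSum M (k + 1) N o ^ 2 ∂μ),
        ← mul_zero (2 : ℝ), ← h0, ← integral_const_mul, ← integral_add (hs0.mul (hS.pow 2)).integrable
        (((hs0.mul hS).mul hMk).const_mul 2).integrable]
      refine integral_mono ((hs0.mul (hS.pow 2)).add
        (((hs0.mul hS).mul hMk).const_mul 2)).integrable (hs0.mul (hS'.pow 2)).integrable fun o => ?_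
      dsimp only
      rw [icoSum_succ_bot (show k < N by omega)]
      have h1 : 0 ≤ s.indicator (fun _ => (1 : ℝ)) o :=
        Set.indicator_nonneg (fun _ _ => zero_le_one) o
      nlinarith [mul_nonneg h1 (sq_nonneg (M k o))]
    · have e1 : N - i = 0 := by omega
      have e2 : N - (i + 1) = 0 := by omega
      simp [e1, e2]
  set e : NNReal := (ε ^ 2).toNNReal with he
  have heε : (e : ℝ) = ε ^ 2 := Real.coe_toNNReal _ (sq_nonneg ε)
  have hmax := maximal_ineq hsub (fun i o => sq_nonneg _) (ε := e) (N - n)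
  have hset : {o | ∃ k, n ≤ k ∧ k ≤ N ∧ ε ≤ |icoSum M k N o|} ⊆
      {o | (e : ℝ) ≤ (Finset.range (N - n + 1)).sup' Finset.nonempty_range_add_one
        fun k => icoSum M (N - k) N o ^ 2} := by
    rintro o ⟨k, hnk, hkN, hk⟩
    simp only [Set.mem_ofPred_eq, Finset.le_sup'_iff]
    refine ⟨N - k, Finset.mem_range.2 (by omega), ?_⟩
    rw [show N - (N - k) = k by omega, ← sq_abs (icoSum M k N o), heε]
    exact pow_le_pow_left₀ hε.le hk 2
  have hint : ∫ o in {o | (e : ℝ) ≤ (Finset.range (N - n + 1)).sup' Finset.nonempty_range_add_one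
        fun k => icoSum M (N - k) N o ^ 2}, icoSum M (N - (N - n)) N o ^ 2 ∂μ
      ≤ ∑ k ∈ Finset.Ico n N, ∫ o, M k o ^ 2 ∂μ := by
    rw [show N - (N - n) = n by omega, ← hM.integral_sum_sq hnN]
    exact setIntegral_le_integral (hM.int_sum _ _ _) (ae_of_all _ fun o => sq_nonneg _)
  have he1 : (e : ℝ≥0∞) = ENNReal.ofReal (ε ^ 2) := rfl
  have he0 : (e : ℝ≥0∞) ≠ 0 := by
    rw [he1]
    exact (ENNReal.ofReal_pos.2 (by positivity)).ne'
  rw [ENNReal.ofReal_div_of_pos (by positivity), ← he1, ENNReal.le_div_iff_mul_le (Or.inl he0)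
    (Or.inl ENNReal.coe_ne_top), mul_comm]
  exact (mul_le_mul_right (measure_mono hset) _).trans (hmax.trans (ENNReal.ofReal_le_ofReal hint))

lemma measure_exists_le_abs_le' (hM : IsBddRevMart μ G M b)
    (hV : Summable fun k => ∫ o, M k o ^ 2 ∂μ) (n : ℕ) {ε : ℝ} (hε : 0 < ε) :
    μ {o | ∃ k, n ≤ k ∧ 2 * ε ≤ |icoSum M n k o|}
      ≤ ENNReal.ofReal ((∑' k, ∫ o, M (k + n) o ^ 2 ∂μ) / ε ^ 2) := by
  have hU : {o | ∃ k, n ≤ k ∧ 2 * ε ≤ |icoSum M n k o|}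
      = ⋃ N, {o | ∃ k, n ≤ k ∧ k ≤ n + N ∧ 2 * ε ≤ |icoSum M n k o|} := by
    ext o
    simp only [Set.mem_ofPred_eq, Set.mem_iUnion]
    constructor
    · rintro ⟨k, h1, h2⟩
      exact ⟨k, k, h1, by omega, h2⟩
    · rintro ⟨N, k, h1, -, h2⟩
      exact ⟨k, h1, h2⟩
  rw [hU, Monotone.measure_iUnion]
  · refine iSup_le fun N => ?_
    -- Since `icoSum M n k` is the difference of the sums from `n` and from `k` up to `n + N`, one
    -- of these two is at least `ε` in absolute value; this turns the backward maximal inequality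
    -- into a forward one.
    have hsub : {o | ∃ k, n ≤ k ∧ k ≤ n + N ∧ 2 * ε ≤ |icoSum M n k o|}
        ⊆ {o | ∃ k, n ≤ k ∧ k ≤ n + N ∧ ε ≤ |icoSum M k (n + N) o|} := by
      rintro o ⟨k, h1, h2, h3⟩
      by_contra hcon
      simp only [Set.mem_ofPred_eq, not_exists, not_and, not_le] at hcon
      have h4 := hcon n le_rfl (by omega)
      have h5 := hcon k h1 h2
      rw [icoSum_add h1 h2] at h4
      have := abs_sub (icoSum M n k o + icoSum M k (n + N) o) (icoSum M k (n + N) o)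
      rw [add_sub_cancel_right] at this
      linarith
    refine (measure_mono hsub).trans ((hM.measure_exists_le_abs_le (Nat.le_add_right n N) hε).trans
      (ENNReal.ofReal_le_ofReal ?_))
    gcongr
    rw [Finset.sum_Ico_eq_sum_range, Nat.add_sub_cancel_left]
    simp only [add_comm n]
    exact ((summable_nat_add_iff n).2 hV).sum_le_tsum _
      fun k _ => integral_nonneg fun o => sq_nonneg _
  · intro N N' hN o
    rintro ⟨k, h1, h2, h3⟩
    exact ⟨k, h1, by omega, h3⟩

/-- Almost sure convergence of a reverse martingale difference series with summable variances. -/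
lemma ae_exists_tendsto (hM : IsBddRevMart μ G M b)
    (hV : Summable fun k => ∫ o, M k o ^ 2 ∂μ) :
    ∀ᵐ o ∂μ, ∃ l, Tendsto (fun n => icoSum M 0 n o) atTop (𝓝 l) := by
  have htail := tendsto_sum_nat_add fun k => ∫ o, M k o ^ 2 ∂μ
  have key : ∀ m : ℕ, ∀ᵐ o ∂μ, ∃ n, ∀ k, n ≤ k → |icoSum M n k o| < 2 * (1 / ((m : ℝ) + 1)) := by
    intro m
    have hε : (0 : ℝ) < 1 / ((m : ℝ) + 1) := by positivity
    rw [ae_iff]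
    have hle : ∀ n, μ {o | ¬ ∃ n, ∀ k, n ≤ k → |icoSum M n k o| < 2 * (1 / ((m : ℝ) + 1))}
        ≤ ENNReal.ofReal ((∑' k, ∫ o, M (k + n) o ^ 2 ∂μ) / (1 / ((m : ℝ) + 1)) ^ 2) := by
      intro n
      refine (measure_mono ?_).trans (hM.measure_exists_le_abs_le' hV n hε)
      intro o ho
      simp only [Set.mem_ofPred_eq, not_exists, not_forall, not_lt] at ho ⊢
      obtain ⟨k, hk, hk'⟩ := ho n
      exact ⟨k, hk, hk'⟩
    have hlim : Tendsto (fun n => ENNReal.ofReal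
        ((∑' k, ∫ o, M (k + n) o ^ 2 ∂μ) / (1 / ((m : ℝ) + 1)) ^ 2)) atTop (𝓝 0) := by
      have := (ENNReal.continuous_ofReal.tendsto _).comp
        (htail.div_const ((1 / ((m : ℝ) + 1)) ^ 2))
      simpa only [zero_div, ENNReal.ofReal_zero, Function.comp_def] using this
    exact le_antisymm (ge_of_tendsto' hlim hle) zero_le
  filter_upwards [ae_all_iff.2 key] with o ho
  refine cauchySeq_tendsto_of_complete (Metric.cauchySeq_iff'.2 fun ε hε => ?_)
  obtain ⟨m, hm⟩ := exists_nat_one_div_lt (half_pos hε)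
  obtain ⟨n, hn⟩ := ho m
  refine ⟨n, fun k hk => ?_⟩
  rw [Real.dist_eq, icoSum_add (Nat.zero_le n) hk, add_sub_cancel_left]
  linarith [hn k hk]

lemma eLpNorm_sum_le (hM : IsBddRevMart μ G M b) (m j n : ℕ) {ε : ℝ} (hε : 0 ≤ ε)
    (h : ∫ o, icoSum M j n o ^ (2 * m + 2) ∂μ ≤ ε ^ (2 * m + 2)) :
    eLpNorm (icoSum M j n) ((2 * m + 2 : ℕ) : ℝ≥0∞) μ ≤ ENNReal.ofReal ε := by
  rw [MemLp.eLpNorm_eq_integral_rpow_norm (by simp) (ENNReal.natCast_ne_top _)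
    (((hM.bddMeas_sum j n).mono (hM.le j)).memLp _)]
  refine ENNReal.ofReal_le_ofReal ?_
  simp only [ENNReal.toReal_natCast, Real.rpow_natCast]
  have hev : Even (2 * m + 2) := ⟨m + 1, by ring⟩
  have e : ∀ o, ‖icoSum M j n o‖ ^ (2 * m + 2) = icoSum M j n o ^ (2 * m + 2) := fun o => by
    rw [Real.norm_eq_abs, hev.pow_abs]
  simp only [e]
  calc (∫ o, icoSum M j n o ^ (2 * m + 2) ∂μ) ^ (((2 * m + 2 : ℕ) : ℝ)⁻¹)
      ≤ (ε ^ (2 * m + 2)) ^ (((2 * m + 2 : ℕ) : ℝ)⁻¹) :=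
        Real.rpow_le_rpow (integral_nonneg fun o => hev.pow_nonneg _) h (by positivity)
    _ = ε := Real.pow_rpow_inv_natCast hε (by omega)

lemma exists_forall_integral_pow_le (hM : IsBddRevMart μ G M b)
    (hV : Summable fun k => ∫ o, M k o ^ 2 ∂μ)
    (hmom : ∀ k : ℕ, ∃ C, ∀ j n, j ≤ n → ∫ o, icoSum M j n o ^ (2 * k + 2) ∂μ ≤ C)
    (m : ℕ) {η : ℝ} (hη : 0 < η) :
    ∃ n₀, ∀ n ≥ n₀, ∀ l ≥ n, ∫ o, icoSum M n l o ^ (2 * m + 2) ∂μ ≤ η := by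
  obtain ⟨C, hC⟩ := hmom (2 * m)
  have hC0 : 0 ≤ C := le_trans (integral_nonneg fun o =>
    (show Even (2 * (2 * m) + 2) from ⟨2 * m + 1, by ring⟩).pow_nonneg _) (hC 0 0 le_rfl)
  -- This weight makes the bounded `4m + 2` moment contribute at most `η / 2`; the tail of the
  -- variances is then taken below `η / (2 * c)`.
  set c : ℝ := 2 * (C + 1) / η with hc
  have hc0 : 0 < c := by positivity
  have htail := tendsto_sum_nat_add fun k => ∫ o, M k o ^ 2 ∂μ
  obtain ⟨n₀, hn₀⟩ := eventually_atTop.1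
    (htail.eventually (ge_mem_nhds (show (0 : ℝ) < η / (2 * c) by positivity)))
  refine ⟨n₀, fun n hn l hl => ?_⟩
  have h1 : ∫ o, icoSum M n l o ^ (2 * m + 2) ∂μ
      ≤ ∫ o, (c * icoSum M n l o ^ 2 + c⁻¹ * icoSum M n l o ^ (2 * (2 * m) + 2)) ∂μ :=
    integral_mono (hM.int_sum _ _ _) (((hM.int_sum _ _ _).const_mul _).add
      ((hM.int_sum _ _ _).const_mul _)) fun o => pow_le_mul_sq_add m _ hc0
  rw [integral_add ((hM.int_sum _ _ _).const_mul _) ((hM.int_sum _ _ _).const_mul _),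
    integral_const_mul, integral_const_mul, hM.integral_sum_sq hl] at h1
  have h2 : ∑ k ∈ Finset.Ico n l, ∫ o, M k o ^ 2 ∂μ ≤ η / (2 * c) := by
    refine le_trans ?_ (hn₀ n hn)
    rw [Finset.sum_Ico_eq_sum_range]
    simp only [add_comm n]
    exact ((summable_nat_add_iff n).2 hV).sum_le_tsum _
      fun k _ => integral_nonneg fun o => sq_nonneg _
  have h3 := mul_le_mul_of_nonneg_left h2 hc0.le
  have h4 := mul_le_mul_of_nonneg_left (hC n l hl) (inv_nonneg.2 hc0.le)
  have e1 : c * (η / (2 * c)) = η / 2 := by field_simp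
  have e2 : c⁻¹ * C ≤ η / 2 := by
    rw [hc, inv_div, div_mul_eq_mul_div, div_le_iff₀ (by positivity)]
    nlinarith
  linarith

/-- `L^p` convergence of a reverse martingale difference series. -/
lemma memLp_and_tendsto_eLpNorm (hM : IsBddRevMart μ G M b)
    (hV : Summable fun k => ∫ o, M k o ^ 2 ∂μ)
    (hmom : ∀ k : ℕ, ∃ C, ∀ j n, j ≤ n → ∫ o, icoSum M j n o ^ (2 * k + 2) ∂μ ≤ C)
    (j : ℕ) {R : Ω → ℝ} (hR : ∀ᵐ o ∂μ, Tendsto (fun n => icoSum M j n o) atTop (𝓝 (R o)))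
    {p : ℝ≥0∞} (hp : p ≠ ∞) : MemLp R p μ ∧
      Tendsto (fun n => eLpNorm (fun o => icoSum M j n o - R o) p μ) atTop (𝓝 0) := by
  obtain ⟨m, hm⟩ : ∃ m : ℕ, p ≤ ((2 * m + 2 : ℕ) : ℝ≥0∞) := by
    obtain ⟨m, hm⟩ := ENNReal.exists_nat_gt hp
    exact ⟨m, hm.le.trans (by exact_mod_cast (by omega : m ≤ 2 * m + 2))⟩
  have hmeas : ∀ n, AEStronglyMeasurable (icoSum M j n) μ := fun n =>
    ((hM.bddMeas_sum j n).mono (hM.le j)).1.aestronglyMeasurable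
  have hRm : AEStronglyMeasurable R μ := aestronglyMeasurable_of_tendsto_ae atTop hmeas hR
  have hlim : Tendsto (fun n => eLpNorm (fun o => icoSum M j n o - R o) p μ) atTop (𝓝 0) := by
    rw [ENNReal.tendsto_atTop_zero]
    intro ε hε
    obtain ⟨ε', hε', hεε⟩ : ∃ ε' : ℝ, 0 < ε' ∧ ENNReal.ofReal ε' ≤ ε := by
      rcases eq_or_ne ε ∞ with rfl | h
      · exact ⟨1, one_pos, le_top⟩
      · exact ⟨ε.toReal, ENNReal.toReal_pos hε.ne' h, ENNReal.ofReal_toReal_le⟩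
    obtain ⟨n₀, hn₀⟩ := hM.exists_forall_integral_pow_le hV hmom m
      (show 0 < ε' ^ (2 * m + 2) by positivity)
    refine ⟨max n₀ j, fun n hn => ?_⟩
    have hnj : j ≤ n := (le_max_right _ _).trans hn
    refine (eLpNorm_le_eLpNorm_of_exponent_le hm ((hmeas n).sub hRm)).trans (le_trans ?_ hεε)
    -- Fatou in `l` passes the Cauchy estimate for `icoSum M n l` to the limit.
    have h1 := Lp.eLpNorm_lim_le_liminf_eLpNorm (p := ((2 * m + 2 : ℕ) : ℝ≥0∞)) (μ := μ)
      (f := fun l o => icoSum M j n o - icoSum M j l o)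
      (fun l => (hmeas n).sub (hmeas l)) (fun o => icoSum M j n o - R o)
      (by filter_upwards [hR] with o ho using ho.const_sub _)
    refine h1.trans (liminf_le_of_frequently_le' (Eventually.frequently ?_))
    filter_upwards [eventually_ge_atTop n] with l hl
    have e : (fun o => icoSum M j n o - icoSum M j l o) = -icoSum M n l := by
      ext o
      simp only [Pi.neg_apply, icoSum_add hnj hl]
      ring
    rw [e, eLpNorm_neg]
    exact hM.eLpNorm_sum_le m n l hε'.le (hn₀ n ((le_max_left _ _).trans hn) l hl)
  refine ⟨?_, hlim⟩
  obtain ⟨n, hn⟩ := (ENNReal.tendsto_atTop_zero.1 hlim) 1 one_pos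
  have h2 : MemLp (fun o => icoSum M j n o - R o) p μ :=
    ⟨(hmeas n).sub hRm, (hn n le_rfl).trans_lt ENNReal.one_lt_top⟩
  have h3 := (((hM.bddMeas_sum j n).mono (hM.le j)).memLp p (μ := μ)).sub h2
  refine h3.ae_eq (ae_of_all _ fun o => ?_)
  simp

/-! ### Bounded variances from a merely measurable coboundary -/

lemma exists_measureReal_lt {K : Ω → ℝ} (hK : Measurable K) {ε : ℝ} (hε : 0 < ε) :
    ∃ A : ℝ, 0 ≤ A ∧ μ.real {o | A < |K o|} ≤ ε := by
  have h := tendsto_measure_iInter_atTop (μ := μ) (s := fun n : ℕ => {o | (n : ℝ) < |K o|})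
    (fun n => (measurableSet_lt measurable_const hK.abs).nullMeasurableSet)
    (fun i j hij o (ho : (j : ℝ) < |K o|) =>
      show (i : ℝ) < |K o| from lt_of_le_of_lt (by exact_mod_cast hij) ho) ⟨0, measure_ne_top _ _⟩
  have hI : ⋂ n : ℕ, {o | (n : ℝ) < |K o|} = ∅ := by
    ext o
    simp only [Set.mem_iInter, Set.mem_ofPred_eq, Set.mem_empty_iff_false, iff_false, not_forall,
      not_lt]
    exact exists_nat_ge _
  rw [hI, measure_empty] at h
  obtain ⟨n, hn⟩ := (ENNReal.tendsto_atTop_zero.1 h) (ENNReal.ofReal ε) (by simpa using hε)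
  refine ⟨n, Nat.cast_nonneg n, ?_⟩
  exact ENNReal.toReal_le_of_le_ofReal hε.le (hn n le_rfl)

/-- If the sums `T_n` differ from a fixed random variable by `G n`-measurable ones, and their fourth
moments are dominated by their squared variances, then their variances are bounded. -/
lemma exists_bound_of_sum_eq_sub (hM : IsBddRevMart μ G M b) {K : Ω → ℝ} (hK : Measurable K)
    {Z : ℕ → Ω → ℝ} (hZ : ∀ n, Measurable[G n] (Z n))
    (hTZ : ∀ n, ∀ᵐ o ∂μ, icoSum M 0 n o = Z n o - K o)
    {C : ℝ} (hC : ∀ n, ∫ o, icoSum M 0 n o ^ 4 ∂μ ≤ C * (1 + ∫ o, icoSum M 0 n o ^ 2 ∂μ) ^ 2) :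
    ∃ V, ∀ n, ∫ o, icoSum M 0 n o ^ 2 ∂μ ≤ V := by
  set C' := max C 1 with hC'
  have hC'1 : 1 ≤ C' := le_max_right _ _
  -- The level `1 / (256 * C')` and the truncation height `N` below, with `N ^ 2 = 32 * C' * σ`, are
  -- matched so that each of the two error terms is at most `σ / 4`.
  obtain ⟨A, hA, hAε⟩ := exists_measureReal_lt (μ := μ) hK
    (show (0 : ℝ) < 1 / (256 * C') by positivity)
  refine ⟨max 1 (4 * A ^ 2), fun n => ?_⟩
  set σ := ∫ o, icoSum M 0 n o ^ 2 ∂μ with hσ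
  rcases le_total σ 1 with h1 | h1
  · exact h1.trans (le_max_left _ _)
  refine le_trans ?_ (le_max_right _ _)
  set N := √(32 * C' * σ) with hN
  have hN2 : N ^ 2 = 32 * C' * σ := Real.sq_sqrt (by positivity)
  have hN0 : 0 < N := Real.sqrt_pos.2 (by positivity)
  let Z' : Ω → ℝ := fun o => max (-N) (min N (Z n o))
  have hZ' : BddMeas (G n) Z' := by
    refine ⟨measurable_const.max (measurable_const.min (hZ n)), N, fun o => abs_le.2 ⟨?_, ?_⟩⟩
    · exact le_max_left _ _
    · exact max_le (by linarith) (min_le_left _ _)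
  let I : Ω → ℝ := {o | A < |K o|}.indicator fun _ => 1
  have hImeas : MeasurableSet {o | A < |K o|} := measurableSet_lt measurable_const hK.abs
  have hI : BddMeas m0 I := BddMeas.indicator hImeas
  have hT := (hM.bddMeas_sum 0 n).mono (hM.le 0)
  -- The term with the truncated `Z'` integrates to zero. Writing `t` for the sum, the rest bounds
  -- `t * (t - Z')`. If `|t| ≤ N` and `|K| ≤ A`, truncation is 1-Lipschitz and fixes `t`, so `|t -
  -- Z'| ≤ A`. If `|t| ≤ N` but `|K| > A`, the trivial bound is `2 * N ^ 2`. If `|t| > N`, it is at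
  -- most `2 * t ^ 2 ≤ 2 * t ^ 4 / N ^ 2`. Integration gives `σ ≤ A ^ 2 + 3 * σ / 4`.
  have hpt : ∀ᵐ o ∂μ, icoSum M 0 n o ^ 2 ≤ Z' o * icoSum M 0 n o
      + (A ^ 2 + 1 / 4 * icoSum M 0 n o ^ 2 + 2 / N ^ 2 * icoSum M 0 n o ^ 4
        + 2 * N ^ 2 * I o) := by
    filter_upwards [hTZ n] with o ho
    set t := icoSum M 0 n o
    have hZo := abs_le.1 (show |Z' o| ≤ N from abs_le.2
      ⟨le_max_left _ _, max_le (by linarith) (min_le_left _ _)⟩)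
    have hI0 : 0 ≤ I o := Set.indicator_nonneg (fun _ _ => zero_le_one) o
    have h4 : 0 ≤ 2 / N ^ 2 * t ^ 4 := by positivity
    have h5 : 0 ≤ 2 * N ^ 2 * I o := by positivity
    have h6 : -(Z' o * t) ≤ N * |t| := by
      rw [← neg_mul]
      calc -Z' o * t ≤ |-Z' o * t| := le_abs_self _
        _ = |Z' o| * |t| := by rw [abs_mul, abs_neg]
        _ ≤ N * |t| := by gcongr; exact abs_le.2 hZo
    rcases le_or_gt |t| N with htN | htN
    · rcases le_or_gt |K o| A with hKA | hKA
      · have h7 : |t - Z' o| ≤ A := by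
          have ht := abs_le.1 htN
          have hk := abs_le.1 hKA
          have e : Z n o = t + K o := by linarith
          have : |t - Z' o| ≤ |K o| := by
            simp only [Z', e]
            rcases abs_cases (K o) with ⟨hk1, hk2⟩ | ⟨hk1, hk2⟩ <;>
              rw [abs_le] <;> constructor <;>
              rcases min_cases N (t + K o) with ⟨h8, h9⟩ | ⟨h8, h9⟩ <;>
              rcases max_cases (-N) (min N (t + K o)) with ⟨h10, h11⟩ | ⟨h10, h11⟩ <;> linarith
          exact this.trans hKA
        have h8 : t * (t - Z' o) ≤ |t| * A := by
          calc t * (t - Z' o) ≤ |t * (t - Z' o)| := le_abs_self _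
            _ = |t| * |t - Z' o| := abs_mul _ _
            _ ≤ _ := by gcongr
        nlinarith [sq_nonneg (|t| / 2 - A), sq_abs t]
      · have h7 : I o = 1 := Set.indicator_of_mem (show o ∈ {o | A < |K o|} from hKA) _
        have h8 : t ^ 2 ≤ N ^ 2 := by
          rw [← sq_abs t]; exact pow_le_pow_left₀ (abs_nonneg _) htN 2
        rw [h7]
        nlinarith [abs_nonneg t, sq_nonneg A]
    · have h7 : 2 * t ^ 2 ≤ 2 / N ^ 2 * t ^ 4 := by
        rw [div_mul_eq_mul_div, le_div_iff₀ (by positivity)]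
        have : N ^ 2 ≤ t ^ 2 := by
          rw [← sq_abs t]; exact pow_le_pow_left₀ hN0.le htN.le 2
        nlinarith [sq_nonneg t]
      nlinarith [sq_abs t, sq_nonneg A, abs_nonneg t]
  have hint := integral_mono_ae (hT.pow 2).integrable ((hZ'.mono (hM.le n)).mul hT |>.add
    ((((BddMeas.const (A ^ 2)).add ((hT.pow 2).const_mul (1 / 4))).add
      ((hT.pow 4).const_mul (2 / N ^ 2))).add (hI.const_mul (2 * N ^ 2)))).integrable hpt
  rw [integral_add ((hZ'.mono (hM.le n)).mul hT).integrable
    ((((BddMeas.const (A ^ 2)).add ((hT.pow 2).const_mul (1 / 4))).add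
      ((hT.pow 4).const_mul (2 / N ^ 2))).add (hI.const_mul (2 * N ^ 2))).integrable,
    integral_add (((BddMeas.const (A ^ 2)).add ((hT.pow 2).const_mul (1 / 4))).add
      ((hT.pow 4).const_mul (2 / N ^ 2))).integrable (hI.const_mul (2 * N ^ 2)).integrable,
    integral_add ((BddMeas.const (A ^ 2)).add ((hT.pow 2).const_mul (1 / 4))).integrable
      ((hT.pow 4).const_mul (2 / N ^ 2)).integrable,
    integral_add (BddMeas.const (A ^ 2)).integrable ((hT.pow 2).const_mul (1 / 4)).integrable,
    integral_const_mul, integral_const_mul, integral_const_mul, hM.integral_mul_sum 0 n hZ',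
    show ∫ o, I o ∂μ = μ.real {o | A < |K o|} from integral_indicator_one hImeas,
    integral_const, probReal_univ, one_smul, ← hσ] at hint
  have h3 : ∫ o, icoSum M 0 n o ^ 4 ∂μ ≤ C' * (4 * σ ^ 2) := by
    refine (hC n).trans ?_
    have : (1 + σ) ^ 2 ≤ 4 * σ ^ 2 := by nlinarith
    calc C * (1 + σ) ^ 2 ≤ C' * (1 + σ) ^ 2 := by gcongr; exact le_max_left _ _
      _ ≤ _ := by gcongr
  have h4 : 2 / N ^ 2 * ∫ o, icoSum M 0 n o ^ 4 ∂μ ≤ σ / 4 := by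
    calc 2 / N ^ 2 * ∫ o, icoSum M 0 n o ^ 4 ∂μ ≤ 2 / N ^ 2 * (C' * (4 * σ ^ 2)) := by gcongr
      _ = σ / 4 := by rw [hN2]; field_simp; norm_num
  have h5 : 2 * N ^ 2 * μ.real {o | A < |K o|} ≤ σ / 4 := by
    calc 2 * N ^ 2 * μ.real {o | A < |K o|} ≤ 2 * N ^ 2 * (1 / (256 * C')) := by gcongr
      _ = σ / 4 := by rw [hN2]; field_simp; norm_num
  linarith

end IsBddRevMart

/-! ### Orthogonality tested on π-systems -/

lemma setIntegral_eq_zero_of_piSystem {Ω : Type*} {m0 : MeasurableSpace Ω} {μ : Measure Ω}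
    {m : MeasurableSpace Ω} (hm : m ≤ m0) {C : Set (Set Ω)} (hC : IsPiSystem C)
    (hgen : m = MeasurableSpace.generateFrom C) {u : Ω → ℝ} (hu : Integrable u μ)
    (huniv : ∫ o, u o ∂μ = 0) (h : ∀ s ∈ C, ∫ o in s, u o ∂μ = 0) {s : Set Ω}
    (hs : MeasurableSet[m] s) : ∫ o in s, u o ∂μ = 0 := by
  induction s, hs using MeasurableSpace.induction_on_inter hgen hC with
  | empty => simp
  | basic t ht => exact h t ht
  | compl t ht ih =>
    have := integral_add_compl (hm t ht) hu
    rw [ih, huniv] at this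
    simpa using this
  | iUnion f hd hf ih =>
    rw [integral_iUnion (fun i => hm _ (hf i)) hd hu.integrableOn]
    simp [ih]

/-- A bounded version of the conditional expectation. -/
lemma BddMeas.exists_condExp {Ω : Type*} {m0 : MeasurableSpace Ω} (μ : Measure Ω)
    [IsProbabilityMeasure μ] {m : MeasurableSpace Ω} (hm : m ≤ m0) {h : Ω → ℝ}
    (hh : BddMeas m0 h) :
    ∃ h', BddMeas m h' ∧ ∀ k, BddMeas m k → ∫ o, k o * h o ∂μ = ∫ o, k o * h' o ∂μ := by
  obtain ⟨c, hc⟩ := hh.2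
  obtain ⟨o⟩ := μ.nonempty_of_neZero
  have hc0 : 0 ≤ c := (abs_nonneg _).trans (hc o)
  have hbd := ae_bdd_abs_condExp_of_ae_bdd_abs (m := m) (μ := μ) (ae_of_all _ hc)
  have hmeas : Measurable[m] (μ[h | m]) := stronglyMeasurable_condExp.measurable
  -- Clipping changes the conditional expectation only on a null set and makes it bounded
  -- everywhere.
  refine ⟨fun o => max (-c) (min c ((μ[h | m]) o)),
    ⟨measurable_const.max (measurable_const.min hmeas), c, fun o => abs_le.2
      ⟨le_max_left _ _, max_le (by linarith) (min_le_left _ _)⟩⟩, fun k hk => ?_⟩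
  have hk0 := hk.mono hm
  have h1 : μ[(fun o => k o * h o) | m] =ᵐ[μ] fun o => k o * (μ[h | m]) o :=
    condExp_mul_of_stronglyMeasurable_left hk.1.stronglyMeasurable (hk0.mul hh).integrable
      hh.integrable
  rw [← integral_condExp hm]
  refine integral_congr_ae ?_
  filter_upwards [h1, hbd] with o h2 h3
  rw [h2, min_eq_right (abs_le.1 h3).2, max_eq_right (abs_le.1 h3).1]

lemma integral_mul_eq_zero_of_piSystem {Ω : Type*} {m0 : MeasurableSpace Ω} {μ : Measure Ω}
    [IsProbabilityMeasure μ] {m : MeasurableSpace Ω} (hm : m ≤ m0) {C : Set (Set Ω)}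
    (hC : IsPiSystem C) (hgen : m = MeasurableSpace.generateFrom C) {u : Ω → ℝ}
    (hu : BddMeas m0 u) (huniv : ∫ o, u o ∂μ = 0) (h : ∀ s ∈ C, ∫ o in s, u o ∂μ = 0)
    {φ : Ω → ℝ} (hφ : BddMeas m φ) : ∫ o, φ o * u o ∂μ = 0 := by
  have h0 : (fun _ => (0 : ℝ)) =ᵐ[μ] μ[u | m] :=
    ae_eq_condExp_of_forall_setIntegral_eq hm hu.integrable (fun s _ _ => integrableOn_zero)
      (fun s hs _ => by
        rw [setIntegral_eq_zero_of_piSystem hm hC hgen hu.integrable huniv h hs]; simp)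
      stronglyMeasurable_const.aestronglyMeasurable
  have h1 : μ[(fun o => φ o * u o) | m] =ᵐ[μ] fun o => φ o * (μ[u | m]) o :=
    condExp_mul_of_stronglyMeasurable_left hφ.1.stronglyMeasurable
      ((hφ.mono hm).mul hu).integrable hu.integrable
  rw [← integral_condExp hm, ← integral_zero Ω ℝ (μ := μ)]
  refine integral_congr_ae ?_
  filter_upwards [h1, h0] with o h2 h3
  rw [h2, ← h3, mul_zero]

lemma integral_mul_eq_zero_of_measurableSet {Ω : Type*} {m0 : MeasurableSpace Ω} {μ : Measure Ω}
    [IsProbabilityMeasure μ] {m : MeasurableSpace Ω} (hm : m ≤ m0) {u : Ω → ℝ}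
    (hu : BddMeas m0 u) (h : ∀ s, MeasurableSet[m] s → ∫ o in s, u o ∂μ = 0)
    {φ : Ω → ℝ} (hφ : BddMeas m φ) : ∫ o, φ o * u o ∂μ = 0 :=
  integral_mul_eq_zero_of_piSystem hm (@MeasurableSpace.isPiSystem_measurableSet Ω m)
    (@MeasurableSpace.generateFrom_measurableSet Ω m).symm hu
    (by simpa using h Set.univ MeasurableSet.univ) h hφ

/-! ### Past, future and the Markov property -/

section PathSigma

variable {Ω : Type*} {𝒳 : ℕ → Type*} [∀ k, MeasurableSpace (𝒳 k)] {X : (k : ℕ) → Ω → 𝒳 k}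

lemma pastSigma_mono : Monotone (pastSigma X) := fun _ n h =>
  iSup_le fun k => le_iSup (fun k : Set.Iic n => MeasurableSpace.comap (X k) inferInstance)
    ⟨k, le_trans k.2 h⟩

lemma comap_le_pastSigma {k n : ℕ} (h : k ≤ n) :
    MeasurableSpace.comap (X k) inferInstance ≤ pastSigma X n :=
  le_iSup (fun k : Set.Iic n => MeasurableSpace.comap (X k) inferInstance) ⟨k, h⟩

lemma futureSigma_anti : Antitone (futureSigma X) := fun m _ h =>
  iSup_le fun k => le_iSup (fun k : Set.Ici m => MeasurableSpace.comap (X k) inferInstance)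
    ⟨k, le_trans h k.2⟩

lemma comap_le_futureSigma {k n : ℕ} (h : n ≤ k) :
    MeasurableSpace.comap (X k) inferInstance ≤ futureSigma X n :=
  le_iSup (fun k : Set.Ici n => MeasurableSpace.comap (X k) inferInstance) ⟨k, h⟩

lemma futureSigma_eq (j : ℕ) :
    futureSigma X j = MeasurableSpace.comap (tailPath X j) MeasurableSpace.pi := by
  simp only [futureSigma, MeasurableSpace.pi, MeasurableSpace.comap_iSup,
    MeasurableSpace.comap_comp]
  rfl

lemma measurable_comp_tailPath {j : ℕ} {g : PathFrom 𝒳 j → ℝ} (hg : Measurable g) :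
    Measurable[futureSigma X j] fun o => g (tailPath X j o) := by
  rw [futureSigma_eq]
  exact hg.comp (comap_measurable _)

lemma BddMeas.comp_tailPath {j : ℕ} {g : PathFrom 𝒳 j → ℝ} (hg : BddMeas MeasurableSpace.pi g) :
    BddMeas (futureSigma X j) fun o => g (tailPath X j o) := by
  obtain ⟨c, hc⟩ := hg.2
  refine ⟨?_, c, fun o => hc _⟩
  rw [futureSigma_eq]
  exact hg.1.comp (comap_measurable _)

end PathSigma

section Markov

variable {Ω : Type*} [m0 : MeasurableSpace Ω] {μ : Measure Ω} [IsProbabilityMeasure μ]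
  {𝒳 : ℕ → Type*} [∀ k, MeasurableSpace (𝒳 k)] {X : (k : ℕ) → Ω → 𝒳 k}

lemma pastSigma_le (hX : ∀ k, Measurable (X k)) (n : ℕ) : pastSigma X n ≤ m0 :=
  iSup_le fun k => (hX k).comap_le

lemma futureSigma_le (hX : ∀ k, Measurable (X k)) (n : ℕ) : futureSigma X n ≤ m0 :=
  iSup_le fun k => (hX k).comap_le

lemma measurable_tailPath (hX : ∀ k, Measurable (X k)) (j : ℕ) : Measurable (tailPath X j) :=
  measurable_pi_lambda _ fun k => hX k

/-- The one-step Markov property for bounded functions. -/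
lemma IsMarkovChain.exists_step (hX : IsMarkovChain X μ) (n : ℕ) {φ : Ω → ℝ}
    (hφ : BddMeas (MeasurableSpace.comap (X (n + 1)) inferInstance) φ) :
    ∃ ψ, BddMeas (MeasurableSpace.comap (X n) inferInstance) ψ ∧
      ∀ k, BddMeas (pastSigma X n) k → ∫ o, k o * φ o ∂μ = ∫ o, k o * ψ o ∂μ := by
  have hF := pastSigma_le hX.1 n
  have hn := (hX.1 n).comap_le
  have hn1 := (hX.1 (n + 1)).comap_le
  obtain ⟨ψ, hψ, hψ'⟩ := (hφ.mono hn1).exists_condExp μ hn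
  refine ⟨ψ, hψ, fun k hk => ?_⟩
  obtain ⟨k', hk', hkk⟩ := (hk.mono hF).exists_condExp μ hn
  have hu : BddMeas m0 (fun o => k o - k' o) := (hk.mono hF).sub (hk'.mono hn)
  -- The definition covers only events of `X (n + 1)`. Moving the conditioning onto `k` leaves a
  -- claim about `k - k'` that is linear in `φ` and can be checked on such events.
  have h0 : ∫ o, φ o * (k o - k' o) ∂μ = 0 := by
    refine integral_mul_eq_zero_of_measurableSet hn1 hu (fun s hs => ?_) hφ
    obtain ⟨A, hA, rfl⟩ := hs
    have hs' : MeasurableSet (X (n + 1) ⁻¹' A) := hX.1 (n + 1) hA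
    have hI : BddMeas m0 ((X (n + 1) ⁻¹' A).indicator fun _ => (1 : ℝ)) := BddMeas.indicator hs'
    rw [setIntegral_eq_integral_indicator_mul hs']
    have e1 : ∀ l : Ω → ℝ, BddMeas (pastSigma X n) l →
        ∫ o, l o * (X (n + 1) ⁻¹' A).indicator (fun _ => (1 : ℝ)) o ∂μ
          = ∫ o, l o * (μ[(X (n + 1) ⁻¹' A).indicator (fun _ => (1 : ℝ)) |
              MeasurableSpace.comap (X n) inferInstance]) o ∂μ := by
      intro l hl
      have h1 : μ[(fun o => l o * (X (n + 1) ⁻¹' A).indicator (fun _ => (1 : ℝ)) o) |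
          pastSigma X n] =ᵐ[μ] fun o => l o *
            (μ[(X (n + 1) ⁻¹' A).indicator (fun _ => (1 : ℝ)) | pastSigma X n]) o :=
        condExp_mul_of_stronglyMeasurable_left hl.1.stronglyMeasurable
          ((hl.mono hF).mul hI).integrable hI.integrable
      rw [← integral_condExp hF]
      refine integral_congr_ae ?_
      filter_upwards [h1, hX.2 n A hA] with o h2 h3
      rw [h2, h3]
    obtain ⟨p, hp, hp'⟩ := hI.exists_condExp μ hn
    have hpce : (fun o => p o) =ᵐ[μ] μ[(X (n + 1) ⁻¹' A).indicator (fun _ => (1 : ℝ)) |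
              MeasurableSpace.comap (X n) inferInstance] := by
      refine ae_eq_condExp_of_forall_setIntegral_eq hn hI.integrable
        (fun s _ _ => (hp.mono hn).integrable.integrableOn) (fun s hs _ => ?_)
        hp.1.aestronglyMeasurable
      rw [setIntegral_eq_integral_indicator_mul (hn s hs),
        setIntegral_eq_integral_indicator_mul (hn s hs)]
      exact (hp' _ (BddMeas.indicator hs)).symm
    have e2 : ∀ l : Ω → ℝ, BddMeas (pastSigma X n) l →
        ∫ o, l o * (X (n + 1) ⁻¹' A).indicator (fun _ => (1 : ℝ)) o ∂μ = ∫ o, l o * p o ∂μ := by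
      intro l hl
      rw [e1 l hl]
      refine integral_congr_ae ?_
      filter_upwards [hpce] with o ho
      rw [← ho]
    have e3 := e2 k hk
    have e4 := e2 k' (hk'.mono (comap_le_pastSigma le_rfl))
    have e5 := hkk p hp
    have e6 : ∫ o, k o * p o ∂μ = ∫ o, k' o * p o ∂μ := by
      simpa only [mul_comm] using e5
    calc ∫ o, (X (n + 1) ⁻¹' A).indicator (fun _ => (1 : ℝ)) o * (k o - k' o) ∂μ
        = ∫ o, (k o * (X (n + 1) ⁻¹' A).indicator (fun _ => (1 : ℝ)) o
            - k' o * (X (n + 1) ⁻¹' A).indicator (fun _ => (1 : ℝ)) o) ∂μ :=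
          integral_congr_ae (ae_of_all _ fun o => by ring)
      _ = 0 := by
        rw [integral_sub ((hk.mono hF).mul hI).integrable ((hk'.mono hn).mul hI).integrable,
          e3, e4, e6, sub_self]
  have h1 : ∫ o, k o * φ o ∂μ = ∫ o, k' o * φ o ∂μ := by
    rw [← sub_eq_zero, ← integral_sub ((hk.mono hF).mul (hφ.mono hn1)).integrable
      ((hk'.mono hn).mul (hφ.mono hn1)).integrable, ← h0]
    exact integral_congr_ae (ae_of_all _ fun o => by ring)
  rw [h1, hψ' k' hk']
  simpa only [mul_comm] using (hkk ψ hψ).symm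

/-- Applying the one-step property from the far end backwards reduces a cylinder function of `X n,
…, X (n + l - 1)` to a function of `X n`. -/
lemma IsMarkovChain.exists_prod (hX : IsMarkovChain X μ) (l : ℕ) : ∀ (n : ℕ) (g : ℕ → Ω → ℝ),
    (∀ i, BddMeas (MeasurableSpace.comap (X i) inferInstance) (g i)) →
    ∃ ψ, BddMeas (MeasurableSpace.comap (X n) inferInstance) ψ ∧
      ∀ k, BddMeas (pastSigma X n) k →
        ∫ o, k o * ∏ i ∈ Finset.Ico n (n + l), g i o ∂μ = ∫ o, k o * ψ o ∂μ := by
  induction l with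
  | zero => exact fun n g _ => ⟨fun _ => 1, BddMeas.const 1, fun k _ => by simp⟩
  | succ l ih =>
    intro n g hg
    obtain ⟨ψ, hψ, h1⟩ := ih (n + 1) g hg
    obtain ⟨ψ', hψ', h2⟩ := hX.exists_step n hψ
    refine ⟨fun o => g n o * ψ' o, (hg n).mul hψ', fun k hk => ?_⟩
    have hkg := hk.mul ((hg n).mono (comap_le_pastSigma (X := X) (le_refl n)))
    have e : ∀ o, k o * ∏ i ∈ Finset.Ico n (n + (l + 1)), g i o
        = (k o * g n o) * ∏ i ∈ Finset.Ico (n + 1) (n + 1 + l), g i o := fun o => by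
      rw [Finset.prod_eq_prod_Ico_succ_bot (by omega), show n + (l + 1) = n + 1 + l by omega]
      ring
    simp only [e]
    rw [h1 _ (hkg.mono (pastSigma_mono (Nat.le_succ n))), h2 _ hkg]
    exact integral_congr_ae (ae_of_all _ fun o => by ring)

/-- The past and the future are conditionally independent given the present. -/
lemma IsMarkovChain.exists_of_past (hX : IsMarkovChain X μ) (n : ℕ) {k : Ω → ℝ}
    (hk : BddMeas (pastSigma X n) k) :
    ∃ k', BddMeas (MeasurableSpace.comap (X n) inferInstance) k' ∧
      ∀ φ, BddMeas (futureSigma X n) φ → ∫ o, k o * φ o ∂μ = ∫ o, k' o * φ o ∂μ := by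
  have hF := pastSigma_le hX.1 n
  have hn := (hX.1 n).comap_le
  have hG := futureSigma_le hX.1 n
  obtain ⟨k', hk', hkk⟩ := (hk.mono hF).exists_condExp μ hn
  refine ⟨k', hk', fun φ hφ => ?_⟩
  have hu : BddMeas m0 (fun o => k o - k' o) := (hk.mono hF).sub (hk'.mono hn)
  have hgen := generateFrom_piiUnionInter_measurableSet
    (fun i => MeasurableSpace.comap (X i) inferInstance) (Set.Ici n)
  have hpi := isPiSystem_piiUnionInter
    (fun i => {s | MeasurableSet[MeasurableSpace.comap (X i) inferInstance] s})
    (fun i => @MeasurableSpace.isPiSystem_measurableSet Ω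
      (MeasurableSpace.comap (X i) inferInstance)) (Set.Ici n)
  have hgen' : futureSigma X n = MeasurableSpace.generateFrom (piiUnionInter
      (fun i => {s | MeasurableSet[MeasurableSpace.comap (X i) inferInstance] s}) (Set.Ici n)) := by
    rw [hgen, futureSigma, iSup_subtype']
  -- Products of one-coordinate functions include the indicators of cylinders, a π-system generating
  -- the future; factors equal to `1` fill the unused coordinates.
  have hcyl : ∀ (l : ℕ) (g : ℕ → Ω → ℝ),
      (∀ i, BddMeas (MeasurableSpace.comap (X i) inferInstance) (g i)) →
      ∫ o, (∏ i ∈ Finset.Ico n (n + l), g i o) * (k o - k' o) ∂μ = 0 := by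
    intro l g hg
    obtain ⟨ψ, hψ, h1⟩ := hX.exists_prod l n g hg
    have e1 := h1 k hk
    have e2 := h1 k' (hk'.mono (comap_le_pastSigma le_rfl))
    have e3 : ∫ o, k o * ψ o ∂μ = ∫ o, k' o * ψ o ∂μ := by
      simpa only [mul_comm] using hkk ψ hψ
    have hp : BddMeas m0 (fun o => ∏ i ∈ Finset.Ico n (n + l), g i o) := by
      induction Finset.Ico n (n + l) using Finset.induction_on with
      | empty => simpa using BddMeas.const 1
      | insert i s hi ih =>
        simp only [Finset.prod_insert hi]
        exact ((hg i).mono (hX.1 i).comap_le).mul ih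
    calc ∫ o, (∏ i ∈ Finset.Ico n (n + l), g i o) * (k o - k' o) ∂μ
        = ∫ o, (k o * ∏ i ∈ Finset.Ico n (n + l), g i o
            - k' o * ∏ i ∈ Finset.Ico n (n + l), g i o) ∂μ :=
          integral_congr_ae (ae_of_all _ fun o => by ring)
      _ = 0 := by
        rw [integral_sub ((hk.mono hF).mul hp).integrable ((hk'.mono hn).mul hp).integrable,
          e1, e2, e3, sub_self]
  have h0 : ∫ o, φ o * (k o - k' o) ∂μ = 0 := by
    refine integral_mul_eq_zero_of_piSystem hG hpi hgen' hu
      (by simpa using hcyl 0 (fun _ _ => 1) fun i => BddMeas.const 1) (fun s hs => ?_) hφ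
    obtain ⟨t, ht, f, hf, rfl⟩ := hs
    have hfm : ∀ i ∈ t, MeasurableSet (f i) := fun i hi => (hX.1 i).comap_le _ (hf i hi)
    rw [setIntegral_eq_integral_indicator_mul (t.measurableSet_biInter hfm)]
    classical
    obtain ⟨l, hl⟩ : ∃ l, ∀ i ∈ t, i < n + l := by
      obtain ⟨N, hN⟩ := t.exists_nat_subset_range
      exact ⟨N, fun i hi => by have := Finset.mem_range.1 (hN hi); omega⟩
    rw [← hcyl l (fun i => if i ∈ t then (f i).indicator (fun _ => 1) else fun _ => 1) fun i => ?_]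
    · refine integral_congr_ae (ae_of_all _ fun o => ?_)
      dsimp only
      congr 1
      by_cases ho : o ∈ ⋂ i ∈ t, f i
      · rw [Set.indicator_of_mem ho]
        symm
        refine Finset.prod_eq_one fun i _ => ?_
        by_cases hi : i ∈ t
        · have : o ∈ f i := by
            simp only [Set.mem_iInter] at ho
            exact ho i hi
          simp [hi, this]
        · simp [hi]
      · rw [Set.indicator_of_notMem ho]
        symm
        simp only [Set.mem_iInter, not_forall] at ho
        obtain ⟨i, hi, hio⟩ := ho
        refine Finset.prod_eq_zero (i := i) (Finset.mem_Ico.2 ⟨ht hi, hl i hi⟩) ?_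
        simp [hi, hio]
    · by_cases hi : i ∈ t
      · simp only [hi, if_true]
        exact BddMeas.indicator (hf i hi)
      · simp only [hi, if_false]
        exact BddMeas.const 1
  rw [← sub_eq_zero, ← integral_sub ((hk.mono hF).mul (hφ.mono hG)).integrable
    ((hk'.mono hn).mul (hφ.mono hG)).integrable, ← h0]
  exact integral_congr_ae (ae_of_all _ fun o => by ring)

end Markov

/-! ### Total variation and integrals -/

lemma abs_measureReal_sub_le_tvDistance {S : Type*} [MeasurableSpace S] (P Q : Measure S)
    [IsProbabilityMeasure P] [IsProbabilityMeasure Q] {Γ : Set S} (hΓ : MeasurableSet Γ) :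
    |P.real Γ - Q.real Γ| ≤ tvDistance P Q := by
  refine le_ciSup (f := fun Γ : {Γ : Set S // MeasurableSet Γ} => |P.real Γ - Q.real Γ|)
    ⟨1, ?_⟩ ⟨Γ, hΓ⟩
  rintro _ ⟨Γ, rfl⟩
  have h1 := measureReal_nonneg (μ := P) (s := Γ)
  have h2 := measureReal_nonneg (μ := Q) (s := Γ)
  have h3 := measureReal_le_one (μ := P) (s := Γ)
  have h4 := measureReal_le_one (μ := Q) (s := Γ)
  exact abs_le.2 ⟨by linarith, by linarith⟩

/-- Layer-cake formula: after subtracting its infimum, `g` takes values in `[0, r]`, and its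
integral is that of the probabilities of its superlevel sets over `(0, r]`. No factor `2` is lost,
which is essential for a contraction by `δ < 1`. -/
lemma abs_integral_sub_le_tvDistance {S : Type*} [MeasurableSpace S] (P Q : Measure S)
    [IsProbabilityMeasure P] [IsProbabilityMeasure Q] {g : S → ℝ} (hg : Measurable g) {r : ℝ}
    (hr : ∀ x y, |g x - g y| ≤ r) : |∫ x, g x ∂P - ∫ x, g x ∂Q| ≤ r * tvDistance P Q := by
  obtain ⟨x₀⟩ := P.nonempty_of_neZero
  have hr0 : 0 ≤ r := (abs_nonneg _).trans (hr x₀ x₀)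
  have hbb : BddBelow (Set.range g) := by
    refine ⟨g x₀ - r, ?_⟩
    rintro _ ⟨x, rfl⟩
    linarith [(abs_le.1 (hr x x₀)).1]
  set c := sInf (Set.range g) with hc
  have hf0 : ∀ x, 0 ≤ g x - c := fun x => sub_nonneg.2 (csInf_le hbb ⟨x, rfl⟩)
  have hfr : ∀ x, g x - c ≤ r := fun x => by
    have : g x - r ≤ c := le_csInf ⟨g x₀, x₀, rfl⟩ (by
      rintro _ ⟨y, rfl⟩
      linarith [(abs_le.1 (hr x y)).2])
    linarith
  have hfm : BddMeas (inferInstance : MeasurableSpace S) fun x => g x - c :=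
    ⟨hg.sub_const c, r, fun x => by rw [abs_of_nonneg (hf0 x)]; exact hfr x⟩
  have hgm : BddMeas (inferInstance : MeasurableSpace S) g := by
    simpa using hfm.add (BddMeas.const c)
  have key : ∀ (ν : Measure S) [IsProbabilityMeasure ν],
      ∫ x, g x ∂ν = c + ∫ t in Set.Ioc 0 r, ν.real {x | t < g x - c} := by
    intro ν _
    have h1 : ∫ x, g x ∂ν = c + ∫ x, (g x - c) ∂ν := by
      rw [integral_sub hgm.integrable (integrable_const c)]
      simp
    rw [h1, Integrable.integral_eq_integral_meas_lt hfm.integrable (ae_of_all _ hf0)]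
    congr 1
    refine setIntegral_eq_of_subset_of_forall_sdiff_eq_zero measurableSet_Ioi
      (fun t ht => ht.1) fun t ht => ?_
    have : {x | t < g x - c} = ∅ := by
      ext x
      simp only [Set.mem_ofPred_eq, Set.mem_empty_iff_false, iff_false, not_lt]
      refine (hfr x).trans ?_
      by_contra hcon
      exact ht.2 ⟨ht.1, (not_le.1 hcon).le⟩
    simp [this]
  have hint : ∀ (ν : Measure S) [IsProbabilityMeasure ν],
      IntegrableOn (fun t => ν.real {x | t < g x - c}) (Set.Ioc 0 r) := by
    intro ν _
    have hanti : Antitone fun t => ν.real {x | t < g x - c} := fun s t hst =>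
      measureReal_mono fun x (hx : t < g x - c) => (lt_of_le_of_lt hst hx : s < g x - c)
    exact Integrable.of_bound hanti.measurable.aestronglyMeasurable 1 (ae_of_all _ fun t => by
      rw [Real.norm_of_nonneg measureReal_nonneg]; exact measureReal_le_one)
  rw [key P, key Q, add_sub_add_left_eq_sub, ← integral_sub (hint P) (hint Q)]
  have := norm_setIntegral_le_of_norm_le_const (μ := volume) (s := Set.Ioc 0 r)
    (f := fun t => P.real {x | t < g x - c} - Q.real {x | t < g x - c}) (C := tvDistance P Q)
    (by simp) fun t _ => abs_measureReal_sub_le_tvDistance P Q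
      (measurableSet_lt measurable_const hfm.1)
  simpa [hr0, mul_comm] using this

/-! ### Path space and the transfer operator -/

section PathSpace

variable {𝒳 : ℕ → Type*} {j : ℕ}

/-- Forget the first coordinate of a path. -/
def pathTail (x : PathFrom 𝒳 j) : PathFrom 𝒳 (j + 1) :=
  fun k => x ⟨k, (Nat.le_succ j).trans k.2⟩

/-- The first coordinate of a path. -/
def pathHead (x : PathFrom 𝒳 j) : 𝒳 j := x ⟨j, le_refl j⟩

/-- Prepend a first coordinate to a path. -/
def pathCons (z : 𝒳 j) (x : PathFrom 𝒳 (j + 1)) : PathFrom 𝒳 j := fun k =>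
  if h : j = k then cast (congrArg 𝒳 h) z
  else x ⟨k, Nat.succ_le_of_lt (lt_of_le_of_ne k.2 h)⟩

@[simp] lemma pathHead_pathCons (z : 𝒳 j) (x : PathFrom 𝒳 (j + 1)) :
    pathHead (pathCons z x) = z := by
  simp [pathHead, pathCons]

@[simp] lemma pathTail_pathCons (z : 𝒳 j) (x : PathFrom 𝒳 (j + 1)) :
    pathTail (pathCons z x) = x := by
  funext k
  have hk : j ≠ k := Nat.ne_of_lt k.2
  simp [pathTail, pathCons, hk]

@[simp] lemma pathCons_head_tail (x : PathFrom 𝒳 j) :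
    pathCons (pathHead x) (pathTail x) = x := by
  funext ⟨k, hk⟩
  by_cases h : j = k
  · subst h
    simp [pathHead, pathCons]
  · simp [pathTail, pathCons, h]

@[simp] lemma pathTail_tailPath {Ω : Type*} (X : (k : ℕ) → Ω → 𝒳 k) (o : Ω) :
    pathTail (tailPath X j o) = tailPath X (j + 1) o := rfl

@[simp] lemma pathHead_tailPath {Ω : Type*} (X : (k : ℕ) → Ω → 𝒳 k) (o : Ω) :
    pathHead (tailPath X j o) = X j o := rfl

lemma pathCons_tailPath {Ω : Type*} (X : (k : ℕ) → Ω → 𝒳 k) (o : Ω) :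
    pathCons (X j o) (tailPath X (j + 1) o) = tailPath X j o :=
  pathCons_head_tail (tailPath X j o)

variable [∀ k, MeasurableSpace (𝒳 k)]

lemma measurable_pathTail : Measurable (pathTail : PathFrom 𝒳 j → PathFrom 𝒳 (j + 1)) :=
  measurable_pi_lambda _ fun _ => measurable_pi_apply _

lemma measurable_pathHead : Measurable (pathHead : PathFrom 𝒳 j → 𝒳 j) := measurable_pi_apply _

lemma measurable_pathCons :
    Measurable fun p : PathFrom 𝒳 (j + 1) × 𝒳 j => pathCons p.2 p.1 := by
  refine measurable_pi_lambda _ fun ⟨k, hk⟩ => ?_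
  by_cases h : j = k
  · subst h
    simpa [pathCons] using measurable_snd
  · simpa [pathCons, h] using! (measurable_pi_apply _).comp measurable_fst

/-- The transfer operator `g ↦ ∫ g(z, x) P_j(dz | x_{j+1})`. -/
noncomputable def transfer (P : (j : ℕ) → Kernel (𝒳 (j + 1)) (𝒳 j)) (j : ℕ)
    (g : PathFrom 𝒳 j → ℝ) (x : PathFrom 𝒳 (j + 1)) : ℝ :=
  ∫ z, g (pathCons z x) ∂(P j (pathHead x))

variable (P : (j : ℕ) → Kernel (𝒳 (j + 1)) (𝒳 j)) [∀ j, IsMarkovKernel (P j)]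

lemma BddMeas.comp_pathCons {g : PathFrom 𝒳 j → ℝ} (hg : BddMeas MeasurableSpace.pi g)
    (x : PathFrom 𝒳 (j + 1)) : BddMeas (inferInstance : MeasurableSpace (𝒳 j))
      fun z => g (pathCons z x) := by
  obtain ⟨c, hc⟩ := hg.2
  exact ⟨hg.1.comp (measurable_pathCons.comp (measurable_const.prodMk measurable_id)), c,
    fun z => hc _⟩

lemma BddMeas.transfer {g : PathFrom 𝒳 j → ℝ} (hg : BddMeas MeasurableSpace.pi g) :
    BddMeas MeasurableSpace.pi (transfer P j g) := by
  obtain ⟨c, hc⟩ := hg.2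
  refine ⟨?_, c, fun x => ?_⟩
  · have h1 : StronglyMeasurable fun p : PathFrom 𝒳 (j + 1) × 𝒳 j => g (pathCons p.2 p.1) :=
      (hg.1.comp measurable_pathCons).stronglyMeasurable
    exact (h1.integral_kernel_prod_right' (κ := (P j).comap pathHead measurable_pathHead)).measurable
  · have := norm_integral_le_of_norm_le_const (μ := P j (pathHead x))
      (f := fun z => g (pathCons z x)) (C := c) (ae_of_all _ fun z => hc (pathCons z x))
    simpa using! this

end PathSpace

/-! ### Reverse Markov property and triviality of the tail -/

section Reverse

variable {Ω : Type*} [m0 : MeasurableSpace Ω] {μ : Measure Ω} [IsProbabilityMeasure μ]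
  {𝒳 : ℕ → Type*} [∀ k, MeasurableSpace (𝒳 k)] {X : (k : ℕ) → Ω → 𝒳 k}
  {P : (j : ℕ) → Kernel (𝒳 (j + 1)) (𝒳 j)} [∀ j, IsMarkovKernel (P j)]

lemma HasCondDistrib.integral_indicator_mul (hX : ∀ k, Measurable (X k)) {j : ℕ}
    (hP : HasCondDistrib (X j) (X (j + 1)) (P j) μ) {t : Set (𝒳 j)} (ht : MeasurableSet t)
    {θ : Ω → ℝ} (hθ : BddMeas (MeasurableSpace.comap (X (j + 1)) inferInstance) θ) :
    ∫ o, (X j ⁻¹' t).indicator (fun _ => (1 : ℝ)) o * θ o ∂μ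
      = ∫ o, (P j (X (j + 1) o)).real t * θ o ∂μ := by
  obtain ⟨η, hη, rfl⟩ := hθ.1.exists_eq_measurable_comp
  have hpair : Measurable fun o => (X (j + 1) o, X j o) := (hX _).prodMk (hX _)
  have hF : Measurable fun p : 𝒳 (j + 1) × 𝒳 j => t.indicator (fun _ => (1 : ℝ)) p.2 * η p.1 :=
    ((measurable_const.indicator ht).comp measurable_snd).mul (hη.comp measurable_fst)
  have hint : Integrable (fun p : 𝒳 (j + 1) × 𝒳 j => t.indicator (fun _ => (1 : ℝ)) p.2 * η p.1)
      (μ.map (X (j + 1)) ⊗ₘ P j) := by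
    rw [← hP.map_eq, integrable_map_measure hF.aestronglyMeasurable hpair.aemeasurable]
    exact (BddMeas.mul (BddMeas.indicator (hX j ht)) (hθ.mono (hX _).comap_le)).integrable
  have h1 : ∫ o, (X j ⁻¹' t).indicator (fun _ => (1 : ℝ)) o * (η ∘ X (j + 1)) o ∂μ
      = ∫ p, t.indicator (fun _ => (1 : ℝ)) p.2 * η p.1 ∂(μ.map (X (j + 1)) ⊗ₘ P j) := by
    rw [← hP.map_eq, integral_map hpair.aemeasurable hF.aestronglyMeasurable]
    rfl
  rw [h1, Measure.integral_compProd hint]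
  have h2 : ∀ x, ∫ y, t.indicator (fun _ => (1 : ℝ)) y * η x ∂(P j x) = (P j x).real t * η x := by
    intro x
    rw [integral_mul_const, show ∫ y, t.indicator (fun _ => (1 : ℝ)) y ∂(P j x) = (P j x).real t
      from integral_indicator_one ht]
  simp only [h2]
  rw [integral_map (hX _).aemeasurable]
  · rfl
  · exact (((P j).measurable_coe ht).ennreal_toReal.mul hη).aestronglyMeasurable

/-- The reverse Markov property: `P j` is the conditional law of `X j` given the whole future. -/
lemma IsMarkovChain.map_tailPath_prodMk (hX : IsMarkovChain X μ) {j : ℕ}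
    (hP : HasCondDistrib (X j) (X (j + 1)) (P j) μ) :
    μ.map (fun o => (tailPath X (j + 1) o, X j o))
      = μ.map (tailPath X (j + 1)) ⊗ₘ (P j).comap pathHead measurable_pathHead := by
  have htail := measurable_tailPath hX.1 (j + 1)
  have hpair : Measurable fun o => (tailPath X (j + 1) o, X j o) := htail.prodMk (hX.1 j)
  have := Measure.isProbabilityMeasure_map (μ := μ) htail.aemeasurable
  have := Measure.isProbabilityMeasure_map (μ := μ) hpair.aemeasurable
  refine Measure.ext_prod fun {s t} hs ht => ?_
  have hG := futureSigma_le hX.1 (j + 1)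
  have hn := (hX.1 (j + 1)).comap_le
  have hnG := comap_le_futureSigma (X := X) (le_refl (j + 1))
  have hk : BddMeas (pastSigma X (j + 1)) ((X j ⁻¹' t).indicator fun _ => (1 : ℝ)) :=
    BddMeas.indicator (comap_le_pastSigma (X := X) (Nat.le_succ j) _ ⟨t, ht, rfl⟩)
  have hφ : BddMeas (futureSigma X (j + 1))
      ((tailPath X (j + 1) ⁻¹' s).indicator fun _ => (1 : ℝ)) := by
    refine BddMeas.indicator ?_
    rw [futureSigma_eq]
    exact ⟨s, hs, rfl⟩
  have hp : BddMeas (MeasurableSpace.comap (X (j + 1)) inferInstance)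
      fun o => (P j (X (j + 1) o)).real t :=
    ⟨((P j).measurable_coe ht).ennreal_toReal.comp (comap_measurable _), 1, fun o => by
      rw [abs_of_nonneg measureReal_nonneg]; exact measureReal_le_one⟩
  obtain ⟨k', hk', h1⟩ := hX.exists_of_past (j + 1) hk
  obtain ⟨φ', hφ', h2⟩ := (hφ.mono hG).exists_condExp μ hn
  have h3 : ∫ o, (X j ⁻¹' t).indicator (fun _ => (1 : ℝ)) o *
      (tailPath X (j + 1) ⁻¹' s).indicator (fun _ => (1 : ℝ)) o ∂μ
      = ∫ o, (P j (X (j + 1) o)).real t *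
        (tailPath X (j + 1) ⁻¹' s).indicator (fun _ => (1 : ℝ)) o ∂μ := by
    -- The past event and the future event are conditioned on `X (j + 1)` in turn; then the past
    -- event is restored, so that `P j` meets only a function of `X (j + 1)`, and finally the future
    -- event is restored.
    rw [h1 _ hφ, h2 _ hk', ← h1 _ (hφ'.mono hnG),
      HasCondDistrib.integral_indicator_mul hX.1 hP ht hφ', h2 _ hp]
  have h4 : ∫ o, (X j ⁻¹' t).indicator (fun _ => (1 : ℝ)) o *
      (tailPath X (j + 1) ⁻¹' s).indicator (fun _ => (1 : ℝ)) o ∂μ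
      = (μ.map (fun o => (tailPath X (j + 1) o, X j o))).real (s ×ˢ t) := by
    rw [map_measureReal_apply hpair (hs.prod ht), ← integral_indicator_one (hpair (hs.prod ht))]
    refine integral_congr_ae (ae_of_all _ fun o => ?_)
    by_cases hs' : tailPath X (j + 1) o ∈ s <;> by_cases ht' : X j o ∈ t <;>
      simp [Set.indicator, hs', ht']
  have h5 : ∫ o, (P j (X (j + 1) o)).real t *
        (tailPath X (j + 1) ⁻¹' s).indicator (fun _ => (1 : ℝ)) o ∂μ
      = (μ.map (tailPath X (j + 1)) ⊗ₘ (P j).comap pathHead measurable_pathHead).real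
        (s ×ˢ t) := by
    have hm : Measurable fun x : PathFrom 𝒳 (j + 1) => P j (pathHead x) t :=
      ((P j).measurable_coe ht).comp measurable_pathHead
    rw [measureReal_def, Measure.compProd_apply_prod hs ht, setLIntegral_map hs
      (by simpa using hm) htail, ← integral_toReal]
    · rw [← integral_indicator (htail hs)]
      refine integral_congr_ae (ae_of_all _ fun o => ?_)
      by_cases ho : tailPath X (j + 1) o ∈ s <;>
        simp [Set.indicator, ho, Kernel.comap_apply, measureReal_def]
    · exact (hm.comp htail).aemeasurable
    · exact ae_of_all _ fun o => measure_lt_top _ _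
  rw [h3, h5] at h4
  rw [← ENNReal.toReal_eq_toReal_iff' (measure_ne_top _ _) (measure_ne_top _ _)]
  exact h4.symm

/-- Identifies `transfer P j` with conditional expectation given the future from `j + 1`, in tested
form. -/
lemma IsMarkovChain.integral_mul_transfer (hX : IsMarkovChain X μ) {j : ℕ}
    (hP : HasCondDistrib (X j) (X (j + 1)) (P j) μ) {g : PathFrom 𝒳 j → ℝ}
    (hg : BddMeas MeasurableSpace.pi g) {h : Ω → ℝ} (hh : BddMeas (futureSigma X (j + 1)) h) :
    ∫ o, h o * g (tailPath X j o) ∂μ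
      = ∫ o, h o * transfer P j g (tailPath X (j + 1) o) ∂μ := by
  have htail := measurable_tailPath hX.1 (j + 1)
  have hpair : Measurable fun o => (tailPath X (j + 1) o, X j o) := htail.prodMk (hX.1 j)
  have := Measure.isProbabilityMeasure_map (μ := μ) htail.aemeasurable
  have hh' := hh.1
  rw [futureSigma_eq] at hh'
  obtain ⟨η, hη, rfl⟩ := hh'.exists_eq_measurable_comp
  have hF : Measurable fun p : PathFrom 𝒳 (j + 1) × 𝒳 j => η p.1 * g (pathCons p.2 p.1) :=
    (hη.comp measurable_fst).mul (hg.1.comp measurable_pathCons)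
  have e : ∀ o, (η ∘ tailPath X (j + 1)) o * g (tailPath X j o)
      = η (tailPath X (j + 1) o) * g (pathCons (X j o) (tailPath X (j + 1) o)) := fun o => by
    rw [pathCons_tailPath]; rfl
  have hint : Integrable (fun p : PathFrom 𝒳 (j + 1) × 𝒳 j => η p.1 * g (pathCons p.2 p.1))
      (μ.map (tailPath X (j + 1)) ⊗ₘ (P j).comap pathHead measurable_pathHead) := by
    rw [← hX.map_tailPath_prodMk hP,
      integrable_map_measure hF.aestronglyMeasurable hpair.aemeasurable]
    refine ((hh.mono (futureSigma_le hX.1 _)).mul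
      ((hg.comp_tailPath (X := X)).mono (futureSigma_le hX.1 _))).integrable.congr
      (ae_of_all _ fun o => ?_)
    exact e o
  simp only [e]
  have h1 := integral_map hpair.aemeasurable (μ := μ) hF.aestronglyMeasurable
  rw [← h1, hX.map_tailPath_prodMk hP, Measure.integral_compProd hint]
  simp only [Kernel.comap_apply, integral_const_mul]
  exact integral_map htail.aemeasurable (f := fun x => η x * transfer P j g x)
    (hη.mul (hg.transfer P).1).aestronglyMeasurable

/-- Each kernel multiplies oscillations by at most `δ`, so conditioning a function of `X m` on a
future `i` steps away leaves oscillation at most `δ ^ i * c`. -/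
lemma IsMarkovChain.exists_iterate (hX : IsMarkovChain X μ)
    (hP : ∀ j, HasCondDistrib (X j) (X (j + 1)) (P j) μ) {δ : ℝ}
    (hTV : ∀ j, ∀ x y : 𝒳 (j + 1), tvDistance (P j x) (P j y) ≤ δ) {m : ℕ} {φ : 𝒳 m → ℝ}
    (hφ : Measurable φ) {c : ℝ} (hc : ∀ x y, |φ x - φ y| ≤ c) (i : ℕ) :
    ∃ φ' : 𝒳 (m + i) → ℝ, Measurable φ' ∧ (∀ x y, |φ' x - φ' y| ≤ δ ^ i * c) ∧
      ∀ V, BddMeas (futureSigma X (m + i)) V →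
        ∫ o, V o * φ (X m o) ∂μ = ∫ o, V o * φ' (X (m + i) o) ∂μ := by
  induction i with
  | zero => exact ⟨φ, hφ, by simpa using hc, fun V _ => rfl⟩
  | succ i ih =>
    obtain ⟨φ', hφ', hosc, h⟩ := ih
    obtain ⟨o₀⟩ := μ.nonempty_of_neZero
    have hb : ∀ x, |φ' x| ≤ |φ' (X (m + i) o₀)| + δ ^ i * c := fun x => by
      have := abs_sub_abs_le_abs_sub (φ' x) (φ' (X (m + i) o₀))
      linarith [hosc x (X (m + i) o₀)]
    have hg : BddMeas MeasurableSpace.pi fun x : PathFrom 𝒳 (m + i) => φ' (pathHead x) :=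
      ⟨hφ'.comp measurable_pathHead, _, fun x => hb _⟩
    refine ⟨fun x => ∫ z, φ' z ∂(P (m + i) x), ?_, fun x y => ?_, fun V hV => ?_⟩
    · exact (StronglyMeasurable.integral_kernel hφ'.stronglyMeasurable).measurable
    · have h0 : 0 ≤ δ ^ i * c := (abs_nonneg _).trans (hosc (X (m + i) o₀) (X (m + i) o₀))
      refine (abs_integral_sub_le_tvDistance _ _ hφ' hosc).trans ?_
      calc δ ^ i * c * tvDistance (P (m + i) x) (P (m + i) y) ≤ δ ^ i * c * δ := by
            gcongr
            exact hTV _ _ _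
        _ = _ := by ring
    · rw [h V (hV.mono (futureSigma_anti (by omega)))]
      have := hX.integral_mul_transfer (hP (m + i)) hg hV
      simpa [transfer] using! this

/-- The tail σ-algebra of the chain is trivial. -/
lemma IsMarkovChain.ae_eq_integral_of_tail (hX : IsMarkovChain X μ)
    (hP : ∀ j, HasCondDistrib (X j) (X (j + 1)) (P j) μ) {δ : ℝ} (hδ0 : 0 ≤ δ) (hδ1 : δ < 1)
    (hTV : ∀ j, ∀ x y : 𝒳 (j + 1), tvDistance (P j x) (P j y) ≤ δ) {W : Ω → ℝ}
    (hW : ∀ n, BddMeas (futureSigma X n) W) : ∀ᵐ o ∂μ, W o = ∫ o', W o' ∂μ := by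
  have hW0 := (hW 0).mono (futureSigma_le hX.1 0)
  set w := ∫ o', W o' ∂μ with hw
  have hu : BddMeas m0 fun o => W o - w := hW0.sub (BddMeas.const w)
  have hu0 : ∫ o, (W o - w) ∂μ = 0 := by
    rw [integral_sub hW0.integrable (integrable_const _)]
    simp [hw]
  have hun : ∀ n, BddMeas (futureSigma X n) fun o => W o - w := fun n =>
    (hW n).sub (BddMeas.const w)
  -- A function of the past becomes one of `X m`, then one of `X (m + i)` with oscillation of order
  -- `δ ^ i`; its constant part integrates to zero against `W - w`. As all pasts together generate
  -- `futureSigma X 0`, the variable `W - w` is orthogonal to itself.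
  have hpast : ∀ m k, BddMeas (pastSigma X m) k → ∫ o, k o * (W o - w) ∂μ = 0 := by
    intro m k hk
    obtain ⟨k', hk', h1⟩ := hX.exists_of_past m hk
    rw [h1 _ (hun m)]
    obtain ⟨φ, hφ, rfl⟩ := hk'.1.exists_eq_measurable_comp
    obtain ⟨c, hc⟩ := hk'.2
    obtain ⟨d, hd⟩ := hu.2
    obtain ⟨o₀⟩ := μ.nonempty_of_neZero
    have hc0 : 0 ≤ c := (abs_nonneg _).trans (hc o₀)
    have hd0 : 0 ≤ d := (abs_nonneg _).trans (hd o₀)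
    -- The factor `φ` is bounded only on the range of `X m`; clipping makes it bounded on the whole
    -- space.
    let ψ : 𝒳 m → ℝ := fun x => max (-c) (min c (φ x))
    have hψ : Measurable ψ := measurable_const.max (measurable_const.min hφ)
    have hψb : ∀ x, |ψ x| ≤ c := fun x =>
      abs_le.2 ⟨le_max_left _ _, max_le (by linarith) (min_le_left _ _)⟩
    have hψφ : ∀ o, (φ ∘ X m) o = ψ (X m o) := fun o => by
      have := abs_le.1 (hc o)
      simp only [Function.comp_apply, ψ] at this ⊢
      rw [min_eq_right this.2, max_eq_right this.1]
    simp only [hψφ]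
    have hle : ∀ i : ℕ, |∫ o, ψ (X m o) * (W o - w) ∂μ| ≤ δ ^ i * (2 * c) * d := by
      intro i
      obtain ⟨φ', hφ', hosc, h⟩ := hX.exists_iterate hP hTV hψ (c := 2 * c) (fun x y => by
        have := abs_sub (ψ x) (ψ y)
        linarith [hψb x, hψb y]) i
      have h2 := h _ (hun (m + i))
      have hb : ∀ x, |φ' x - φ' (X (m + i) o₀)| ≤ δ ^ i * (2 * c) := fun x => hosc _ _
      have hφb : BddMeas m0 fun o => φ' (X (m + i) o) - φ' (X (m + i) o₀) :=
        ⟨(hφ'.comp (hX.1 _)).sub_const _, _, fun o => hb _⟩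
      have h3 : ∫ o, ψ (X m o) * (W o - w) ∂μ
          = ∫ o, (W o - w) * (φ' (X (m + i) o) - φ' (X (m + i) o₀)) ∂μ := by
        have e1 : ∫ o, ψ (X m o) * (W o - w) ∂μ = ∫ o, (W o - w) * ψ (X m o) ∂μ :=
          integral_congr_ae (ae_of_all _ fun o => mul_comm _ _)
        rw [e1, h2]
        have e2 : ∀ o, (W o - w) * φ' (X (m + i) o)
            = (W o - w) * (φ' (X (m + i) o) - φ' (X (m + i) o₀))
              + φ' (X (m + i) o₀) * (W o - w) := fun o => by ring
        simp only [e2]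
        rw [integral_add (hu.mul hφb).integrable (hu.const_mul _).integrable, integral_const_mul,
          hu0, mul_zero, add_zero]
      rw [h3]
      have h4 := norm_integral_le_of_norm_le_const (μ := μ)
        (f := fun o => (W o - w) * (φ' (X (m + i) o) - φ' (X (m + i) o₀)))
        (C := d * (δ ^ i * (2 * c))) (ae_of_all _ fun o => by
          rw [norm_mul]
          exact mul_le_mul (hd o) (hb _) (norm_nonneg _) hd0)
      rw [probReal_univ, mul_one, mul_comm d] at h4
      exact h4
    have hlim : Tendsto (fun i : ℕ => δ ^ i * (2 * c) * d) atTop (𝓝 0) := by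
      simpa using ((tendsto_pow_atTop_nhds_zero_of_lt_one hδ0 hδ1).mul_const (2 * c)).mul_const d
    exact abs_eq_zero.1 (le_antisymm (ge_of_tendsto' hlim hle) (abs_nonneg _))
  have hsup : futureSigma X 0 = MeasurableSpace.generateFrom
      {s | ∃ m, MeasurableSet[pastSigma X m] s} := by
    refine le_antisymm (iSup_le fun k => fun s hs => ?_) ?_
    · exact MeasurableSpace.measurableSet_generateFrom
        ⟨k, comap_le_pastSigma (X := X) (le_refl (k : ℕ)) s hs⟩
    · refine MeasurableSpace.generateFrom_le ?_
      rintro s ⟨m, hs⟩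
      have : pastSigma X m ≤ futureSigma X 0 := iSup_le fun k => comap_le_futureSigma (Nat.zero_le _)
      exact this s hs
  have hpi : IsPiSystem {s | ∃ m, MeasurableSet[pastSigma X m] s} := by
    rintro s ⟨m, hs⟩ t ⟨n, ht⟩ -
    refine ⟨max m n, ?_⟩
    exact MeasurableSet.inter (pastSigma_mono (le_max_left m n) s hs)
      (pastSigma_mono (le_max_right m n) t ht)
  have hzero := integral_mul_eq_zero_of_piSystem (futureSigma_le hX.1 0) hpi hsup hu hu0
    (fun s ⟨m, hs⟩ => by
      rw [setIntegral_eq_integral_indicator_mul (pastSigma_le hX.1 m s hs)]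
      exact hpast m _ (BddMeas.indicator hs)) (hun 0)
  have hnn : 0 ≤ᵐ[μ] fun o => (W o - w) * (W o - w) := ae_of_all _ fun o => mul_self_nonneg _
  have := (integral_eq_zero_iff_of_nonneg_ae hnn (hu.mul hu).integrable).1 hzero
  filter_upwards [this] with o ho
  have : W o - w = 0 := mul_self_eq_zero.1 ho
  linarith

end Reverse

/-! ### Path modulus and contraction of oscillations -/

section Modulus

variable {𝒳 : ℕ → Type*} [∀ k, MetricSpace (𝒳 k)] {ω : ℝ → ℝ} {a : ℝ} {j : ℕ}

lemma IsModulus.dist_mem (hω : IsModulus ω) (hdiam : ∀ k, ∀ x y : 𝒳 k, dist x y ≤ 1) {k : ℕ}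
    (x y : 𝒳 k) : ω (dist x y) ∈ Set.Icc (0 : ℝ) 1 :=
  hω.mapsTo ⟨dist_nonneg, hdiam k x y⟩

lemma bddAbove_pathModulus (hω : IsModulus ω) (hdiam : ∀ k, ∀ x y : 𝒳 k, dist x y ≤ 1)
    (ha : a ∈ Set.Ioo (0 : ℝ) 1) (x y : PathFrom 𝒳 j) :
    BddAbove (Set.range fun n : ℕ => a ^ n *
      ω (dist (x ⟨j + n, Nat.le_add_right j n⟩) (y ⟨j + n, Nat.le_add_right j n⟩))) := by
  refine ⟨1, ?_⟩
  rintro _ ⟨n, rfl⟩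
  have h := hω.dist_mem hdiam (x ⟨j + n, Nat.le_add_right j n⟩) (y ⟨j + n, Nat.le_add_right j n⟩)
  exact mul_le_one₀ (pow_le_one₀ ha.1.le ha.2.le) h.1 h.2

lemma pathModulus_nonneg (hω : IsModulus ω) (hdiam : ∀ k, ∀ x y : 𝒳 k, dist x y ≤ 1)
    (ha : a ∈ Set.Ioo (0 : ℝ) 1) (x y : PathFrom 𝒳 j) : 0 ≤ pathModulus a ω j x y :=
  Real.iSup_nonneg fun n => mul_nonneg (pow_nonneg ha.1.le n) (hω.dist_mem hdiam _ _).1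

lemma pathModulus_le_one (hω : IsModulus ω) (hdiam : ∀ k, ∀ x y : 𝒳 k, dist x y ≤ 1)
    (ha : a ∈ Set.Ioo (0 : ℝ) 1) (x y : PathFrom 𝒳 j) : pathModulus a ω j x y ≤ 1 :=
  ciSup_le fun _ => mul_le_one₀ (pow_le_one₀ ha.1.le ha.2.le) (hω.dist_mem hdiam _ _).1
    (hω.dist_mem hdiam _ _).2

lemma pathModulus_self (hω : IsModulus ω) (x : PathFrom 𝒳 j) : pathModulus a ω j x x = 0 := by
  simp [pathModulus, hω.zero]

lemma omega_head_le_pathModulus (hω : IsModulus ω) (hdiam : ∀ k, ∀ x y : 𝒳 k, dist x y ≤ 1)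
    (ha : a ∈ Set.Ioo (0 : ℝ) 1) (x y : PathFrom 𝒳 j) :
    ω (dist (pathHead x) (pathHead y)) ≤ pathModulus a ω j x y := by
  have := le_ciSup (bddAbove_pathModulus hω hdiam ha x y) 0
  simpa [pathModulus, pathHead] using! this

lemma dist_pathTail (x y : PathFrom 𝒳 j) (n : ℕ) :
    dist (pathTail x ⟨j + 1 + n, Nat.le_add_right (j + 1) n⟩)
      (pathTail y ⟨j + 1 + n, Nat.le_add_right (j + 1) n⟩)
    = dist (x ⟨j + (n + 1), Nat.le_add_right j (n + 1)⟩)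
      (y ⟨j + (n + 1), Nat.le_add_right j (n + 1)⟩) := by
  have key : ∀ k l (hk : j ≤ k) (hl : j ≤ l), k = l →
      dist (x ⟨k, hk⟩) (y ⟨k, hk⟩) = dist (x ⟨l, hl⟩) (y ⟨l, hl⟩) := by
    rintro k l hk hl rfl
    rfl
  exact key (j + 1 + n) (j + (n + 1)) _ _ (by omega)

lemma mul_pathModulus_tail_le (hω : IsModulus ω) (hdiam : ∀ k, ∀ x y : 𝒳 k, dist x y ≤ 1)
    (ha : a ∈ Set.Ioo (0 : ℝ) 1) (x y : PathFrom 𝒳 j) :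
    a * pathModulus a ω (j + 1) (pathTail x) (pathTail y) ≤ pathModulus a ω j x y := by
  rw [pathModulus, Real.mul_iSup_of_nonneg ha.1.le]
  refine ciSup_le fun n => ?_
  rw [dist_pathTail, ← mul_assoc, ← pow_succ']
  exact le_ciSup (bddAbove_pathModulus hω hdiam ha x y) (n + 1)

lemma pathModulus_le_add (hω : IsModulus ω) (hdiam : ∀ k, ∀ x y : 𝒳 k, dist x y ≤ 1)
    (ha : a ∈ Set.Ioo (0 : ℝ) 1) (x y : PathFrom 𝒳 j) :
    pathModulus a ω j x y ≤ ω (dist (pathHead x) (pathHead y))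
      + a * pathModulus a ω (j + 1) (pathTail x) (pathTail y) := by
  have h0 := (hω.dist_mem hdiam (pathHead x) (pathHead y)).1
  have h1 := mul_nonneg ha.1.le (pathModulus_nonneg hω hdiam ha (pathTail x) (pathTail y))
  refine ciSup_le fun n => ?_
  rcases n with _ | n
  · simpa [pathHead] using! h1
  · refine le_trans ?_ (le_add_of_nonneg_left h0)
    rw [← dist_pathTail, pow_succ', mul_assoc]
    exact mul_le_mul_of_nonneg_left
      (le_ciSup (bddAbove_pathModulus hω hdiam ha (pathTail x) (pathTail y)) n) ha.1.le

/-- A weighted form of the Lipschitz condition with respect to `pathModulus`; the weight `K` on the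
first coordinate makes the transfer operator a contraction. -/
def HasOsc (a : ℝ) (ω : ℝ → ℝ) (K : ℝ) (j : ℕ) (g : PathFrom 𝒳 j → ℝ) (C : ℝ) : Prop :=
  ∀ x y, |g x - g y| ≤ C * (K * ω (dist (pathHead x) (pathHead y))
    + a * pathModulus a ω (j + 1) (pathTail x) (pathTail y))

namespace HasOsc

variable {K C D : ℝ} {g h : PathFrom 𝒳 j → ℝ}

lemma add (hg : HasOsc a ω K j g C) (hh : HasOsc a ω K j h D) :
    HasOsc a ω K j (fun x => g x + h x) (C + D) := fun x y => by
  have := abs_add_le (g x - g y) (h x - h y)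
  rw [add_sub_add_comm, add_mul]
  linarith [hg x y, hh x y]

lemma sub_const (hg : HasOsc a ω K j g C) (c : ℝ) : HasOsc a ω K j (fun x => g x - c) C :=
  fun x y => by simpa using hg x y

lemma of_le (hω : IsModulus ω) (hdiam : ∀ k, ∀ x y : 𝒳 k, dist x y ≤ 1)
    (ha : a ∈ Set.Ioo (0 : ℝ) 1) (hK : 1 ≤ K) (hC : 0 ≤ C)
    (hg : ∀ x y, |g x - g y| ≤ C * pathModulus a ω j x y) : HasOsc a ω K j g C := fun x y => by
  have h0 := (hω.dist_mem hdiam (pathHead x) (pathHead y)).1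
  refine (hg x y).trans (mul_le_mul_of_nonneg_left ?_ hC)
  refine (pathModulus_le_add hω hdiam ha x y).trans ?_
  nlinarith

lemma le (hω : IsModulus ω) (hdiam : ∀ k, ∀ x y : 𝒳 k, dist x y ≤ 1)
    (ha : a ∈ Set.Ioo (0 : ℝ) 1) (hK : 0 ≤ K) (hC : 0 ≤ C) (hg : HasOsc a ω K j g C)
    (x y : PathFrom 𝒳 j) : |g x - g y| ≤ C * (K + 1) * pathModulus a ω j x y := by
  refine (hg x y).trans ?_
  rw [mul_assoc]
  refine mul_le_mul_of_nonneg_left ?_ hC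
  have h1 := mul_le_mul_of_nonneg_left (omega_head_le_pathModulus hω hdiam ha x y) hK
  have h2 := mul_pathModulus_tail_le hω hdiam ha x y
  linarith

/-- Changing the tail under a fixed first coordinate costs `a * pathModulus`, as `ω 0 = 0` removes
the head term; changing the kernel costs the fibre oscillation `C * K` times total variation. The
head coefficient becomes `a + K * δ` and the tail gains a factor `a`, so both contract by `ρ`. -/
lemma transfer [∀ k, MeasurableSpace (𝒳 k)] (hω : IsModulus ω)
    (hdiam : ∀ k, ∀ x y : 𝒳 k, dist x y ≤ 1) (ha : a ∈ Set.Ioo (0 : ℝ) 1)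
    {P : (j : ℕ) → Kernel (𝒳 (j + 1)) (𝒳 j)} [∀ j, IsMarkovKernel (P j)] {δ : ℝ}
    (hTV : ∀ j, ∀ x y : 𝒳 (j + 1), tvDistance (P j x) (P j y) ≤ δ * ω (dist x y))
    (hK : 0 ≤ K) (hC : 0 ≤ C) {ρ : ℝ} (hρ1 : a + K * δ ≤ ρ * K) (hρ2 : a ≤ ρ)
    (hgm : BddMeas MeasurableSpace.pi g) (hg : HasOsc a ω K j g C) :
    HasOsc a ω K (j + 1) (transfer P j g) (ρ * C) := fun x y => by
  have hx := hgm.comp_pathCons x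
  have hy := hgm.comp_pathCons y
  have hpm := pathModulus_nonneg hω hdiam ha x y
  have hω0 := (hω.dist_mem hdiam (pathHead x) (pathHead y)).1
  have h1 : |∫ z, g (pathCons z x) ∂(P j (pathHead x)) - ∫ z, g (pathCons z y) ∂(P j (pathHead x))|
      ≤ C * (a * pathModulus a ω (j + 1) x y) := by
    rw [← integral_sub hx.integrable hy.integrable]
    have := norm_integral_le_of_norm_le_const (μ := P j (pathHead x))
      (f := fun z => g (pathCons z x) - g (pathCons z y))
      (C := C * (a * pathModulus a ω (j + 1) x y)) (ae_of_all _ fun z => by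
        have := hg (pathCons z x) (pathCons z y)
        simpa [hω.zero] using this)
    simpa using! this
  have h2 : |∫ z, g (pathCons z y) ∂(P j (pathHead x)) - ∫ z, g (pathCons z y) ∂(P j (pathHead y))|
      ≤ C * K * (δ * ω (dist (pathHead x) (pathHead y))) := by
    have hCK : 0 ≤ C * K := mul_nonneg hC hK
    refine (abs_integral_sub_le_tvDistance _ _ hy.1 (r := C * K) fun z z' => ?_).trans
      (mul_le_mul_of_nonneg_left (hTV j _ _) hCK)
    have h3 := hg (pathCons z y) (pathCons z' y)
    simp only [pathHead_pathCons, pathTail_pathCons, pathModulus_self hω, mul_zero, add_zero] at h3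
    refine h3.trans ?_
    have := (hω.dist_mem hdiam z z').2
    calc C * (K * ω (dist z z')) ≤ C * (K * 1) := by gcongr
      _ = C * K := by ring
  have h3 := pathModulus_le_add hω hdiam ha x y
  have h4 := mul_nonneg ha.1.le (pathModulus_nonneg hω hdiam ha (pathTail x) (pathTail y))
  have h5 := abs_sub_le (∫ z, g (pathCons z x) ∂(P j (pathHead x)))
    (∫ z, g (pathCons z y) ∂(P j (pathHead x))) (∫ z, g (pathCons z y) ∂(P j (pathHead y)))
  refine (h5.trans (add_le_add h1 h2)).trans ?_
  set w := ω (dist (pathHead x) (pathHead y))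
  set p := pathModulus a ω (j + 1 + 1) (pathTail x) (pathTail y)
  calc C * (a * pathModulus a ω (j + 1) x y) + C * K * (δ * w)
      ≤ C * (a * (w + a * p)) + C * K * (δ * w) := by
        have := ha.1.le
        gcongr
    _ = C * ((a + K * δ) * w + a * (a * p)) := by ring
    _ ≤ C * (ρ * K * w + ρ * (a * p)) := by gcongr
    _ = ρ * C * (K * w + a * p) := by ring

end HasOsc

end Modulus

/-! ### Regular functions and the corrector -/

section Regular

variable {Ω : Type*} [m0 : MeasurableSpace Ω] {μ : Measure Ω}
  {𝒳 : ℕ → Type*} [∀ k, MetricSpace (𝒳 k)] [∀ k, MeasurableSpace (𝒳 k)]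
  {X : (k : ℕ) → Ω → 𝒳 k} {ω : ℝ → ℝ} {a : ℝ}

lemma IsOmegaRegular.exists_bound [IsProbabilityMeasure μ] (hω : IsModulus ω)
    (hdiam : ∀ k, ∀ x y : 𝒳 k, dist x y ≤ 1)
    (ha : a ∈ Set.Ioo (0 : ℝ) 1) (hX : ∀ k, Measurable (X k))
    {g : (j : ℕ) → PathFrom 𝒳 j → ℝ} (hg : IsOmegaRegular X μ a ω g) :
    ∃ C, 0 ≤ C ∧ (∀ j x, |g j x| ≤ C) ∧
      ∀ j x y, |g j x - g j y| ≤ C * pathModulus a ω j x y := by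
  obtain ⟨hgm, hS⟩ := hg
  set S := ⨆ j, omegaNorm a ω j (μ.map (tailPath X j)) (g j) with hSdef
  have hle : ∀ j, omegaNorm a ω j (μ.map (tailPath X j)) (g j) ≤ S := fun j =>
    le_iSup (fun j => omegaNorm a ω j (μ.map (tailPath X j)) (g j)) j
  have hS1 : S + 1 ≠ ∞ := by simpa using hS.ne
  have hST : S.toReal ≤ (S + 1).toReal := ENNReal.toReal_mono hS1 le_self_add
  have hosc : ∀ j x y, |g j x - g j y| ≤ (S + 1).toReal * pathModulus a ω j x y := by
    intro j x y
    rcases eq_or_ne x y with rfl | hxy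
    · rw [sub_self, abs_zero]
      exact mul_nonneg ENNReal.toReal_nonneg (pathModulus_nonneg hω hdiam ha _ _)
    have h1 : ‖g j x - g j y‖ₑ / ENNReal.ofReal (pathModulus a ω j x y) ≤ S + 1 :=
      calc _ ≤ variationSeminorm a ω j (g j) := le_iSup_of_le x (le_iSup_of_le y
            (le_iSup_of_le hxy le_rfl))
        _ ≤ omegaNorm a ω j (μ.map (tailPath X j)) (g j) := le_add_self
        _ ≤ S := hle j
        _ ≤ S + 1 := le_self_add
    rw [ENNReal.div_le_iff_le_mul (Or.inr hS1) (Or.inl ENNReal.ofReal_ne_top)] at h1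
    have h2 := ENNReal.toReal_mono (ENNReal.mul_ne_top hS1 ENNReal.ofReal_ne_top) h1
    rwa [ENNReal.toReal_mul, ENNReal.toReal_ofReal (pathModulus_nonneg hω hdiam ha _ _),
      toReal_enorm, Real.norm_eq_abs] at h2
  refine ⟨S.toReal + (S + 1).toReal, by positivity, fun j x => ?_, fun j x y => ?_⟩
  · have hmap := Measure.isProbabilityMeasure_map (μ := μ) (measurable_tailPath hX j).aemeasurable
    have h1 : eLpNorm (g j) ∞ (μ.map (tailPath X j)) ≤ S := le_self_add.trans (hle j)
    rw [eLpNorm_exponent_top] at h1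
    have h2 : ∀ᵐ x ∂(μ.map (tailPath X j)), ‖g j x‖ₑ ≤ S := by
      filter_upwards [enorm_ae_le_eLpNormEssSup (g j) (μ.map (tailPath X j))] with x hx
      exact hx.trans h1
    -- The norm bounds `g j` only almost everywhere; one good point and the oscillation bound, with
    -- `pathModulus ≤ 1`, give a bound everywhere.
    obtain ⟨x₀, hx₀⟩ := h2.exists
    have h3 := ENNReal.toReal_mono hS.ne hx₀
    rw [toReal_enorm, Real.norm_eq_abs] at h3
    have h4 := hosc j x x₀
    have h5 := mul_le_mul_of_nonneg_left (pathModulus_le_one hω hdiam ha x x₀)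
      (ENNReal.toReal_nonneg (a := S + 1))
    have h6 := abs_sub_abs_le_abs_sub (g j x) (g j x₀)
    linarith
  · refine (hosc j x y).trans (mul_le_mul_of_nonneg_right ?_ (pathModulus_nonneg hω hdiam ha _ _))
    linarith [ENNReal.toReal_nonneg (a := S)]

lemma IsOmegaRegular.of_bound {g : (j : ℕ) → PathFrom 𝒳 j → ℝ} (hgm : ∀ j, Measurable (g j))
    {C D : ℝ} (hC : ∀ j x, |g j x| ≤ C) (hD : 0 ≤ D)
    (hosc : ∀ j x y, |g j x - g j y| ≤ D * pathModulus a ω j x y) : IsOmegaRegular X μ a ω g := by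
  refine ⟨hgm, lt_of_le_of_lt (iSup_le fun j => ?_)
    (show ENNReal.ofReal C + ENNReal.ofReal D < ∞ by simp)⟩
  refine add_le_add ?_ (iSup_le fun x => iSup_le fun y => iSup_le fun _ => ?_)
  · rw [eLpNorm_exponent_top]
    refine eLpNormEssSup_le_of_ae_bound (ae_of_all _ fun x => hC j x)
  · refine ENNReal.div_le_of_le_mul ?_
    rw [← ENNReal.ofReal_mul hD, ← ofReal_norm]
    exact ENNReal.ofReal_le_ofReal (hosc j x y)

/-- The corrector, `u_{n+1} = L_n (f_n - E f_n + u_n)`. -/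
noncomputable def corrector (P : (j : ℕ) → Kernel (𝒳 (j + 1)) (𝒳 j))
    (f : (j : ℕ) → PathFrom 𝒳 j → ℝ) (c : ℕ → ℝ) : (n : ℕ) → PathFrom 𝒳 n → ℝ
  | 0 => fun _ => 0
  | n + 1 => transfer P n fun x => f n x - c n + corrector P f c n x

lemma exists_corrector [IsProbabilityMeasure μ] (hω : IsModulus ω)
    (hdiam : ∀ k, ∀ x y : 𝒳 k, dist x y ≤ 1)
    (ha : a ∈ Set.Ioo (0 : ℝ) 1) (hX : IsMarkovChain X μ)
    {P : (j : ℕ) → Kernel (𝒳 (j + 1)) (𝒳 j)} [∀ j, IsMarkovKernel (P j)]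
    (hP : ∀ j, HasCondDistrib (X j) (X (j + 1)) (P j) μ) {δ : ℝ} (hδ : δ ∈ Set.Ioo (0 : ℝ) 1)
    (hTV : ∀ j, ∀ x y : 𝒳 (j + 1), tvDistance (P j x) (P j y) ≤ δ * ω (dist x y))
    {f : (j : ℕ) → PathFrom 𝒳 j → ℝ} (hfm : ∀ j, Measurable (f j)) {C : ℝ} (hC0 : 0 ≤ C)
    (hC : ∀ j x, |f j x| ≤ C) (hosc : ∀ j x y, |f j x - f j y| ≤ C * pathModulus a ω j x y) :
    ∃ (u : (j : ℕ) → PathFrom 𝒳 j → ℝ) (D : ℝ), 0 ≤ D ∧ (∀ j, Measurable (u j)) ∧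
      (∀ x, u 0 x = 0) ∧ (∀ j x, |u j x| ≤ D) ∧
      (∀ j x y, |u j x - u j y| ≤ D * pathModulus a ω j x y) ∧
      (∀ j, ∫ o, u j (tailPath X j o) ∂μ = 0) ∧
      ∀ j h, BddMeas (futureSigma X (j + 1)) h →
        ∫ o, h o * (f j (tailPath X j o) - ∫ o', f j (tailPath X j o') ∂μ
          + u j (tailPath X j o)) ∂μ = ∫ o, h o * u (j + 1) (tailPath X (j + 1) o) ∂μ := by
  set c : ℕ → ℝ := fun j => ∫ o', f j (tailPath X j o') ∂μ with hc
  -- With this `K`, `a + K * δ = K - 2 + a ≤ K - 1 = (1 + δ) / 2 * K`, so the head coefficient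
  -- contracts.
  set K : ℝ := 2 / (1 - δ) with hK
  have hδ' : 0 < 1 - δ := by linarith [hδ.2]
  have hK1 : 1 ≤ K := by rw [hK, le_div_iff₀ hδ']; linarith [hδ.1]
  have hK0 : 0 ≤ K := zero_le_one.trans hK1
  set ρ : ℝ := max a ((1 + δ) / 2) with hρ
  have hρ1 : ρ < 1 := max_lt ha.2 (by linarith [hδ.2])
  have hρa : a ≤ ρ := le_max_left _ _
  have hρ0 : 0 ≤ ρ := ha.1.le.trans hρa
  have hρK : a + K * δ ≤ ρ * K := by
    have h1 : (1 + δ) / 2 * K ≤ ρ * K := mul_le_mul_of_nonneg_right (le_max_right _ _) hK0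
    have h2 : K * (1 - δ) = 2 := by rw [hK]; field_simp
    linarith [ha.2]
  -- The fixed point of `D ↦ ρ * (C + D)`, hence preserved by the recursion.
  set D₀ : ℝ := ρ * C / (1 - ρ) with hD₀
  have hρ' : 0 < 1 - ρ := by linarith
  have hD₀0 : 0 ≤ D₀ := by positivity
  have hfb : ∀ j, BddMeas MeasurableSpace.pi (f j) := fun j => ⟨hfm j, C, hC j⟩
  set u := corrector P f c with hu
  have hub : ∀ n, BddMeas MeasurableSpace.pi (u n) := by
    intro n
    induction n with
    | zero => exact BddMeas.const 0
    | succ n ih => exact (((hfb n).sub (BddMeas.const (c n))).add ih).transfer P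
  have huo : ∀ n, HasOsc a ω K n (u n) D₀ := by
    intro n
    induction n with
    | zero =>
      intro x y
      have h0 := (hω.dist_mem hdiam (pathHead x) (pathHead y)).1
      have h1 := mul_nonneg ha.1.le (pathModulus_nonneg hω hdiam ha (pathTail x) (pathTail y))
      simp only [hu, corrector, sub_self, abs_zero]
      positivity
    | succ n ih =>
      have h1 := (((HasOsc.of_le hω hdiam ha hK1 hC0 (hosc n)).sub_const (c n)).add ih).transfer
        hω hdiam ha hTV hK0 (by positivity) hρK hρa
        (((hfb n).sub (BddMeas.const (c n))).add (hub n))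
      have e : ρ * (C + D₀) = D₀ := by
        rw [hD₀]
        field_simp
        ring
      rw [e] at h1
      exact h1
  have horth : ∀ j h, BddMeas (futureSigma X (j + 1)) h →
      ∫ o, h o * (f j (tailPath X j o) - c j + u j (tailPath X j o)) ∂μ
        = ∫ o, h o * u (j + 1) (tailPath X (j + 1) o) ∂μ := fun j h hh =>
    hX.integral_mul_transfer (hP j) (((hfb j).sub (BddMeas.const (c j))).add (hub j)) hh
  have hG := futureSigma_le hX.1
  have hmean : ∀ j, ∫ o, u j (tailPath X j o) ∂μ = 0 := by
    intro j
    induction j with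
    | zero => simp [hu, corrector]
    | succ j ih =>
      have h1 := horth j (fun _ => 1) (BddMeas.const 1)
      simp only [one_mul] at h1
      have hf' := ((hfb j).comp_tailPath (X := X)).mono (hG j)
      rw [← h1, integral_add (hf'.sub (BddMeas.const _)).integrable
        (((hub j).comp_tailPath (X := X)).mono (hG j)).integrable, ih,
        integral_sub hf'.integrable (integrable_const _)]
      simp [hc]
  have hD1 : 0 ≤ D₀ * (K + 1) := by positivity
  have hosc' := fun j => (huo j).le hω hdiam ha hK0 hD₀0
  refine ⟨u, D₀ * (K + 1), hD1, fun j => (hub j).1, fun _ => rfl, fun j x => ?_, hosc', hmean,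
    horth⟩
  -- Mean zero turns the oscillation bound into a sup bound.
  have h1 : ∫ o, (u j x - u j (tailPath X j o)) ∂μ = u j x := by
    rw [integral_sub (integrable_const _)
      (((hub j).comp_tailPath (X := X)).mono (hG j)).integrable, hmean j]
    simp
  rw [← h1]
  have h2 := norm_integral_le_of_norm_le_const (μ := μ)
    (f := fun o => u j x - u j (tailPath X j o)) (C := D₀ * (K + 1)) (ae_of_all _ fun o =>
      (hosc' j x (tailPath X j o)).trans
        (mul_le_of_le_one_right hD1 (pathModulus_le_one hω hdiam ha _ _)))
  simpa using! h2

end Regular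

/-! ### Coboundaries and martingale decompositions -/

section Coboundary

variable {Ω : Type*} [m0 : MeasurableSpace Ω] {μ : Measure Ω}
  {𝒳 : ℕ → Type*} [∀ k, MeasurableSpace (𝒳 k)] {X : (k : ℕ) → Ω → 𝒳 k}
  {f : (j : ℕ) → PathFrom 𝒳 j → ℝ}

lemma IsMeasurableCoboundary.sum_eq {H : (j : ℕ) → PathFrom 𝒳 j → ℝ}
    (hH : IsMeasurableCoboundary X μ f H) {j n : ℕ} (hjn : j ≤ n) :
    ∀ᵐ o ∂μ, ∑ k ∈ Finset.Ico j n, f k (tailPath X k o)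
      = H n (tailPath X n o) - H j (tailPath X j o) := by
  filter_upwards [ae_all_iff.2 hH.2] with o ho
  induction n, hjn using Nat.le_induction with
  | base => simp
  | succ n hjn ih =>
    rw [Finset.sum_Ico_succ_top hjn, ih, ho n]
    ring

end Coboundary

/-- A martingale-coboundary decomposition, with pointwise bounds in place of norms and without the
summability of the variances of the martingale part. -/
structure IsBoundedDecomp {Ω : Type*} [MeasurableSpace Ω] {𝒳 : ℕ → Type*}
    [∀ k, MetricSpace (𝒳 k)] [∀ k, MeasurableSpace (𝒳 k)] (X : (k : ℕ) → Ω → 𝒳 k) (μ : Measure Ω)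
    (a : ℝ) (ω : ℝ → ℝ) (f M u : (j : ℕ) → PathFrom 𝒳 j → ℝ) (D : ℝ) : Prop where
  decomp : ∀ j, ∀ᵐ o ∂μ, f j (tailPath X j o) =
    (∫ o', f j (tailPath X j o') ∂μ) + M j (tailPath X j o)
      + u (j + 1) (tailPath X (j + 1) o) - u j (tailPath X j o)
  nonneg : 0 ≤ D
  measurable_u : ∀ j, Measurable (u j)
  bound_u : ∀ j x, |u j x| ≤ D
  measurable_M : ∀ j, Measurable (M j)
  bound_M : ∀ j x, |M j x| ≤ D
  osc_M : ∀ j x y, |M j x - M j y| ≤ D * pathModulus a ω j x y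
  mean_u : ∀ j, ∫ o, u j (tailPath X j o) ∂μ = 0
  orth : ∀ j h, BddMeas (futureSigma X (j + 1)) h → ∫ o, h o * M j (tailPath X j o) ∂μ = 0

section Decomposition

variable {Ω : Type*} [m0 : MeasurableSpace Ω] {μ : Measure Ω}
  {𝒳 : ℕ → Type*} [∀ k, MetricSpace (𝒳 k)] [∀ k, MeasurableSpace (𝒳 k)]
  {X : (k : ℕ) → Ω → 𝒳 k} {ω : ℝ → ℝ} {a : ℝ} {f M u : (j : ℕ) → PathFrom 𝒳 j → ℝ}

namespace IsBoundedDecomp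

variable {D : ℝ}

lemma isBddRevMart (hX : ∀ k, Measurable (X k)) (hd : IsBoundedDecomp X μ a ω f M u D) :
    IsBddRevMart μ (futureSigma X) (fun j o => M j (tailPath X j o)) D :=
  ⟨futureSigma_anti, futureSigma_le hX,
    fun j => (BddMeas.comp_tailPath ⟨hd.measurable_M j, D, hd.bound_M j⟩).1,
    fun j _ => hd.bound_M j _, hd.orth⟩

lemma sum_eq (hd : IsBoundedDecomp X μ a ω f M u D) {j n : ℕ} (hjn : j ≤ n) :
    ∀ᵐ o ∂μ, ∑ k ∈ Finset.Ico j n, f k (tailPath X k o)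
      = ∑ k ∈ Finset.Ico j n, ∫ o', f k (tailPath X k o') ∂μ
        + icoSum (fun j o => M j (tailPath X j o)) j n o
        + u n (tailPath X n o) - u j (tailPath X j o) := by
  filter_upwards [ae_all_iff.2 hd.decomp] with o ho
  induction n, hjn using Nat.le_induction with
  | base => simp [icoSum]
  | succ n hjn ih =>
    simp only [icoSum] at ih ⊢
    rw [Finset.sum_Ico_succ_top hjn, Finset.sum_Ico_succ_top hjn, Finset.sum_Ico_succ_top hjn, ih,
      ho n]
    ring

end IsBoundedDecomp

end Decomposition

section Decomposition

variable {Ω : Type*} [m0 : MeasurableSpace Ω] {μ : Measure Ω} [IsProbabilityMeasure μ]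
  {𝒳 : ℕ → Type*} [∀ k, MetricSpace (𝒳 k)] [∀ k, MeasurableSpace (𝒳 k)]
  {X : (k : ℕ) → Ω → 𝒳 k} {ω : ℝ → ℝ} {a : ℝ} {f M u : (j : ℕ) → PathFrom 𝒳 j → ℝ}

lemma IsMartingaleCoboundaryDecomp.exists_isBoundedDecomp (hω : IsModulus ω)
    (hdiam : ∀ k, ∀ x y : 𝒳 k, dist x y ≤ 1) (ha : a ∈ Set.Ioo (0 : ℝ) 1)
    (hX : ∀ k, Measurable (X k)) (hd : IsMartingaleCoboundaryDecomp X μ a ω f M u) :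
    ∃ D, IsBoundedDecomp X μ a ω f M u D := by
  obtain ⟨C, hC0, hC, -⟩ := hd.regular_u.exists_bound hω hdiam ha hX
  obtain ⟨D, hD0, hD, hD'⟩ := hd.regular_M.exists_bound hω hdiam ha hX
  refine ⟨C + D, hd.decomp, by positivity, hd.regular_u.1, fun j x => (hC j x).trans (by linarith),
    hd.regular_M.1, fun j x => (hD j x).trans (by linarith), fun j x y => (hD' j x y).trans
      (mul_le_mul_of_nonneg_right (by linarith) (pathModulus_nonneg hω hdiam ha _ _)),
    hd.mean_u, fun j h hh => ?_⟩
  have hG := futureSigma_le hX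
  have hM : BddMeas (futureSigma X j) fun o => M j (tailPath X j o) :=
    BddMeas.comp_tailPath ⟨hd.regular_M.1 j, D, hD j⟩
  have h1 : μ[(fun o => h o * M j (tailPath X j o)) | futureSigma X (j + 1)] =ᵐ[μ]
      fun o => h o * (μ[(fun o => M j (tailPath X j o)) | futureSigma X (j + 1)]) o :=
    condExp_mul_of_stronglyMeasurable_left hh.1.stronglyMeasurable
      ((hh.mono (hG _)).mul (hM.mono (hG _))).integrable (hM.mono (hG _)).integrable
  rw [← integral_condExp (hG (j + 1)), ← integral_zero Ω ℝ (μ := μ)]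
  refine integral_congr_ae ?_
  filter_upwards [h1, (hd.martingale j).2.2] with o h2 h3
  rw [h2, h3, Pi.zero_apply, mul_zero]

lemma exists_decomp (hω : IsModulus ω)
    (hdiam : ∀ k, ∀ x y : 𝒳 k, dist x y ≤ 1) (ha : a ∈ Set.Ioo (0 : ℝ) 1)
    (hX : IsMarkovChain X μ)
    {P : (j : ℕ) → Kernel (𝒳 (j + 1)) (𝒳 j)} [∀ j, IsMarkovKernel (P j)]
    (hP : ∀ j, HasCondDistrib (X j) (X (j + 1)) (P j) μ) {δ : ℝ} (hδ : δ ∈ Set.Ioo (0 : ℝ) 1)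
    (hTV : ∀ j, ∀ x y : 𝒳 (j + 1), tvDistance (P j x) (P j y) ≤ δ * ω (dist x y))
    (hf : IsOmegaRegular X μ a ω f) :
    ∃ M u D, IsBoundedDecomp X μ a ω f M u D ∧
      (∑' j, evariance (fun o => M j (tailPath X j o)) μ < ∞ →
        IsMartingaleCoboundaryDecomp X μ a ω f M u) := by
  obtain ⟨C, hC0, hC, hosc⟩ := hf.exists_bound hω hdiam ha hX.1
  obtain ⟨u, D, hD0, hum, -, hub, huo, humean, horth⟩ :=
    exists_corrector hω hdiam ha hX hP hδ hTV hf.1 hC0 hC hosc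
  have hG := futureSigma_le hX.1
  set c : ℕ → ℝ := fun j => ∫ o', f j (tailPath X j o') ∂μ with hc
  let M : (j : ℕ) → PathFrom 𝒳 j → ℝ := fun j x => f j x - c j + u j x - u (j + 1) (pathTail x)
  have hMm : ∀ j, Measurable (M j) := fun j =>
    (((hf.1 j).sub_const _).add (hum j)).sub ((hum (j + 1)).comp measurable_pathTail)
  have hcb : ∀ j, |c j| ≤ C := fun j => by
    have := norm_integral_le_of_norm_le_const (μ := μ) (f := fun o => f j (tailPath X j o))
      (C := C) (ae_of_all _ fun o => hC j _)
    simpa using! this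
  have hMb : ∀ j x, |M j x| ≤ 2 * C + 2 * D := fun j x => by
    have h1 := abs_le.1 (hC j x)
    have h2 := abs_le.1 (hcb j)
    have h3 := abs_le.1 (hub j x)
    have h4 := abs_le.1 (hub (j + 1) (pathTail x))
    refine abs_le.2 ⟨?_, ?_⟩ <;> simp only [M] <;> linarith
  have hMo : ∀ j x y, |M j x - M j y| ≤ (C + D + D / a) * pathModulus a ω j x y := fun j x y => by
    have h1 := abs_le.1 (hosc j x y)
    have h2 := abs_le.1 (huo j x y)
    have h3 := abs_le.1 (huo (j + 1) (pathTail x) (pathTail y))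
    -- Dropping a coordinate may enlarge the modulus by `1 / a`.
    have h4 : D * pathModulus a ω (j + 1) (pathTail x) (pathTail y)
        ≤ D / a * pathModulus a ω j x y := by
      rw [div_mul_eq_mul_div, le_div_iff₀ ha.1, mul_assoc, mul_comm _ a]
      exact mul_le_mul_of_nonneg_left (mul_pathModulus_tail_le hω hdiam ha x y) hD0
    refine abs_le.2 ⟨?_, ?_⟩ <;> simp only [M] <;> linarith
  have hfb : ∀ j, BddMeas (futureSigma X j) fun o => f j (tailPath X j o) := fun j =>
    BddMeas.comp_tailPath ⟨hf.1 j, C, hC j⟩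
  have hub' : ∀ j, BddMeas (futureSigma X j) fun o => u j (tailPath X j o) := fun j =>
    BddMeas.comp_tailPath ⟨hum j, D, hub j⟩
  have hMb' : ∀ j, BddMeas (futureSigma X j) fun o => M j (tailPath X j o) := fun j =>
    BddMeas.comp_tailPath ⟨hMm j, _, hMb j⟩
  have hMorth : ∀ j h, BddMeas (futureSigma X (j + 1)) h →
      ∫ o, h o * M j (tailPath X j o) ∂μ = 0 := fun j h hh => by
    have h1 := horth j h hh
    have hh0 := hh.mono (hG _)
    have hb := (((hfb j).sub (BddMeas.const (c j))).add (hub' j)).mono (hG j)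
    have hb' := (hub' (j + 1)).mono (hG _)
    rw [← sub_eq_zero, ← integral_sub (hh0.mul hb).integrable (hh0.mul hb').integrable] at h1
    rw [← h1]
    refine integral_congr_ae (ae_of_all _ fun o => ?_)
    simp only [M, pathTail_tailPath]
    ring
  have hdec : ∀ j, ∀ᵐ o ∂μ, f j (tailPath X j o) = c j + M j (tailPath X j o)
      + u (j + 1) (tailPath X (j + 1) o) - u j (tailPath X j o) := fun j =>
    ae_of_all _ fun o => by simp only [M, pathTail_tailPath]; ring
  have haD : 0 ≤ D / a := div_nonneg hD0 ha.1.le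
  refine ⟨M, u, 2 * C + 2 * D + D / a, ⟨hdec, by positivity, hum,
    fun j x => (hub j x).trans (by linarith), hMm, fun j x => (hMb j x).trans (by linarith),
    fun j x y => (hMo j x y).trans (mul_le_mul_of_nonneg_right (by linarith)
      (pathModulus_nonneg hω hdiam ha _ _)), humean, hMorth⟩, fun hsum => ?_⟩
  refine ⟨hdec, .of_bound hum hub hD0 huo, .of_bound hMm hMb (by positivity) hMo, humean,
    fun j => by simpa using hMorth j (fun _ => 1) (BddMeas.const 1), fun j =>
    ⟨(hMb' j).1.stronglyMeasurable, ((hMb' j).mono (hG j)).integrable, ?_⟩, hsum⟩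
  refine (ae_eq_condExp_of_forall_setIntegral_eq (hG (j + 1)) ((hMb' j).mono (hG j)).integrable
    (fun s _ _ => integrableOn_zero) (fun s hs _ => ?_)
    stronglyMeasurable_zero.aestronglyMeasurable).symm
  rw [setIntegral_eq_integral_indicator_mul (hG (j + 1) s hs) fun o => M j (tailPath X j o),
    hMorth j _ (BddMeas.indicator hs)]
  simp

namespace IsBoundedDecomp

variable {D : ℝ}

/-- Mixing bounds the conditional expectation of the square function given the future. -/
lemma exists_potential_bound (hω : IsModulus ω) (hdiam : ∀ k, ∀ x y : 𝒳 k, dist x y ≤ 1)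
    (ha : a ∈ Set.Ioo (0 : ℝ) 1) (hX : IsMarkovChain X μ)
    {P : (j : ℕ) → Kernel (𝒳 (j + 1)) (𝒳 j)} [∀ j, IsMarkovKernel (P j)]
    (hP : ∀ j, HasCondDistrib (X j) (X (j + 1)) (P j) μ) {δ : ℝ} (hδ : δ ∈ Set.Ioo (0 : ℝ) 1)
    (hTV : ∀ j, ∀ x y : 𝒳 (j + 1), tvDistance (P j x) (P j y) ≤ δ * ω (dist x y))
    (hd : IsBoundedDecomp X μ a ω f M u D) :
    ∃ E, 0 ≤ E ∧ ∀ n h, BddMeas (futureSigma X n) h → (∀ o, 0 ≤ h o) →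
      ∫ o, h o * icoSq (fun j o => M j (tailPath X j o)) 0 n o ∂μ
        ≤ (∑ k ∈ Finset.range n, ∫ o, M k (tailPath X k o) ^ 2 ∂μ + E) * ∫ o, h o ∂μ := by
  have hD := hd.nonneg
  have hG := futureSigma_le hX.1
  have hM := hd.isBddRevMart hX.1
  -- The squares `M j ^ 2` are regular too; their corrector `v n` is the conditional expectation,
  -- given the future from `n`, of the centered square function, and it is bounded uniformly in `n`.
  obtain ⟨v, E, hE0, hvm, hv0, hvb, -, -, horth⟩ := exists_corrector (μ := μ) hω hdiam ha hX hP hδ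
    hTV (f := fun j x => M j x ^ 2) (fun j => (hd.measurable_M j).pow_const 2)
    (C := D ^ 2 + 2 * D * D) (by positivity)
    (fun j x => by
      rw [abs_pow]
      have := pow_le_pow_left₀ (abs_nonneg _) (hd.bound_M j x) 2
      nlinarith)
    (fun j x y => by
      have hp := pathModulus_nonneg hω hdiam ha x y
      have e : M j x ^ 2 - M j y ^ 2 = (M j x + M j y) * (M j x - M j y) := by ring
      rw [e, abs_mul]
      have h1 : |M j x + M j y| ≤ 2 * D := (abs_add_le _ _).trans (by
        linarith [hd.bound_M j x, hd.bound_M j y])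
      calc |M j x + M j y| * |M j x - M j y| ≤ 2 * D * (D * pathModulus a ω j x y) :=
            mul_le_mul h1 (hd.osc_M j x y) (abs_nonneg _) (by positivity)
        _ ≤ _ := by nlinarith [sq_nonneg D, mul_nonneg (sq_nonneg D) hp])
  have hvb' : ∀ n, BddMeas m0 fun o => v n (tailPath X n o) := fun n =>
    (BddMeas.comp_tailPath (X := X) ⟨hvm n, E, hvb n⟩).mono (hG n)
  have hQ : ∀ n, BddMeas m0 (icoSq (fun j o => M j (tailPath X j o)) 0 n) := fun n =>
    (hM.bddMeas_sq 0 n).mono (hG 0)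
  have key : ∀ n h, BddMeas (futureSigma X n) h →
      ∫ o, h o * (icoSq (fun j o => M j (tailPath X j o)) 0 n o
        - ∑ k ∈ Finset.range n, ∫ o, M k (tailPath X k o) ^ 2 ∂μ) ∂μ
      = ∫ o, h o * v n (tailPath X n o) ∂μ := by
    intro n
    induction n with
    | zero => intro h _; simp [icoSq, hv0]
    | succ n ih =>
      intro h hh
      have hh0 := hh.mono (hG _)
      rw [← horth n h hh]
      have h1 := ih h (hh.mono (futureSigma_anti (Nat.le_succ n)))
      have hM2 := ((hM.bddMeas n).mono (hG n)).pow 2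
      have e : ∀ o, h o * (icoSq (fun j o => M j (tailPath X j o)) 0 (n + 1) o
          - ∑ k ∈ Finset.range (n + 1), ∫ o, M k (tailPath X k o) ^ 2 ∂μ)
          = h o * (icoSq (fun j o => M j (tailPath X j o)) 0 n o
              - ∑ k ∈ Finset.range n, ∫ o, M k (tailPath X k o) ^ 2 ∂μ)
            + h o * (M n (tailPath X n o) ^ 2 - ∫ o, M n (tailPath X n o) ^ 2 ∂μ) := fun o => by
        rw [Finset.sum_range_succ, icoSq, Finset.sum_Ico_succ_top (Nat.zero_le n)]
        simp only [icoSq]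
        ring
      simp only [e]
      rw [integral_add (hh0.mul ((hQ n).sub (BddMeas.const _))).integrable
        (hh0.mul (hM2.sub (BddMeas.const _))).integrable, h1,
        ← integral_add (hh0.mul (hvb' n)).integrable
          (hh0.mul (hM2.sub (BddMeas.const _))).integrable]
      exact integral_congr_ae (ae_of_all _ fun o => by ring)
  refine ⟨E, hE0, fun n h hh h0 => ?_⟩
  have hh0 := hh.mono (hG n)
  have h1 := key n h hh
  simp only [mul_sub] at h1
  rw [integral_sub (hh0.mul (hQ n)).integrable (hh0.mul (BddMeas.const _)).integrable,
    integral_mul_const] at h1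
  have h2 : ∫ o, h o * v n (tailPath X n o) ∂μ ≤ ∫ o, h o * E ∂μ :=
    integral_mono (hh0.mul (hvb' n)).integrable (hh0.mul (BddMeas.const _)).integrable fun o =>
      mul_le_mul_of_nonneg_left ((le_abs_self _).trans (hvb n _)) (h0 o)
  rw [integral_mul_const] at h2
  linarith

/-- If `f` is a measurable coboundary then the martingale part has summable variances. -/
lemma summable_of_coboundary (hω : IsModulus ω) (hdiam : ∀ k, ∀ x y : 𝒳 k, dist x y ≤ 1)
    (ha : a ∈ Set.Ioo (0 : ℝ) 1) (hX : IsMarkovChain X μ)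
    {P : (j : ℕ) → Kernel (𝒳 (j + 1)) (𝒳 j)} [∀ j, IsMarkovKernel (P j)]
    (hP : ∀ j, HasCondDistrib (X j) (X (j + 1)) (P j) μ) {δ : ℝ} (hδ : δ ∈ Set.Ioo (0 : ℝ) 1)
    (hTV : ∀ j, ∀ x y : 𝒳 (j + 1), tvDistance (P j x) (P j y) ≤ δ * ω (dist x y))
    (hd : IsBoundedDecomp X μ a ω f M u D) {H : (j : ℕ) → PathFrom 𝒳 j → ℝ}
    (hH : IsMeasurableCoboundary X μ f H) :
    Summable fun k => ∫ o, M k (tailPath X k o) ^ 2 ∂μ := by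
  obtain ⟨E, hE0, hE⟩ := hd.exists_potential_bound hω hdiam ha hX hP hδ hTV
  have hM := hd.isBddRevMart hX.1
  set N : ℕ → Ω → ℝ := fun j o => M j (tailPath X j o) with hN
  have hG := futureSigma_le hX.1
  have hsq : ∀ n, ∫ o, icoSum N 0 n o ^ 2 ∂μ = ∑ k ∈ Finset.range n, ∫ o, N k o ^ 2 ∂μ :=
    fun n => by rw [hM.integral_sum_sq (Nat.zero_le n), Finset.range_eq_Ico]
  have hnn : ∀ k, 0 ≤ ∫ o, N k o ^ 2 ∂μ := fun k => integral_nonneg fun o => sq_nonneg _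
  set c := burkholderConst 1 with hc
  have hc0 : 0 ≤ c := by rw [hc]; unfold burkholderConst; positivity
  obtain ⟨V, hV⟩ := hM.exists_bound_of_sum_eq_sub
    (K := fun o => H 0 (tailPath X 0 o) - u 0 (tailPath X 0 o))
    (Z := fun n o => H n (tailPath X n o) - u n (tailPath X n o)
      - ∑ k ∈ Finset.Ico 0 n, ∫ o', f k (tailPath X k o') ∂μ)
    (((measurable_comp_tailPath (hH.1 0)).sub (measurable_comp_tailPath (hd.measurable_u 0))).mono
      (hG 0) le_rfl)
    (fun n => ((measurable_comp_tailPath (hH.1 n)).sub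
      (measurable_comp_tailPath (hd.measurable_u n))).sub_const
      _)
    (fun n => by
      filter_upwards [hd.sum_eq (Nat.zero_le n), hH.sum_eq (Nat.zero_le n)] with o h1 h2
      rw [h2] at h1
      linarith)
    -- The bound for `k = 1` and `B = s + E`, where `squareMomentBound` equals `2 * B` at `1` and `4
    -- * (2 * B + D ^ 2) * B` at `2`: quadratic in `B`, hence `O((1 + s) ^ 2)`.
    (C := 2 * c * (2 * c * (4 * (2 * (1 + E) ^ 2 + D ^ 2 * (1 + E))) + D ^ 2 * (2 * (1 + E))))
    (fun n => by
      set s := ∫ o, icoSum N 0 n o ^ 2 ∂μ with hs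
      have hs0 : 0 ≤ s := integral_nonneg fun o => sq_nonneg _
      have h1 := hM.integral_pow_le_of_potential (B := s + E) (n := n) (by positivity)
        (fun i hi h hh h0 => (hE i h hh h0).trans (mul_le_mul_of_nonneg_right (by
          rw [hs, hsq n]
          refine add_le_add ?_ le_rfl
          exact Finset.sum_le_sum_of_subset_of_nonneg (Finset.range_subset_range.2 hi)
            fun k _ _ => hnn k) (integral_nonneg h0))) (Nat.zero_le n) 1
      refine h1.trans ?_
      simp only [squareMomentBound, ← hc]
      norm_num
      have hB : s + E ≤ (1 + E) * (1 + s) := by nlinarith [mul_nonneg hE0 hs0]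
      have hB0 : 0 ≤ s + E := by positivity
      have h2 : s + E ≤ (1 + E) * (1 + s) ^ 2 := by nlinarith [mul_nonneg hE0 hs0]
      have h3 : (s + E) ^ 2 ≤ (1 + E) ^ 2 * (1 + s) ^ 2 := by
        rw [← mul_pow]
        exact pow_le_pow_left₀ hB0 hB 2
      have hD2 : 0 ≤ D ^ 2 := sq_nonneg D
      have h4 := mul_le_mul_of_nonneg_left h2 hD2
      have h5 : 2 * c * (4 * (2 * (s + E) + D ^ 2) * (s + E)) + D ^ 2 * (2 * (s + E))
          ≤ (2 * c * (4 * (2 * (1 + E) ^ 2 + D ^ 2 * (1 + E))) + D ^ 2 * (2 * (1 + E)))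
            * (1 + s) ^ 2 := by
        have h6 : 4 * (2 * (s + E) + D ^ 2) * (s + E)
            ≤ 4 * (2 * (1 + E) ^ 2 + D ^ 2 * (1 + E)) * (1 + s) ^ 2 := by nlinarith
        have h7 := mul_le_mul_of_nonneg_left h6 (show 0 ≤ 2 * c by positivity)
        nlinarith
      have h8 := mul_le_mul_of_nonneg_left h5 (show 0 ≤ 2 * c by positivity)
      nlinarith)
  exact summable_of_sum_range_le hnn fun n => (hsq n) ▸ hV n

lemma exists_moment_bound (hω : IsModulus ω) (hdiam : ∀ k, ∀ x y : 𝒳 k, dist x y ≤ 1)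
    (ha : a ∈ Set.Ioo (0 : ℝ) 1) (hX : IsMarkovChain X μ)
    {P : (j : ℕ) → Kernel (𝒳 (j + 1)) (𝒳 j)} [∀ j, IsMarkovKernel (P j)]
    (hP : ∀ j, HasCondDistrib (X j) (X (j + 1)) (P j) μ) {δ : ℝ} (hδ : δ ∈ Set.Ioo (0 : ℝ) 1)
    (hTV : ∀ j, ∀ x y : 𝒳 (j + 1), tvDistance (P j x) (P j y) ≤ δ * ω (dist x y))
    (hd : IsBoundedDecomp X μ a ω f M u D)
    (hV : Summable fun k => ∫ o, M k (tailPath X k o) ^ 2 ∂μ) (k : ℕ) :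
    ∃ C, ∀ j n, j ≤ n →
      ∫ o, icoSum (fun j o => M j (tailPath X j o)) j n o ^ (2 * k + 2) ∂μ ≤ C := by
  obtain ⟨E, hE0, hE⟩ := hd.exists_potential_bound hω hdiam ha hX hP hδ hTV
  have hM := hd.isBddRevMart hX.1
  have hnn : ∀ k, 0 ≤ ∫ o, M k (tailPath X k o) ^ 2 ∂μ := fun k =>
    integral_nonneg fun o => sq_nonneg _
  refine ⟨_, fun j n hjn => hM.integral_pow_le_of_potential
    (B := ∑' k, ∫ o, M k (tailPath X k o) ^ 2 ∂μ + E)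
    (add_nonneg (tsum_nonneg hnn) hE0) (fun i hi h hh h0 => (hE i h hh h0).trans
      (mul_le_mul_of_nonneg_right (add_le_add (hV.sum_le_tsum _ fun k _ => hnn k) le_rfl)
        (integral_nonneg h0))) hjn k⟩

/-- The tail sums of the martingale part converge almost surely and in every `L^p`. -/
lemma exists_remainder (hω : IsModulus ω) (hdiam : ∀ k, ∀ x y : 𝒳 k, dist x y ≤ 1)
    (ha : a ∈ Set.Ioo (0 : ℝ) 1) (hX : IsMarkovChain X μ)
    {P : (j : ℕ) → Kernel (𝒳 (j + 1)) (𝒳 j)} [∀ j, IsMarkovKernel (P j)]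
    (hP : ∀ j, HasCondDistrib (X j) (X (j + 1)) (P j) μ) {δ : ℝ} (hδ : δ ∈ Set.Ioo (0 : ℝ) 1)
    (hTV : ∀ j, ∀ x y : 𝒳 (j + 1), tvDistance (P j x) (P j y) ≤ δ * ω (dist x y))
    (hd : IsBoundedDecomp X μ a ω f M u D)
    (hV : Summable fun k => ∫ o, M k (tailPath X k o) ^ 2 ∂μ) :
    ∃ R : ℕ → Ω → ℝ,
      (∀ j, ∀ᵐ o ∂μ, Tendsto (fun n => icoSum (fun j o => M j (tailPath X j o)) j n o) atTop
        (𝓝 (R j o))) ∧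
      ∀ j, ∀ p : ℝ≥0∞, p ≠ ∞ → MemLp (R j) p μ ∧ Tendsto (fun n => eLpNorm
        (fun o => icoSum (fun j o => M j (tailPath X j o)) j n o - R j o) p μ) atTop (𝓝 0) := by
  have hM := hd.isBddRevMart hX.1
  have hmom := hd.exists_moment_bound hω hdiam ha hX hP hδ hTV hV
  set N : ℕ → Ω → ℝ := fun j o => M j (tailPath X j o) with hN
  -- All remainders come from a single limit by subtracting an initial sum.
  have hR : ∀ j, ∀ᵐ o ∂μ, Tendsto (fun n => icoSum N j n o) atTop
      (𝓝 (limUnder atTop (fun n => icoSum N 0 n o) - icoSum N 0 j o)) := by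
    intro j
    filter_upwards [hM.ae_exists_tendsto hV] with o ⟨l, hl⟩
    rw [hl.limUnder_eq]
    refine (hl.sub_const (icoSum N 0 j o)).congr' ?_
    filter_upwards [eventually_ge_atTop j] with n hn
    rw [icoSum_add (Nat.zero_le j) hn]
    ring
  exact ⟨_, hR, fun j p hp => hM.memLp_and_tendsto_eLpNorm hV hmom j (hR j) hp⟩

/-- Comparing the two expressions for the sum of `f` shows that `H j - u j + R` is the limit of
variables `Z n` measurable for ever later futures, hence constant; integrating identifies the
constant, as `u j` and `R` have mean zero. -/
lemma eq_of_coboundary (hX : IsMarkovChain X μ) (hω : IsModulus ω)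
    (hdiam : ∀ k, ∀ x y : 𝒳 k, dist x y ≤ 1)
    {P : (j : ℕ) → Kernel (𝒳 (j + 1)) (𝒳 j)} [∀ j, IsMarkovKernel (P j)]
    (hP : ∀ j, HasCondDistrib (X j) (X (j + 1)) (P j) μ) {δ : ℝ} (hδ : δ ∈ Set.Ioo (0 : ℝ) 1)
    (hTV : ∀ j, ∀ x y : 𝒳 (j + 1), tvDistance (P j x) (P j y) ≤ δ * ω (dist x y))
    (hd : IsBoundedDecomp X μ a ω f M u D) {j : ℕ} {R : Ω → ℝ}
    (hR : ∀ᵐ o ∂μ, Tendsto (fun n => icoSum (fun j o => M j (tailPath X j o)) j n o) atTop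
      (𝓝 (R o)))
    (hR1 : MemLp R 1 μ) (hRL : Tendsto (fun n => eLpNorm
        (fun o => icoSum (fun j o => M j (tailPath X j o)) j n o - R o) 1 μ) atTop (𝓝 0))
    {H : (j : ℕ) → PathFrom 𝒳 j → ℝ} (hH : IsMeasurableCoboundary X μ f H) :
    ∀ᵐ o ∂μ, H j (tailPath X j o)
      = (∫ x, H j x ∂(μ.map (tailPath X j))) + u j (tailPath X j o) - R o := by
  have hM := hd.isBddRevMart hX.1
  have hG := futureSigma_le hX.1
  set N : ℕ → Ω → ℝ := fun j o => M j (tailPath X j o) with hN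
  let Z : ℕ → Ω → ℝ := fun n o => H n (tailPath X n o) - u n (tailPath X n o)
    - ∑ k ∈ Finset.Ico j n, ∫ o', f k (tailPath X k o') ∂μ
  have hZm : ∀ n, Measurable[futureSigma X n] (Z n) := fun n =>
    ((measurable_comp_tailPath (hH.1 n)).sub (measurable_comp_tailPath (hd.measurable_u n))).sub_const _
  let W : Ω → ℝ := fun o => limsup (fun n => Z n o) atTop
  have hWm : ∀ i, Measurable[futureSigma X i] W := by
    intro i
    have e : W = fun o => limsup (fun n => Z (n + i) o) atTop := by
      funext o
      exact (limsup_nat_add (fun n => Z n o) i).symm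
    rw [e]
    exact Measurable.limsup fun n => (hZm (n + i)).mono (futureSigma_anti (Nat.le_add_left i n))
      le_rfl
  -- `W` is not yet known to be integrable, so tail triviality is applied to its arctangent, and the
  -- tangent recovers the constant.
  have hWb : ∀ i, BddMeas (futureSigma X i) fun o => Real.arctan (W o) := fun i =>
    ⟨Real.measurable_arctan.comp (hWm i), Real.pi / 2, fun o =>
      abs_le.2 ⟨(Real.neg_pi_div_two_lt_arctan _).le, (Real.arctan_lt_pi_div_two _).le⟩⟩
  have hconst := hX.ae_eq_integral_of_tail hP hδ.1.le hδ.2 (fun k x y => (hTV k x y).trans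
    (mul_le_of_le_one_right hδ.1.le (hω.dist_mem hdiam x y).2)) hWb
  set w := ∫ o, Real.arctan (W o) ∂μ
  have hsum : ∀ᵐ o ∂μ, ∀ n, j ≤ n →
      Z n o = H j (tailPath X j o) - u j (tailPath X j o) + icoSum N j n o := by
    refine ae_all_iff.2 fun n => ?_
    by_cases hjn : j ≤ n
    · filter_upwards [hd.sum_eq hjn, hH.sum_eq hjn] with o h1 h2 _
      rw [h2] at h1
      simp only [Z]
      linarith
    · exact ae_of_all _ fun o h => absurd h hjn
  have hW : ∀ᵐ o ∂μ, H j (tailPath X j o) = Real.tan w + u j (tailPath X j o) - R o := by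
    filter_upwards [hconst, hsum, hR] with o h1 h2 h3
    have h4 : Tendsto (fun n => Z n o) atTop
        (𝓝 (H j (tailPath X j o) - u j (tailPath X j o) + R o)) := by
      refine (h3.const_add _).congr' ?_
      filter_upwards [eventually_ge_atTop j] with n hn
      exact (h2 n hn).symm
    have h5 : W o = H j (tailPath X j o) - u j (tailPath X j o) + R o := h4.limsup_eq
    have h6 : Real.tan w = W o := by rw [← h1, Real.tan_arctan]
    linarith
  have hRint : ∫ o, R o ∂μ = 0 := by
    have hSint : ∀ n, Integrable (icoSum N j n) μ := fun n =>
      ((hM.bddMeas_sum j n).mono (hG j)).integrable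
    have h1 := tendsto_integral_of_L1' R hR1.1
      (Eventually.of_forall hSint) (l := atTop) hRL
    have h2 : ∀ n, ∫ o, icoSum N j n o ∂μ = 0 := fun n => by
      simpa using hM.integral_mul_sum j n (BddMeas.const 1)
    simp only [h2] at h1
    exact (tendsto_nhds_unique h1 tendsto_const_nhds)
  have hub : BddMeas m0 fun o => u j (tailPath X j o) :=
    (BddMeas.comp_tailPath (X := X) ⟨hd.measurable_u j, D, hd.bound_u j⟩).mono (hG j)
  have hmean : ∫ x, H j x ∂(μ.map (tailPath X j)) = Real.tan w := by
    rw [integral_map (measurable_tailPath hX.1 j).aemeasurable (hH.1 j).aestronglyMeasurable,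
      integral_congr_ae hW, integral_sub ((BddMeas.const _).add hub).integrable
        (memLp_one_iff_integrable.1 hR1), integral_add (integrable_const _) hub.integrable,
      hd.mean_u j, hRint]
    simp
  rw [hmean]
  exact hW

lemma memLp_of_coboundary (hX : IsMarkovChain X μ) (hd : IsBoundedDecomp X μ a ω f M u D)
    {H : (j : ℕ) → PathFrom 𝒳 j → ℝ} (hH : IsMeasurableCoboundary X μ f H) {j : ℕ} {R : Ω → ℝ}
    {c : ℝ} {s : ℝ≥0∞} (hR : MemLp R s μ)
    (h : ∀ᵐ o ∂μ, H j (tailPath X j o) = c + u j (tailPath X j o) - R o) :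
    MemLp (H j) s (μ.map (tailPath X j)) := by
  have hub : BddMeas m0 fun o => u j (tailPath X j o) :=
    (BddMeas.comp_tailPath (X := X) ⟨hd.measurable_u j, D, hd.bound_u j⟩).mono
      (futureSigma_le hX.1 j)
  rw [memLp_map_measure_iff (hH.1 j).aestronglyMeasurable (measurable_tailPath hX.1 j).aemeasurable]
  have h1 : MemLp (fun o => c + u j (tailPath X j o) - R o) s μ :=
    (((BddMeas.const c).add hub).memLp s).sub hR
  exact h1.ae_eq (by filter_upwards [h] with o ho using ho.symm)

/-- A decomposition with summable variances yields a measurable coboundary. -/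
lemma exists_coboundary (hX : IsMarkovChain X μ) (hd : IsBoundedDecomp X μ a ω f M u D)
    (hV : Summable fun k => ∫ o, M k (tailPath X k o) ^ 2 ∂μ) :
    ∃ H : (j : ℕ) → PathFrom 𝒳 j → ℝ, IsMeasurableCoboundary X μ f H := by
  have hM := hd.isBddRevMart hX.1
  set N : ℕ → Ω → ℝ := fun j o => M j (tailPath X j o) with hN
  have hr : ∀ j, ∃ r : PathFrom 𝒳 j → ℝ, Measurable r ∧
      (fun o => limsup (fun n => icoSum N j n o) atTop) = r ∘ tailPath X j := by
    intro j
    have h1 : Measurable[futureSigma X j] fun o => limsup (fun n => icoSum N j n o) atTop :=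
      Measurable.limsup fun n => (hM.bddMeas_sum j n).1
    rw [futureSigma_eq] at h1
    exact h1.exists_eq_measurable_comp
  choose r hrm hr using hr
  -- The partial sums of the means compensate the term `E f_j` in the decomposition.
  refine ⟨fun j x => u j x - r j x + ∑ k ∈ Finset.range j, ∫ o', f k (tailPath X k o') ∂μ,
    fun j => ((hd.measurable_u j).sub (hrm j)).add_const _, fun j => ?_⟩
  filter_upwards [hd.decomp j, hM.ae_exists_tendsto hV] with o h1 ⟨l, hl⟩
  have h2 : ∀ i, r i (tailPath X i o) = l - icoSum N 0 i o := by
    intro i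
    have h3 : Tendsto (fun n => icoSum N i n o) atTop (𝓝 (l - icoSum N 0 i o)) := by
      refine (hl.sub_const (icoSum N 0 i o)).congr' ?_
      filter_upwards [eventually_ge_atTop i] with n hn
      rw [icoSum_add (Nat.zero_le i) hn]
      ring
    rw [← h3.limsup_eq]
    exact (congrFun (hr i) o).symm
  rw [h1, h2, h2, Finset.sum_range_succ, icoSum_add (Nat.zero_le j) (Nat.le_succ j)]
  simp only [icoSum, hN, Nat.Ico_succ_singleton, Finset.sum_singleton]
  ring

end IsBoundedDecomp

end Decomposition

/-! ### Variance comparison -/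

section Variance

variable {Ω : Type*} [m0 : MeasurableSpace Ω] {μ : Measure Ω} [IsProbabilityMeasure μ]
  {𝒳 : ℕ → Type*} [∀ k, MetricSpace (𝒳 k)] [∀ k, MeasurableSpace (𝒳 k)]
  {X : (k : ℕ) → Ω → 𝒳 k} {ω : ℝ → ℝ} {a : ℝ} {f M u : (j : ℕ) → PathFrom 𝒳 j → ℝ} {D : ℝ}

lemma BddMeas.evariance_eq {Y : Ω → ℝ} (hY : BddMeas m0 Y) :
    evariance Y μ = ENNReal.ofReal (∫ o, (Y o - ∫ o', Y o' ∂μ) ^ 2 ∂μ) := by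
  rw [← (hY.memLp 2).ofReal_variance_eq, variance_eq_integral hY.1.aemeasurable]

namespace IsBoundedDecomp

lemma evariance_eq (hX : ∀ k, Measurable (X k)) (hd : IsBoundedDecomp X μ a ω f M u D) (j : ℕ) :
    evariance (fun o => M j (tailPath X j o)) μ
      = ENNReal.ofReal (∫ o, M j (tailPath X j o) ^ 2 ∂μ) := by
  have hM := hd.isBddRevMart hX
  have h0 : ∫ o, M j (tailPath X j o) ∂μ = 0 := by
    simpa using hd.orth j (fun _ => 1) (BddMeas.const 1)
  rw [BddMeas.evariance_eq ((hM.bddMeas j).mono (hM.le j)), h0]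
  simp

lemma summable_iff (hX : ∀ k, Measurable (X k)) (hd : IsBoundedDecomp X μ a ω f M u D) :
    ∑' j, evariance (fun o => M j (tailPath X j o)) μ < ∞
      ↔ Summable fun k => ∫ o, M k (tailPath X k o) ^ 2 ∂μ := by
  have hnn : ∀ k, 0 ≤ ∫ o, M k (tailPath X k o) ^ 2 ∂μ := fun k =>
    integral_nonneg fun o => sq_nonneg _
  simp only [hd.evariance_eq hX]
  constructor
  · intro h
    have := ENNReal.summable_toReal h.ne
    simpa only [ENNReal.toReal_ofReal (hnn _)] using this
  · intro h
    rw [← ENNReal.ofReal_tsum_of_nonneg hnn h]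
    exact ENNReal.ofReal_lt_top

/-- The variances of `S_n f` and of the martingale part are comparable. -/
lemma exists_variance_comparison (hω : IsModulus ω) (hdiam : ∀ k, ∀ x y : 𝒳 k, dist x y ≤ 1)
    (ha : a ∈ Set.Ioo (0 : ℝ) 1) (hX : ∀ k, Measurable (X k)) (hf : IsOmegaRegular X μ a ω f)
    (hd : IsBoundedDecomp X μ a ω f M u D) (n : ℕ) :
    ∃ v : ℝ, 0 ≤ v ∧ evariance (partialSum X f n) μ = ENNReal.ofReal v ∧
      ∑ k ∈ Finset.range n, ∫ o, M k (tailPath X k o) ^ 2 ∂μ ≤ 2 * v + 8 * D ^ 2 ∧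
      v ≤ 2 * ∑ k ∈ Finset.range n, ∫ o, M k (tailPath X k o) ^ 2 ∂μ + 8 * D ^ 2 := by
  obtain ⟨C, hC0, hC, -⟩ := hf.exists_bound hω hdiam ha hX
  have hG := futureSigma_le hX
  have hM := hd.isBddRevMart hX
  have hfb : ∀ k, BddMeas m0 fun o => f k (tailPath X k o) := fun k =>
    (BddMeas.comp_tailPath (X := X) ⟨hf.1 k, C, hC k⟩).mono (hG k)
  have hS : BddMeas m0 (partialSum X f n) := BddMeas.sum fun k _ => hfb k
  have hT := (hM.bddMeas_sum 0 n).mono (hG 0)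
  have hmean : ∫ o, partialSum X f n o ∂μ
      = ∑ k ∈ Finset.Ico 0 n, ∫ o', f k (tailPath X k o') ∂μ := by
    rw [← Finset.range_eq_Ico]
    exact integral_finsetSum _ fun k _ => (hfb k).integrable
  have hsq := hM.integral_sum_sq (Nat.zero_le n)
  rw [← Finset.range_eq_Ico] at hsq
  have hY := (hS.sub (BddMeas.const (∫ o', partialSum X f n o' ∂μ))).pow 2
  have hD := hd.nonneg
  have hrel : ∀ᵐ o ∂μ, partialSum X f n o - ∫ o', partialSum X f n o' ∂μ
      = icoSum (fun j o => M j (tailPath X j o)) 0 n o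
        + (u n (tailPath X n o) - u 0 (tailPath X 0 o)) := by
    filter_upwards [hd.sum_eq (Nat.zero_le n)] with o ho
    rw [hmean, partialSum, Finset.range_eq_Ico, ho]
    ring
  -- The boundary term is at most `2 * D`; with `(x + y) ^ 2 ≤ 2 * x ^ 2 + 2 * y ^ 2` this gives `8
  -- * D ^ 2` in both comparisons.
  have hu : ∀ o, (u n (tailPath X n o) - u 0 (tailPath X 0 o)) ^ 2 ≤ 4 * D ^ 2 := fun o => by
    have h1 := abs_le.1 (hd.bound_u n (tailPath X n o))
    have h2 := abs_le.1 (hd.bound_u 0 (tailPath X 0 o))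
    nlinarith
  refine ⟨∫ o, (partialSum X f n o - ∫ o', partialSum X f n o' ∂μ) ^ 2 ∂μ,
    integral_nonneg fun o => sq_nonneg _, BddMeas.evariance_eq hS, ?_, ?_⟩
  · rw [← hsq]
    have h1 : ∫ o, icoSum (fun j o => M j (tailPath X j o)) 0 n o ^ 2 ∂μ
        ≤ ∫ o, (2 * (partialSum X f n o - ∫ o', partialSum X f n o' ∂μ) ^ 2 + 8 * D ^ 2) ∂μ := by
      refine integral_mono_ae (hT.pow 2).integrable
        ((hY.const_mul 2).add (BddMeas.const _)).integrable ?_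
      filter_upwards [hrel] with o ho
      rw [ho]
      nlinarith [hu o, sq_nonneg (icoSum (fun j o => M j (tailPath X j o)) 0 n o
        + 2 * (u n (tailPath X n o) - u 0 (tailPath X 0 o)))]
    rwa [integral_add (hY.const_mul 2).integrable (integrable_const _), integral_const_mul,
      integral_const, probReal_univ, one_smul] at h1
  · rw [← hsq]
    have h1 : ∫ o, (partialSum X f n o - ∫ o', partialSum X f n o' ∂μ) ^ 2 ∂μ
        ≤ ∫ o, (2 * icoSum (fun j o => M j (tailPath X j o)) 0 n o ^ 2 + 8 * D ^ 2) ∂μ := by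
      refine integral_mono_ae hY.integrable
        (((hT.pow 2).const_mul 2).add (BddMeas.const _)).integrable ?_
      filter_upwards [hrel] with o ho
      rw [ho]
      nlinarith [hu o, sq_nonneg (icoSum (fun j o => M j (tailPath X j o)) 0 n o
        - (u n (tailPath X n o) - u 0 (tailPath X 0 o)))]
    rwa [integral_add ((hT.pow 2).const_mul 2).integrable (integrable_const _), integral_const_mul,
      integral_const, probReal_univ, one_smul] at h1

lemma summable_of_liminf (hω : IsModulus ω) (hdiam : ∀ k, ∀ x y : 𝒳 k, dist x y ≤ 1)
    (ha : a ∈ Set.Ioo (0 : ℝ) 1) (hX : ∀ k, Measurable (X k)) (hf : IsOmegaRegular X μ a ω f)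
    (hd : IsBoundedDecomp X μ a ω f M u D)
    (h : liminf (fun n => evariance (partialSum X f n) μ) atTop < ∞) :
    Summable fun k => ∫ o, M k (tailPath X k o) ^ 2 ∂μ := by
  have hnn : ∀ k, 0 ≤ ∫ o, M k (tailPath X k o) ^ 2 ∂μ := fun k =>
    integral_nonneg fun o => sq_nonneg _
  obtain ⟨c, hc1, hc2⟩ := exists_between h
  have hfreq := frequently_lt_of_liminf_lt (by isBoundedDefault) hc1
  refine summable_of_sum_range_le (c := 2 * c.toReal + 8 * D ^ 2) hnn fun n => ?_
  -- The sums of the martingale variances are monotone, so a bound along infinitely many `m` bounds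
  -- them all.
  obtain ⟨m, hm, hmc⟩ := (frequently_atTop.1 hfreq) n
  obtain ⟨v, hv0, hv, h1, -⟩ := hd.exists_variance_comparison hω hdiam ha hX hf m
  rw [hv] at hmc
  have h2 : v ≤ c.toReal := (ENNReal.ofReal_le_iff_le_toReal hc2.ne).1 hmc.le
  have h3 := Finset.sum_le_sum_of_subset_of_nonneg (Finset.range_subset_range.2 hm)
    (f := fun k => ∫ o, M k (tailPath X k o) ^ 2 ∂μ) fun k _ _ => hnn k
  linarith

lemma iSup_evariance_lt_top (hω : IsModulus ω) (hdiam : ∀ k, ∀ x y : 𝒳 k, dist x y ≤ 1)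
    (ha : a ∈ Set.Ioo (0 : ℝ) 1) (hX : ∀ k, Measurable (X k)) (hf : IsOmegaRegular X μ a ω f)
    (hd : IsBoundedDecomp X μ a ω f M u D)
    (hV : Summable fun k => ∫ o, M k (tailPath X k o) ^ 2 ∂μ) :
    ⨆ n, evariance (partialSum X f n) μ < ∞ := by
  refine lt_of_le_of_lt (iSup_le fun n => ?_) (ENNReal.ofReal_lt_top
    (r := 2 * ∑' k, ∫ o, M k (tailPath X k o) ^ 2 ∂μ + 8 * D ^ 2))
  obtain ⟨v, hv0, hv, -, h1⟩ := hd.exists_variance_comparison hω hdiam ha hX hf n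
  rw [hv]
  refine ENNReal.ofReal_le_ofReal (h1.trans ?_)
  gcongr
  exact hV.sum_le_tsum _ fun k _ => integral_nonneg fun o => sq_nonneg _

end IsBoundedDecomp

end Variance

/-! ### The main theorem -/

theorem mainTheorem6 {Ω : Type*} [MeasurableSpace Ω] (μ : Measure Ω) [IsProbabilityMeasure μ]
    {𝒳 : ℕ → Type*} [∀ k, MetricSpace (𝒳 k)] [∀ k, MeasurableSpace (𝒳 k)]
    -- the spaces have diameter at most one
    (hdiam : ∀ k, ∀ x y : 𝒳 k, dist x y ≤ 1)
    (ω : ℝ → ℝ) (hω : IsModulus ω) (a : ℝ) (ha : a ∈ Set.Ioo (0 : ℝ) 1)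
    (X : (k : ℕ) → Ω → 𝒳 k) (hX : IsMarkovChain X μ)
    -- `P j x` is the law of `X j` given `X (j+1) = x`
    (P : (j : ℕ) → Kernel (𝒳 (j + 1)) (𝒳 j)) [∀ j, IsMarkovKernel (P j)]
    (hP : ∀ j, HasCondDistrib (X j) (X (j + 1)) (P j) μ)
    -- the contraction and equicontinuity assumption
    (hTV : ∃ δ ∈ Set.Ioo (0 : ℝ) 1, ∀ j, ∀ x y : 𝒳 (j + 1),
      tvDistance (P j x) (P j y) ≤ δ * ω (dist x y))
    (f : (j : ℕ) → PathFrom 𝒳 j → ℝ) (hf : IsOmegaRegular X μ a ω f) :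
    [liminf (fun n => evariance (partialSum X f n) μ) atTop < ∞,
      ⨆ n, evariance (partialSum X f n) μ < ∞,
      ∃ M u : (j : ℕ) → PathFrom 𝒳 j → ℝ, IsMartingaleCoboundaryDecomp X μ a ω f M u,
      ∃ H : (j : ℕ) → PathFrom 𝒳 j → ℝ, IsMeasurableCoboundary X μ f H].TFAE ∧
    -- every such `H` has finite moments of all orders
    (∀ H : (j : ℕ) → PathFrom 𝒳 j → ℝ, IsMeasurableCoboundary X μ f H →
      ∀ j, ∀ s : ℝ≥0∞, s ≠ ∞ → MemLp (H j) s (μ.map (tailPath X j))) ∧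
    -- `R j` is the sum of the series `∑_{k ≥ j} M_k(X_k, X_{k+1}, …)`
    (∀ M u : (j : ℕ) → PathFrom 𝒳 j → ℝ, IsMartingaleCoboundaryDecomp X μ a ω f M u →
      ∃ R : ℕ → Ω → ℝ,
        (∀ j, ∀ᵐ o ∂μ, Tendsto (fun n => ∑ k ∈ Finset.Ico j n, M k (tailPath X k o)) atTop
          (𝓝 (R j o))) ∧
        (∀ j, ∀ p : ℝ≥0∞, p ≠ ∞ → MemLp (R j) p μ ∧
          Tendsto (fun n => eLpNorm
            (fun o => ∑ k ∈ Finset.Ico j n, M k (tailPath X k o) - R j o) p μ) atTop (𝓝 0)) ∧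
        ∀ H : (j : ℕ) → PathFrom 𝒳 j → ℝ, IsMeasurableCoboundary X μ f H →
          ∀ j, ∀ᵐ o ∂μ, H j (tailPath X j o) =
            (∫ x, H j x ∂(μ.map (tailPath X j))) + u j (tailPath X j o) - R j o) := by
  obtain ⟨δ, hδ, hTV⟩ := hTV
  -- This decomposition exists unconditionally; only the summability of its variances depends on
  -- (1)–(4).
  obtain ⟨M₀, u₀, D₀, hd₀, hd₀'⟩ := exists_decomp hω hdiam ha hX hP hδ hTV hf
  refine ⟨?_, fun H hH j s hs => ?_, fun M u hMu => ?_⟩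
  · tfae_have 2 → 1 := fun h => lt_of_le_of_lt
      (liminf_le_of_frequently_le' (Eventually.frequently (Eventually.of_forall fun n =>
        le_iSup (fun n => evariance (partialSum X f n) μ) n))) h
    tfae_have 1 → 3 := fun h => ⟨M₀, u₀, hd₀' ((hd₀.summable_iff hX.1).2
      (hd₀.summable_of_liminf hω hdiam ha hX.1 hf h))⟩
    tfae_have 3 → 2 := by
      rintro ⟨M, u, hMu⟩
      obtain ⟨D, hd⟩ := hMu.exists_isBoundedDecomp hω hdiam ha hX.1
      exact hd.iSup_evariance_lt_top hω hdiam ha hX.1 hf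
        ((hd.summable_iff hX.1).1 hMu.summable_var)
    tfae_have 3 → 4 := by
      rintro ⟨M, u, hMu⟩
      obtain ⟨D, hd⟩ := hMu.exists_isBoundedDecomp hω hdiam ha hX.1
      exact hd.exists_coboundary hX ((hd.summable_iff hX.1).1 hMu.summable_var)
    tfae_have 4 → 3 := fun ⟨H, hH⟩ => ⟨M₀, u₀, hd₀' ((hd₀.summable_iff hX.1).2
      (hd₀.summable_of_coboundary hω hdiam ha hX hP hδ hTV hH))⟩
    tfae_finish
  · obtain ⟨R, hR, hRp⟩ := hd₀.exists_remainder hω hdiam ha hX hP hδ hTV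
      (hd₀.summable_of_coboundary hω hdiam ha hX hP hδ hTV hH)
    exact hd₀.memLp_of_coboundary hX hH (hRp j s hs).1 (hd₀.eq_of_coboundary hX hω hdiam hP hδ hTV
      (hR j) (hRp j 1 ENNReal.one_ne_top).1 (hRp j 1 ENNReal.one_ne_top).2 hH)
  · obtain ⟨D, hd⟩ := hMu.exists_isBoundedDecomp hω hdiam ha hX.1
    obtain ⟨R, hR, hRp⟩ := hd.exists_remainder hω hdiam ha hX hP hδ hTV
      ((hd.summable_iff hX.1).1 hMu.summable_var)
    exact ⟨R, hR, hRp, fun H hH j => hd.eq_of_coboundary hX hω hdiam hP hδ hTV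
      (hR j) (hRp j 1 ENNReal.one_ne_top).1 (hRp j 1 ENNReal.one_ne_top).2 hH⟩
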